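/- For $V>0$ let $\mathcal A_V$ be the set of pairs $(u,h)$ with $h\in H^1(\mathbb R)$ (identified with its continuous representative), $h\ge 0$, $\int_{\mathbb R}h\,dx=V$, $u\in H^1(\Omega_h)$, where $\Omega_h=\{(x,y)\in\mathbb R^2: 0<y<h(x)\}$, and $u(x,0)=x$ on $\{h>0\}$ in the sense of traces. Let $$F_s(V)=\inf\Big\{\int_{\Omega_h}|\nabla u|^2\,dx\,dy+\int_{\mathbb R}h'^2\,dx\ :\ (u,h)\in\mathcal A_V\Big\},$$ and call $(u,h)\in\mathcal A_V$ a minimizer for the volume $V$ if it attains this infimum. Theorem. Let $V_n\to+\infty$, and for every $n$ let $(u_{V_n},h_{V_n})$ be a minimizer for the volume $V_n$. Put $\tilde h_{V_n}(x)=V_n^{-3/5}\,h_{V_n}(V_n^{2/5}x)$. Then there are a subsequence $(n_k)$, translations $\tau_k\in\mathbb R$ and a function $h$ such that $\tilde h_{V_{n_k}}(\cdot-\tau_k)\to h$ in $L^\infty(\mathbb R)$ as $k\to\infty$, and $h$ minimizes the functional $$G(h)=\Big(\inf_{u(x,0)=x}\int_{\{h>0\}\times(0,+\infty)}|\nabla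 u|^2\,dx\,dy\Big)+\int_{\mathbb R}h'^2\,dx$$ among all $h\in H^1(\mathbb R)$ with $h\ge0$ and $\int_{\mathbb R}h\,dx=1$. Here the infimum (with value in $[0,\infty]$) is over all weakly differentiable $u$ on $\{h>0\}\times(0,\infty)$, integrable together with $\nabla u$ locally up to the bottom boundary $\{h>0\}\times\{0\}$, whose trace there is $u(x,0)=x$. -/

import Mathlib

open MeasureTheory Filter Topology Set
open scoped ENNReal ContDiff

noncomputable section

namespace Film

/-- `g` is the weak (distributional) derivative of `u` in direction `v` on the open set `Ω`. -/
def HasWeakDeriv {E : Type*} [NormedAddCommGroup E] [NormedSpace ℝ E] [MeasureSpace E]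
    (Ω : Set E) (v : E) (u g : E → ℝ) : Prop :=
  LocallyIntegrableOn u Ω volume ∧ LocallyIntegrableOn g Ω volume ∧
  ∀ φ : E → ℝ, ContDiff ℝ ∞ φ → HasCompactSupport φ → tsupport φ ⊆ Ω →
    ∫ x in Ω, u x * fderiv ℝ φ x v = - ∫ x in Ω, g x * φ x

/-- `h ∈ H¹(ℝ)`; `h` is taken to be the continuous representative. -/
def MemH1Line (h : ℝ → ℝ) : Prop :=
  Continuous h ∧ MemLp h 2 volume ∧ ∃ g : ℝ → ℝ, HasWeakDeriv univ 1 h g ∧ MemLp g 2 volume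

/-- `u ∈ H¹(Ω)` for an open subset `Ω` of the plane. -/
def MemH1Plane (Ω : Set (ℝ × ℝ)) (u : ℝ × ℝ → ℝ) : Prop :=
  MemLp u 2 (volume.restrict Ω) ∧
  ∃ g₁ g₂ : ℝ × ℝ → ℝ, HasWeakDeriv Ω (1, 0) u g₁ ∧ HasWeakDeriv Ω (0, 1) u g₂ ∧
    MemLp g₁ 2 (volume.restrict Ω) ∧ MemLp g₂ 2 (volume.restrict Ω)

/-- The surface energy `∫ h'²`, where `h'` is the weak derivative. As the weak derivative is unique
up to a null set, the infimum ranges over one value (and it is `∞` if there is no weak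
derivative). -/
def surfaceEnergy (h : ℝ → ℝ) : ℝ≥0∞ :=
  ⨅ (g : ℝ → ℝ) (_ : HasWeakDeriv univ 1 h g), ∫⁻ x, ENNReal.ofReal (g x ^ 2)

/-- The Dirichlet energy `∫_Ω |∇u|²`, where `∇u` is the weak gradient. As the weak gradient is
unique up to a null set, the infimum ranges over one value (and it is `∞` if there is no weak
gradient). -/
def dirichletEnergy (Ω : Set (ℝ × ℝ)) (u : ℝ × ℝ → ℝ) : ℝ≥0∞ :=
  ⨅ (g₁ : ℝ × ℝ → ℝ) (g₂ : ℝ × ℝ → ℝ) (_ : HasWeakDeriv Ω (1, 0) u g₁)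
    (_ : HasWeakDeriv Ω (0, 1) u g₂), ∫⁻ p in Ω, ENNReal.ofReal (g₁ p ^ 2 + g₂ p ^ 2)

/-- The part of `D` in the open upper half plane. -/
def upperPart (D : Set (ℝ × ℝ)) : Set (ℝ × ℝ) := {p ∈ D | 0 < p.2}

/-- For an open set `D` of the plane, `u` has on the bottom boundary `D ∩ {y = 0}` of
`D ∩ {y > 0}` the trace `t(x)`. The trace is defined, as usual, through the integration by parts
formula against test functions that do not have to vanish on `D ∩ {y = 0}`; `u` and its weak
`y`-derivative `g` are locally integrable up to this part of the boundary. -/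
def HasBottomTrace (D : Set (ℝ × ℝ)) (u : ℝ × ℝ → ℝ) (t : ℝ → ℝ) : Prop :=
  ∃ g : ℝ × ℝ → ℝ, HasWeakDeriv (upperPart D) (0, 1) u g ∧
    LocallyIntegrableOn u {p ∈ D | 0 ≤ p.2} volume ∧
    LocallyIntegrableOn g {p ∈ D | 0 ≤ p.2} volume ∧
    ∀ φ : ℝ × ℝ → ℝ, ContDiff ℝ ∞ φ → HasCompactSupport φ → tsupport φ ⊆ D →
      ∫ p in upperPart D, u p * fderiv ℝ φ p (0, 1) =
        - (∫ p in upperPart D, g p * φ p) - ∫ x in {x : ℝ | (x, 0) ∈ D}, t x * φ (x, 0)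

/-- The film `Ω_h = {(x, y) : 0 < y < h x}`. -/
def film (h : ℝ → ℝ) : Set (ℝ × ℝ) := {p | 0 < p.2 ∧ p.2 < h p.1}

/-- The film together with the substrate below it; its upper part is `Ω_h`, its bottom boundary
is `{h > 0} × {0}`. -/
def filmAndSubstrate (h : ℝ → ℝ) : Set (ℝ × ℝ) := {p | 0 < h p.1 ∧ p.2 < h p.1}

theorem upperPart_filmAndSubstrate (h : ℝ → ℝ) : upperPart (filmAndSubstrate h) = film h := by
  ext p
  change ((0 < h p.1 ∧ p.2 < h p.1) ∧ 0 < p.2) ↔ (0 < p.2 ∧ p.2 < h p.1)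
  constructor
  · rintro ⟨⟨_, h2⟩, h3⟩
    exact ⟨h3, h2⟩
  · rintro ⟨h1, h2⟩
    exact ⟨⟨h1.trans h2, h2⟩, h1⟩

/-- Profiles of volume `V`: `h ∈ H¹(ℝ)`, `h ≥ 0`, `∫ h = V`. -/
def IsProfile (V : ℝ) (h : ℝ → ℝ) : Prop :=
  MemH1Line h ∧ (∀ x, 0 ≤ h x) ∧ Integrable h volume ∧ ∫ x, h x = V

/-- The admissible pairs `(u, h) ∈ 𝒜_V`. -/
def IsAdmissible (V : ℝ) (u : ℝ × ℝ → ℝ) (h : ℝ → ℝ) : Prop :=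
  IsProfile V h ∧ MemH1Plane (film h) u ∧ HasBottomTrace (filmAndSubstrate h) u (fun x => x)

/-- The energy `∫_{Ω_h} |∇u|² + ∫ h'²`. -/
def energy (u : ℝ × ℝ → ℝ) (h : ℝ → ℝ) : ℝ≥0∞ :=
  dirichletEnergy (film h) u + surfaceEnergy h

/-- The minimal energy `F_s(V)`. -/
def minEnergy (V : ℝ) : ℝ≥0∞ :=
  ⨅ (u : ℝ × ℝ → ℝ) (h : ℝ → ℝ) (_ : IsAdmissible V u h), energy u h

/-- `(u, h)` is a minimizer for the volume `V`. -/
def IsMinimizer (V : ℝ) (u : ℝ × ℝ → ℝ) (h : ℝ → ℝ) : Prop :=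
  IsAdmissible V u h ∧ energy u h = minEnergy V

/-- The rescaled profile `x ↦ V^{-3/5} h(V^{2/5} x)`. -/
def rescaled (V : ℝ) (h : ℝ → ℝ) (x : ℝ) : ℝ :=
  V ^ (-(3 / 5) : ℝ) * h (V ^ (2 / 5 : ℝ) * x)

/-- The infimum of `∫_{I × (0,∞)} |∇u|²` over the functions `u` on `I × (0,∞)` with `u(x,0) = x`
on `I`. -/
def stripEnergy (I : Set ℝ) : ℝ≥0∞ :=
  ⨅ (u : ℝ × ℝ → ℝ) (_ : HasBottomTrace (I ×ˢ univ) u (fun x => x)),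
    dirichletEnergy (I ×ˢ Ioi 0) u

/-- The limit functional `G`. -/
def limitEnergy (h : ℝ → ℝ) : ℝ≥0∞ :=
  stripEnergy {x | 0 < h x} + surfaceEnergy h

/-- `h` minimizes `G` among the profiles of volume one. -/
def IsLimitMinimizer (h : ℝ → ℝ) : Prop :=
  IsProfile 1 h ∧ ∀ g : ℝ → ℝ, IsProfile 1 g → limitEnergy h ≤ limitEnergy g

end Film

end

/-! In the variables $x=V^{2/5}\tilde x$, $h=V^{3/5}\tilde h$ the strip energy over $\{h>0\}$ and
the surface energy both scale like $V^{4/5}$, while the ratio of height to width grows like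
$V^{1/5}$. In the limit the film therefore acts like the infinite strip over $\{h>0\}$. Let
$\kappa=\inf G$ over profiles of volume one (`minLimitEnergy`); it is positive and finite.

Upper bound. For a compactly supported profile, the extremal function of the strip restricted to the
film is admissible, so $F_s(V)\le\kappa V^{4/5}$ (`minEnergy_le`).

Duality. Pairing $\nabla u$ with a rotated gradient $(-\psi_y,\psi_x)$ and integrating by parts
leaves the boundary term $\int\psi(x,0)\,dx$. Hence the Dirichlet energy is at least
$2\int\psi(x,0)\,dx-\int_{y>0}|\nabla\psi|^2$ for every test function $\psi$ in the film and
substrate (`dualEnergy_le_dirichletEnergy`). On strips the supremum of these values is the infimum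
of the energy (`stripEnergy_eq_dualEnergy`), by Riesz representation and vertical integration of the
extremal field. A supremum over test functions is monotone in the domain, superadditive over
disjoint domains and lower semicontinuous, so all lower bounds are proved on the dual side.

Lower bound. Let $h$ be a minimizing profile, $d>0$ small and $M=d^3V^{3/5}$. The dual test function
$(\alpha w-y)^+$ with $w\approx\min(h,M)$ and $\alpha=d^{-1}V^{-1/5}$ shows that the part of $h$
below height $M$ has volume $O(dV)$ (`IsProfile.mul_integral_min_le`). A test function of the strip
over $\{h>M\}$ can be cut off at height $M$ so as to fit into the film; since $|\{h>M\}|\le V/M$,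
Poincaré's inequality bounds the loss by a factor $(1+KV/M^2)^2$ with $V/M^2=d^{-6}V^{-1/5}\to0$
(`dualEnergy_superlevel_le`). So $(h-M)^+$, rescaled, has compact support, volume close to $1$,
limit energy at most $(1+o(1))\kappa$, and uniform distance at most $d^3$ from $\tilde h$
(`IsMinimizer.exists_profile_near`).

Compactness. Cutting a profile at a zero does not increase the total limit energy, and a piece of
volume $s$ has energy at least $\kappa s^{4/5}$. Strict subadditivity of $s\mapsto s^{4/5}$ leaves
nearly all mass of an almost minimizer on the component of its median
(`IsProfile.exists_main_component`). The length of this component is bounded, because the strip over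
an interval of length $\ell$ costs at least $c\ell^2$. Off it the profile is uniformly small, since
bounded slope energy and small mass bound $\sup h^3$. After translation, Arzelà–Ascoli gives a
uniform limit of volume one, and lower semicontinuity makes it a minimizer
(`exists_subseq_tendsto_of_minimizing`). A diagonal choice $d\to0$ transfers the convergence to
$\tilde h$. -/

noncomputable section

namespace Film

/-! ### Riesz representation and test functions -/

/-- Riesz representation of a functional that is bounded in terms of a linear map into a Hilbert
space. -/
theorem exists_inner_eq_of_sq_le {E H : Type*} [AddCommGroup E] [Module ℝ E]
    [NormedAddCommGroup H] [InnerProductSpace ℝ H] [CompleteSpace H]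
    (A : E →ₗ[ℝ] H) (l : E →ₗ[ℝ] ℝ) {C : ℝ} (hC : 0 ≤ C)
    (h : ∀ e, l e ^ 2 ≤ C * ‖A e‖ ^ 2) :
    ∃ F : H, ‖F‖ ^ 2 ≤ C ∧ ∀ e, inner ℝ F (A e) = l e := by
  have hle : ∀ e, |l e| ≤ √C * ‖A e‖ := fun e => by
    rw [← Real.sqrt_sq (norm_nonneg (A e)), ← Real.sqrt_mul hC]
    exact Real.abs_le_sqrt (h e)
  have hker : LinearMap.ker A ≤ LinearMap.ker l := fun e he => by
    have h1 := hle e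
    rw [LinearMap.mem_ker.1 he, norm_zero, mul_zero] at h1
    exact LinearMap.mem_ker.2 (abs_nonpos_iff.1 h1)
  let f₀ : LinearMap.range A →ₗ[ℝ] ℝ :=
    ((LinearMap.ker A).liftQ l hker) ∘ₗ A.quotKerEquivRange.symm.toLinearMap
  have hf₀ : ∀ e, f₀ ⟨A e, LinearMap.mem_range_self A e⟩ = l e := fun e => by
    have h1 : A.quotKerEquivRange.symm ⟨A e, LinearMap.mem_range_self A e⟩
        = (LinearMap.ker A).mkQ e := by
      rw [LinearEquiv.symm_apply_eq]
      rfl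
    change (LinearMap.ker A).liftQ l hker
      (A.quotKerEquivRange.symm ⟨A e, LinearMap.mem_range_self A e⟩) = l e
    rw [h1]
    rfl
  have hb : ∀ x, ‖f₀ x‖ ≤ √C * ‖x‖ := by
    rintro ⟨_, e, rfl⟩
    rw [hf₀]
    exact hle e
  obtain ⟨g, hg, hgn⟩ := exists_extension_norm_eq _ (f₀.mkContinuous _ hb)
  refine ⟨(InnerProductSpace.toDual ℝ H).symm g, ?_, fun e => ?_⟩
  · rw [LinearIsometryEquiv.norm_map, hgn]
    have h1 := LinearMap.mkContinuous_norm_le f₀ (Real.sqrt_nonneg C) hb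
    calc _ ≤ √C ^ 2 := by gcongr
      _ = C := Real.sq_sqrt hC
  · rw [InnerProductSpace.toDual_symm_apply]
    have h1 := hg ⟨A e, LinearMap.mem_range_self A e⟩
    rw [h1]
    exact hf₀ e

/-- Smooth functions with compact support in `D`. -/
structure IsTest {E : Type*} [NormedAddCommGroup E] [NormedSpace ℝ E] (D : Set E)
    (φ : E → ℝ) : Prop where
  contDiff : ContDiff ℝ ∞ φ
  hasCompactSupport : HasCompactSupport φ
  tsupport_subset : tsupport φ ⊆ D

namespace IsTest

variable {E : Type*} [NormedAddCommGroup E] [NormedSpace ℝ E] {D D' : Set E} {φ ψ : E → ℝ}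

theorem mono (h : IsTest D φ) (hD : D ⊆ D') : IsTest D' φ :=
  ⟨h.1, h.2, h.3.trans hD⟩

theorem zero : IsTest D (0 : E → ℝ) :=
  ⟨contDiff_const, HasCompactSupport.zero, by simp [tsupport]⟩

theorem add (h : IsTest D φ) (h' : IsTest D ψ) : IsTest D (φ + ψ) :=
  ⟨h.1.add h'.1, h.2.add h'.2, (tsupport_add φ ψ).trans (union_subset h.3 h'.3)⟩

theorem smul (c : ℝ) (h : IsTest D φ) : IsTest D (c • φ) :=
  ⟨h.1.const_smul c, h.2.smul_left, (tsupport_smul_subset_right (fun _ => c) φ).trans h.3⟩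

theorem mul_left {χ : E → ℝ} (h : IsTest D φ) (hχ : ContDiff ℝ ∞ χ) :
    IsTest D (fun x => χ x * φ x) :=
  ⟨hχ.mul h.1, h.2.mul_left, (tsupport_mul_subset_right).trans h.3⟩

theorem continuous (h : IsTest D φ) : Continuous φ := h.1.continuous

theorem differentiable (h : IsTest D φ) : Differentiable ℝ φ := h.1.differentiable (by simp)

theorem integrable [MeasurableSpace E] [OpensMeasurableSpace E] (h : IsTest D φ)
    (μ : Measure E) [IsFiniteMeasureOnCompacts μ] : Integrable φ μ :=
  h.continuous.integrable_of_hasCompactSupport h.2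

theorem fderiv_apply (h : IsTest D φ) (v : E) : IsTest D (fun x => fderiv ℝ φ x v) := by
  refine ⟨(h.1.fderiv_right (m := ∞) (by simp)).clm_apply contDiff_const, h.2.fderiv_apply ℝ v, ?_⟩
  exact (tsupport_fderiv_apply_subset ℝ v).trans h.3

theorem eq_zero (h : IsTest D φ) {x : E} (hx : x ∉ D) : φ x = 0 :=
  image_eq_zero_of_notMem_tsupport fun h' => hx (h.3 h')

theorem integrable_mul [MeasurableSpace E] [BorelSpace E] (h : IsTest D φ) {μ : Measure E}
    {u : E → ℝ} (hu : LocallyIntegrableOn u D μ) : Integrable (fun x => u x * φ x) μ := by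
  have h1 : IntegrableOn u (tsupport φ) μ :=
    hu.integrableOn_compact_subset h.3 h.2
  have h2 : IntegrableOn (fun x => u x * φ x) (tsupport φ) μ :=
    h1.mul_continuousOn h.continuous.continuousOn h.2
  refine (integrableOn_iff_integrable_of_support_subset ?_).1 h2
  intro x hx
  exact subset_tsupport _ (right_ne_zero_of_mul hx)

end IsTest

/-- The space of smooth functions with compact support in `D`. -/
def testSpace {E : Type*} [NormedAddCommGroup E] [NormedSpace ℝ E] (D : Set E) :
    Submodule ℝ (E → ℝ) where
  carrier := {φ | IsTest D φ}
  add_mem' h h' := h.add h'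
  zero_mem' := IsTest.zero
  smul_mem' c _ h := h.smul c

/-! ### The surface energy as a dual norm -/

/-- `(∫ h φ')² ≤ C ∫ φ²` for all test functions. For continuous `h` this says that
`∫ h'² ≤ C`. -/
def SlopeBound (h : ℝ → ℝ) (C : ℝ) : Prop :=
  ∀ φ : ℝ → ℝ, IsTest univ φ → (∫ x, h x * deriv φ x) ^ 2 ≤ C * ∫ x, φ x ^ 2

theorem IsTest.isTest_deriv {D : Set ℝ} {φ : ℝ → ℝ} (h : IsTest D φ) : IsTest D (deriv φ) :=
  h.fderiv_apply 1

theorem IsTest.memLp {E : Type*} [NormedAddCommGroup E] [NormedSpace ℝ E] [MeasurableSpace E]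
    [BorelSpace E] {D : Set E} {φ : E → ℝ} (h : IsTest D φ) (p : ℝ≥0∞)
    (μ : Measure E) [IsFiniteMeasureOnCompacts μ] [SecondCountableTopologyEither E ℝ] :
    MemLp φ p μ :=
  h.continuous.memLp_of_hasCompactSupport h.2

theorem lintegral_ofReal_sq {α : Type*} [MeasurableSpace α] {μ : Measure α} {f : α → ℝ}
    (hf : MemLp f 2 μ) : ∫⁻ x, ENNReal.ofReal (f x ^ 2) ∂μ = ENNReal.ofReal (∫ x, f x ^ 2 ∂μ) :=
  (ofReal_integral_eq_lintegral_ofReal hf.integrable_sq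
    (Eventually.of_forall fun _ => sq_nonneg _)).symm

theorem memLp_two_of_lintegral_lt_top {α : Type*} [MeasurableSpace α] {μ : Measure α} {f : α → ℝ}
    (hf : AEStronglyMeasurable f μ) (h : ∫⁻ x, ENNReal.ofReal (f x ^ 2) ∂μ < ⊤) : MemLp f 2 μ := by
  rw [memLp_two_iff_integrable_sq hf]
  refine ⟨hf.pow 2, ?_⟩
  rw [hasFiniteIntegral_iff_ofReal (Eventually.of_forall fun _ => sq_nonneg _)]
  exact h

theorem sq_integral_mul_le {α : Type*} [MeasurableSpace α] {μ : Measure α} {f g : α → ℝ}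
    (hf : MemLp f 2 μ) (hg : MemLp g 2 μ) :
    (∫ x, f x * g x ∂μ) ^ 2 ≤ (∫ x, f x ^ 2 ∂μ) * ∫ x, g x ^ 2 ∂μ := by
  have hfg : Integrable (fun x => f x * g x) μ := hf.integrable_mul hg
  have h2 := hf.integrable_sq
  have h3 := hg.integrable_sq
  have key : ∀ s : ℝ, 0 ≤ (∫ x, g x ^ 2 ∂μ) * (s * s) + (2 * ∫ x, f x * g x ∂μ) * s
      + ∫ x, f x ^ 2 ∂μ := fun s => by
    have h4 : ∫ x, (f x + s * g x) ^ 2 ∂μ = (∫ x, g x ^ 2 ∂μ) * (s * s)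
        + (2 * ∫ x, f x * g x ∂μ) * s + ∫ x, f x ^ 2 ∂μ := by
      have : ∀ x, (f x + s * g x) ^ 2 = (s * s) * g x ^ 2 + (2 * s) * (f x * g x) + f x ^ 2 :=
        fun x => by ring
      simp_rw [this]
      rw [integral_add, integral_add, integral_const_mul, integral_const_mul]
      · ring
      · exact h3.const_mul _
      · exact hfg.const_mul _
      · exact (h3.const_mul _).add (hfg.const_mul _)
      · exact h2
    rw [← h4]
    exact integral_nonneg fun x => sq_nonneg _
  have := discrim_le_zero key
  rw [discrim] at this
  nlinarith

/-- The functional $\varphi\mapsto-\int h\varphi'$ is bounded in the $L^2$ norm of $\varphi$, so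
Riesz represents it by an $L^2$ function; this is the weak derivative, and the bound on its norm is
the energy bound. -/
theorem exists_weakDeriv_of_slopeBound {h : ℝ → ℝ} {C : ℝ} (hC : 0 ≤ C)
    (hl : LocallyIntegrable h volume) (hs : SlopeBound h C) :
    ∃ g : ℝ → ℝ, HasWeakDeriv univ 1 h g ∧ MemLp g 2 volume ∧
      ∫⁻ x, ENNReal.ofReal (g x ^ 2) ≤ ENNReal.ofReal C := by
  let A : testSpace (univ : Set ℝ) →ₗ[ℝ] Lp ℝ 2 (volume : Measure ℝ) :=
    { toFun := fun φ => (φ.2.memLp 2 volume).toLp φ.1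
      map_add' := fun φ ψ => MemLp.toLp_add _ _
      map_smul' := fun c φ => MemLp.toLp_const_smul c _ }
  let l : testSpace (univ : Set ℝ) →ₗ[ℝ] ℝ :=
    { toFun := fun φ => - ∫ x, h x * deriv φ.1 x
      map_add' := fun φ ψ => by
        rw [← neg_add, ← integral_add (φ.2.isTest_deriv.integrable_mul (hl.locallyIntegrableOn _))
          (ψ.2.isTest_deriv.integrable_mul (hl.locallyIntegrableOn _))]
        congr 1
        refine integral_congr_ae (Eventually.of_forall fun x => ?_)
        change h x * deriv (φ.1 + ψ.1) x = _
        rw [deriv_add (φ.2.differentiable x) (ψ.2.differentiable x)]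
        ring
      map_smul' := fun c φ => by
        rw [RingHom.id_apply, smul_eq_mul, mul_neg, ← integral_const_mul]
        congr 1
        refine integral_congr_ae (Eventually.of_forall fun x => ?_)
        change h x * deriv (c • φ.1) x = _
        rw [deriv_const_smul c (φ.2.differentiable x), smul_eq_mul]
        ring }
  have hA : ∀ φ : testSpace (univ : Set ℝ), ‖A φ‖ ^ 2 = ∫ x, φ.1 x ^ 2 := fun φ => by
    rw [← real_inner_self_eq_norm_sq, L2.inner_def]
    refine integral_congr_ae ?_
    filter_upwards [(φ.2.memLp 2 volume).coeFn_toLp] with x hx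
    change inner ℝ ((φ.2.memLp 2 volume).toLp φ.1 x) ((φ.2.memLp 2 volume).toLp φ.1 x) = _
    rw [hx, real_inner_self_eq_norm_sq, Real.norm_eq_abs, sq_abs]
  obtain ⟨F, hF, hFl⟩ := exists_inner_eq_of_sq_le A l hC (fun φ => by
    rw [hA]
    change (-_) ^ 2 ≤ _
    rw [neg_sq]
    exact hs φ.1 φ.2)
  have hFm := Lp.memLp F
  refine ⟨F, ⟨hl.locallyIntegrableOn _, (hFm.locallyIntegrable (by norm_num)).locallyIntegrableOn _,
    fun φ h1 h2 _ => ?_⟩, hFm, ?_⟩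
  · have h3 : IsTest univ φ := ⟨h1, h2, subset_univ _⟩
    have h4 := hFl ⟨φ, h3⟩
    rw [L2.inner_def] at h4
    have h5 : ∫ x, F x * φ x = - ∫ x, h x * deriv φ x := by
      refine Eq.trans (integral_congr_ae ?_) h4
      filter_upwards [(h3.memLp 2 volume).coeFn_toLp] with x hx
      change _ = inner ℝ (F x) ((h3.memLp 2 volume).toLp φ x)
      rw [hx]
      exact mul_comm _ _
    simp only [Measure.restrict_univ]
    rw [h5, neg_neg]
    rfl
  · rw [lintegral_ofReal_sq hFm]
    refine ENNReal.ofReal_le_ofReal (le_trans (le_of_eq ?_) hF)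
    rw [← real_inner_self_eq_norm_sq, L2.inner_def]
    refine integral_congr_ae (Eventually.of_forall fun x => ?_)
    change _ = inner ℝ (F x) (F x)
    rw [real_inner_self_eq_norm_sq, Real.norm_eq_abs, sq_abs]

theorem slopeBound_of_hasWeakDeriv {h g : ℝ → ℝ} {C : ℝ} (hC : 0 ≤ C)
    (hg : HasWeakDeriv univ 1 h g)
    (hgC : ∫⁻ x, ENNReal.ofReal (g x ^ 2) ≤ ENNReal.ofReal C) : SlopeBound h C := by
  intro φ hφ
  have hgl : LocallyIntegrable g volume := locallyIntegrableOn_univ.1 hg.2.1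
  have hgm := memLp_two_of_lintegral_lt_top hgl.aestronglyMeasurable
    (hgC.trans_lt ENNReal.ofReal_lt_top)
  have h1 := hg.2.2 φ hφ.1 hφ.2 hφ.3
  simp only [Measure.restrict_univ] at h1
  change (∫ x, h x * fderiv ℝ φ x 1) ^ 2 ≤ _
  rw [h1, neg_sq]
  refine (sq_integral_mul_le hgm (hφ.memLp 2 volume)).trans ?_
  rw [lintegral_ofReal_sq hgm, ENNReal.ofReal_le_ofReal_iff hC] at hgC
  exact mul_le_mul_of_nonneg_right hgC (integral_nonneg fun x => sq_nonneg _)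

/-- This trades the infimum over weak derivatives for a family of inequalities, one per test
function, each of which passes to limits of $h$. -/
theorem surfaceEnergy_le_iff {h : ℝ → ℝ} (hl : LocallyIntegrable h volume) {C : ℝ} (hC : 0 ≤ C) :
    surfaceEnergy h ≤ ENNReal.ofReal C ↔ SlopeBound h C := by
  constructor
  · intro hs φ hφ
    -- The infimum is not known to be attained, hence the room $\varepsilon$.
    have h1 : ∀ ε : ℝ, 0 < ε → (∫ x, h x * deriv φ x) ^ 2 ≤ (C + ε) * ∫ x, φ x ^ 2 := by
      intro ε hε
      have h2 : surfaceEnergy h < ENNReal.ofReal (C + ε) :=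
        hs.trans_lt ((ENNReal.ofReal_lt_ofReal_iff (by positivity)).2 (by linarith))
      unfold surfaceEnergy at h2
      simp only [iInf_lt_iff] at h2
      obtain ⟨g, hg, hgC⟩ := h2
      exact slopeBound_of_hasWeakDeriv (by positivity) hg hgC.le φ hφ
    have h3 : Tendsto (fun ε : ℝ => (C + ε) * ∫ x, φ x ^ 2) (𝓝[>] 0) (𝓝 ((C + 0) * ∫ x, φ x ^ 2)) :=
      (Continuous.tendsto (by fun_prop) 0).mono_left nhdsWithin_le_nhds
    rw [add_zero] at h3
    exact ge_of_tendsto h3 (eventually_nhdsWithin_of_forall fun ε hε => h1 ε hε)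
  · intro hs
    obtain ⟨g, hg, _, hgC⟩ := exists_weakDeriv_of_slopeBound hC hl hs
    exact (iInf₂_le g hg).trans hgC

theorem surfaceEnergy_ne_top {h : ℝ → ℝ} (hh : MemH1Line h) : surfaceEnergy h ≠ ⊤ := by
  obtain ⟨_, _, g, hg, hgm⟩ := hh
  refine ne_top_of_le_ne_top ?_ (iInf₂_le g hg)
  rw [lintegral_ofReal_sq hgm]
  exact ENNReal.ofReal_ne_top

theorem MemH1Line.slopeBound {h : ℝ → ℝ} (hh : MemH1Line h) :
    SlopeBound h (surfaceEnergy h).toReal := by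
  rw [← surfaceEnergy_le_iff hh.1.locallyIntegrable ENNReal.toReal_nonneg,
    ENNReal.ofReal_toReal (surfaceEnergy_ne_top hh)]

/-! ### Weak derivatives on the line and Hölder continuity -/

theorem HasCompactSupport.exists_Ioo {φ : ℝ → ℝ} (h : HasCompactSupport φ) :
    ∃ R : ℝ, 0 < R ∧ tsupport φ ⊆ Ioo (-R) R := by
  obtain ⟨R, hR, hs⟩ := h.isCompact.isBounded.subset_ball_lt 0 0
  refine ⟨R, hR, hs.trans ?_⟩
  rw [Real.ball_eq_Ioo]
  simp

theorem intervalIntegrable_of_locallyIntegrable {g : ℝ → ℝ} (hg : LocallyIntegrable g volume)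
    (a b : ℝ) : IntervalIntegrable g volume a b :=
  intervalIntegrable_iff.2 ((hg.integrableOn_isCompact isCompact_uIcc).mono_set uIoc_subset_uIcc)

theorem integral_deriv_isTest {D : Set ℝ} {φ : ℝ → ℝ} (h : IsTest D φ) :
    ∫ x, deriv φ x = 0 := by
  have h1 := integral_mul_deriv_eq_deriv_mul_of_integrable (u := fun _ => (1 : ℝ))
    (u' := fun _ => 0)
    (v := φ) (v' := deriv φ) (fun x _ => hasDerivAt_const x 1)
    (fun x _ => (h.differentiable x).hasDerivAt)
    (by simpa [Pi.mul_def] using h.isTest_deriv.integrable volume) (by simp [Pi.mul_def])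
    (by simpa [Pi.mul_def] using h.integrable volume)
  simpa using h1

theorem hasWeakDeriv_of_eq_integral {h g : ℝ → ℝ} (hg : LocallyIntegrable g volume)
    (hc : Continuous h) (H : ∀ a b, h b - h a = ∫ x in a..b, g x) : HasWeakDeriv univ 1 h g := by
  refine ⟨hc.locallyIntegrable.locallyIntegrableOn _, hg.locallyIntegrableOn _,
    fun φ h1 h2 h3 => ?_⟩
  have hφ : IsTest univ φ := ⟨h1, h2, h3⟩
  simp only [Measure.restrict_univ]
  obtain ⟨R, hR, hs⟩ := HasCompactSupport.exists_Ioo h2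
  have hsφ : ∀ x, x ∉ Ioo (-R) R → φ x = 0 := fun x hx =>
    image_eq_zero_of_notMem_tsupport fun h' => hx (hs h')
  have hsφ' : ∀ x, x ∉ Ioo (-R) R → deriv φ x = 0 := fun x hx =>
    image_eq_zero_of_notMem_tsupport fun h' => hx (hs (tsupport_fderiv_apply_subset ℝ 1 h'))
  have hint : ∀ f : ℝ → ℝ, (∀ x, x ∉ Ioo (-R) R → f x = 0) → ∫ x, f x = ∫ x in (-R)..R, f x :=
    fun f hf => (intervalIntegral.integral_eq_integral_of_support_subset
      (fun x hx => Ioo_subset_Ioc_self (by_contra fun h' => hx (hf x h')))).symm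
  have hgi : IntervalIntegrable g volume (-R) R := intervalIntegrable_of_locallyIntegrable hg (-R) R
  have hac := hgi.absolutelyContinuousOnInterval_intervalIntegral (c := -R) left_mem_uIcc
  have hacφ : AbsolutelyContinuousOnInterval φ (-R) R :=
    (h1.of_le (by simp)).contDiffOn.absolutelyContinuousOnInterval
  have key := hac.integral_mul_deriv_eq_deriv_mul hacφ
  rw [hsφ R (by simp), hsφ (-R) (by simp)] at key
  have h4 : ∫ x in (-R)..R, deriv (fun x => ∫ v in (-R)..x, g v) x * φ x
      = ∫ x in (-R)..R, g x * φ x := by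
    refine intervalIntegral.integral_congr_ae ?_
    filter_upwards [LocallyIntegrable.ae_hasDerivAt_integral hg] with x hx _
    rw [(hx (-R)).deriv]
  rw [h4] at key
  change ∫ x, h x * deriv φ x = _
  -- Subtracting $h(-R)$ changes nothing because $\int\varphi'=0$; what remains is the primitive of
  -- $g$ from $-R$, an absolutely continuous function.
  have h5 : ∫ x, h x * deriv φ x = ∫ x, (h x - h (-R)) * deriv φ x := by
    have : ∫ x, h (-R) * deriv φ x = 0 := by
      rw [integral_const_mul, integral_deriv_isTest hφ, mul_zero]
    simp_rw [sub_mul]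
    rw [integral_sub, this, sub_zero]
    · exact hφ.isTest_deriv.integrable_mul (hc.locallyIntegrable.locallyIntegrableOn _)
    · exact (hφ.isTest_deriv.integrable _).const_mul _
  rw [h5, hint _ (fun x hx => by rw [hsφ' x hx, mul_zero]),
    hint _ (fun x hx => by rw [hsφ x hx, mul_zero])]
  simp_rw [H]
  rw [key]
  ring

theorem IsTest.exists_primitive {η : ℝ → ℝ} (h : IsTest univ η) (h0 : ∫ x, η x = 0) :
    ∃ Φ : ℝ → ℝ, IsTest univ Φ ∧ deriv Φ = η := by
  obtain ⟨R, hR, hs⟩ := HasCompactSupport.exists_Ioo h.2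
  have hsη : ∀ x, x ∉ Ioo (-R) R → η x = 0 := fun x hx =>
    image_eq_zero_of_notMem_tsupport fun h' => hx (hs h')
  have hd : ∀ x, HasDerivAt (fun x => ∫ t in (-R)..x, η t) (η x) x := fun x =>
    intervalIntegral.integral_hasDerivAt_right (h.continuous.intervalIntegrable _ _)
      (h.continuous.stronglyMeasurableAtFilter _ _) h.continuous.continuousAt
  have hd' : deriv (fun x => ∫ t in (-R)..x, η t) = η := funext fun x => (hd x).deriv
  refine ⟨fun x => ∫ t in (-R)..x, η t, ⟨?_, ?_, subset_univ _⟩, hd'⟩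
  · rw [contDiff_infty_iff_deriv, hd']
    exact ⟨fun x => (hd x).differentiableAt, h.1⟩
  · refine HasCompactSupport.intro (isCompact_Icc (a := -R) (b := R)) fun x hx => ?_
    rcases lt_or_ge x (-R) with h1 | h1
    · refine intervalIntegral.integral_zero_ae (Eventually.of_forall fun t ht => hsη t ?_)
      rw [uIoc_of_ge h1.le] at ht
      exact fun h' => absurd ht.2 (not_le.2 h'.1)
    · have h2 : R < x := by
        by_contra h2
        exact hx ⟨h1, not_lt.1 h2⟩
      rw [intervalIntegral.integral_eq_integral_of_support_subset, h0]
      intro t ht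
      have h3 : t ∈ Ioo (-R) R := by_contra fun h' => ht (hsη t h')
      exact ⟨h3.1, h3.2.le.trans h2.le⟩

theorem exists_isTest_integral_eq_one : ∃ ρ : ℝ → ℝ, IsTest univ ρ ∧ ∫ x, ρ x = 1 := by
  let f : ContDiffBump (0 : ℝ) := ⟨1, 2, one_pos, one_lt_two⟩
  exact ⟨f.normed volume, ⟨f.contDiff_normed, f.hasCompactSupport_normed, subset_univ _⟩,
    f.integral_normed⟩

/-- Du Bois-Reymond: $\varphi-(\int\varphi)\rho$ has mean zero, so it is the derivative of a test
function. Hence $f-c$ with $c=\int f\rho$ annihilates every $\varphi$. -/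
theorem eq_of_integral_mul_deriv_eq_zero {f : ℝ → ℝ} (hf : Continuous f)
    (h : ∀ φ : ℝ → ℝ, IsTest univ φ → ∫ x, f x * deriv φ x = 0) (a b : ℝ) : f a = f b := by
  obtain ⟨ρ, hρ, hρ1⟩ := exists_isTest_integral_eq_one
  set c := ∫ x, f x * ρ x with hc
  have hfl : LocallyIntegrable f volume := hf.locallyIntegrable
  have h1 : ∀ᵐ x, f x - c = 0 := by
    refine ae_eq_zero_of_integral_contDiff_smul_eq_zero (μ := volume)
      (hfl.sub (locallyIntegrable_const c)) fun φ hφ1 hφ2 => ?_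
    have hφ : IsTest univ φ := ⟨hφ1, hφ2, subset_univ _⟩
    obtain ⟨Φ, hΦ, hΦd⟩ := (hφ.add (hρ.smul (-∫ x, φ x))).exists_primitive (by
      simp only [Pi.add_apply, Pi.smul_apply, smul_eq_mul]
      rw [integral_add (hφ.integrable _) ((hρ.integrable _).const_mul _), integral_const_mul, hρ1]
      ring)
    have h2 := h Φ hΦ
    rw [hΦd] at h2
    simp only [Pi.add_apply, Pi.smul_apply, smul_eq_mul] at h2
    have i1 := hφ.integrable_mul (hfl.locallyIntegrableOn _)
    have i2 := hρ.integrable_mul (hfl.locallyIntegrableOn _)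
    have h3 : ∫ x, f x * (φ x + (-∫ x, φ x) * ρ x) = (∫ x, f x * φ x) - (∫ x, φ x) * c := by
      rw [hc, ← integral_const_mul, ← integral_sub i1 (i2.const_mul _)]
      exact integral_congr_ae (Eventually.of_forall fun x => by ring)
    rw [h3] at h2
    have h4 : ∫ x, φ x • (f x - c) = (∫ x, f x * φ x) - (∫ x, φ x) * c := by
      rw [← integral_mul_const, ← integral_sub i1 ((hφ.integrable _).mul_const _)]
      exact integral_congr_ae (Eventually.of_forall fun x => by
        change φ x * (f x - c) = f x * φ x - φ x * c
        ring)
    exact h4.trans h2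
  have h2 : (fun x => f x) = fun _ => c := by
    refine Continuous.ae_eq_iff_eq volume hf continuous_const |>.1 ?_
    filter_upwards [h1] with x hx
    linarith
  rw [congrFun h2 a, congrFun h2 b]

/-- Both $h$ and the primitive of $g$ have weak derivative $g$, so their difference is constant. -/
theorem HasWeakDeriv.sub_eq_integral {h g : ℝ → ℝ} (hc : Continuous h)
    (hg : HasWeakDeriv univ 1 h g) (a b : ℝ) : h b - h a = ∫ x in a..b, g x := by
  have hgl : LocallyIntegrable g volume := locallyIntegrableOn_univ.1 hg.2.1
  have hi : ∀ a b, IntervalIntegrable g volume a b := intervalIntegrable_of_locallyIntegrable hgl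
  have hGc : Continuous fun x => ∫ t in a..x, g t := intervalIntegral.continuous_primitive hi a
  have hG : HasWeakDeriv univ 1 (fun x => ∫ t in a..x, g t) g :=
    hasWeakDeriv_of_eq_integral hgl hGc fun c d => by
      rw [intervalIntegral.integral_interval_sub_left (hi _ _) (hi _ _)]
  have key := eq_of_integral_mul_deriv_eq_zero (hc.sub hGc) (fun φ hφ => by
    have h1 := hg.2.2 φ hφ.1 hφ.2 hφ.3
    have h2 := hG.2.2 φ hφ.1 hφ.2 hφ.3
    rw [← h2] at h1
    simp only [Measure.restrict_univ] at h1
    change ∫ x, (h x - ∫ t in a..x, g t) * fderiv ℝ φ x 1 = 0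
    simp_rw [sub_mul]
    rw [integral_sub, h1, sub_self]
    · exact (hφ.fderiv_apply 1).integrable_mul (hc.locallyIntegrable.locallyIntegrableOn _)
    · exact (hφ.fderiv_apply 1).integrable_mul (hGc.locallyIntegrable.locallyIntegrableOn _)) a b
  simp only [intervalIntegral.integral_same, Pi.sub_apply] at key
  linarith

theorem sq_sub_le_of_hasWeakDeriv {h g : ℝ → ℝ} (hc : Continuous h)
    (hg : HasWeakDeriv univ 1 h g) (hgm : MemLp g 2 volume) {a t : ℝ} (ht : 0 ≤ t) :
    (h (a + t) - h a) ^ 2 ≤ t * ∫ x in Ioc a (a + t), g x ^ 2 := by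
  rw [hg.sub_eq_integral hc, intervalIntegral.integral_of_le (by linarith)]
  have h1 := sq_integral_mul_le (μ := volume.restrict (Ioc a (a + t))) (f := fun _ => (1 : ℝ))
    (memLp_const 1) (hgm.restrict _)
  simpa [ht] using h1

theorem SlopeBound.sq_sub_le {h : ℝ → ℝ} {C : ℝ} (hC : 0 ≤ C) (hc : Continuous h)
    (hs : SlopeBound h C) (a b : ℝ) : (h a - h b) ^ 2 ≤ C * |a - b| := by
  obtain ⟨g, hg, hgm, hgC⟩ := exists_weakDeriv_of_slopeBound hC hc.locallyIntegrable hs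
  rw [lintegral_ofReal_sq hgm, ENNReal.ofReal_le_ofReal_iff hC] at hgC
  have key : ∀ a t : ℝ, 0 ≤ t → (h (a + t) - h a) ^ 2 ≤ C * t := fun a t ht => by
    refine (sq_sub_le_of_hasWeakDeriv hc hg hgm ht).trans ?_
    rw [mul_comm]
    refine mul_le_mul_of_nonneg_right (le_trans ?_ hgC) ht
    exact setIntegral_le_integral hgm.integrable_sq (Eventually.of_forall fun _ => sq_nonneg _)
  rcases le_total a b with hab | hab
  · have := key a (b - a) (by linarith)
    rw [add_sub_cancel] at this
    rw [abs_of_nonpos (by linarith), neg_sub, ← neg_sub, neg_sq]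
    exact this
  · have := key b (a - b) (by linarith)
    rw [add_sub_cancel] at this
    rw [abs_of_nonneg (by linarith)]
    exact this

/-! ### Difference quotients and stability of the slope bound -/

theorem lintegral_lintegral_Ioc (G : ℝ → ℝ≥0∞) (hG : AEMeasurable G volume) (t : ℝ) :
    ∫⁻ x, ∫⁻ y in Ioc x (x + t), G y = ENNReal.ofReal t * ∫⁻ y, G y := by
  have hm : MeasurableSet {p : ℝ × ℝ | p.1 < p.2 ∧ p.2 ≤ p.1 + t} :=
    (measurableSet_lt measurable_fst measurable_snd).inter
      (measurableSet_le measurable_snd (measurable_fst.add_const t))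
  have h1 : ∀ x, ∫⁻ y in Ioc x (x + t), G y
      = ∫⁻ y, {p : ℝ × ℝ | p.1 < p.2 ∧ p.2 ≤ p.1 + t}.indicator (fun p => G p.2) (x, y) := by
    intro x
    rw [← lintegral_indicator measurableSet_Ioc]
    rfl
  simp_rw [h1]
  rw [lintegral_lintegral_swap]
  · have h2 : ∀ y, ∫⁻ x, {p : ℝ × ℝ | p.1 < p.2 ∧ p.2 ≤ p.1 + t}.indicator (fun p => G p.2) (x, y)
        = ENNReal.ofReal t * G y := by
      intro y
      have : (fun x => {p : ℝ × ℝ | p.1 < p.2 ∧ p.2 ≤ p.1 + t}.indicator (fun p => G p.2) (x, y))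
          = (Ico (y - t) y).indicator fun _ => G y := by
        ext x
        by_cases hx : x < y ∧ y ≤ x + t
        · rw [indicator_of_mem (show (x, y) ∈ {p : ℝ × ℝ | p.1 < p.2 ∧ p.2 ≤ p.1 + t} from hx),
            indicator_of_mem (show x ∈ Ico (y - t) y from ⟨by linarith [hx.2], hx.1⟩)]
        · rw [indicator_of_notMem (show (x, y) ∉ {p : ℝ × ℝ | p.1 < p.2 ∧ p.2 ≤ p.1 + t} from hx),
            indicator_of_notMem (show x ∉ Ico (y - t) y from
              fun h' => hx ⟨h'.2, by linarith [h'.1]⟩)]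
      rw [this, lintegral_indicator measurableSet_Ico, setLIntegral_const, Real.volume_Ico, mul_comm]
      congr 2
      ring
    simp_rw [h2]
    rw [lintegral_const_mul' _ _ ENNReal.ofReal_ne_top]
  · refine AEMeasurable.indicator ?_ hm
    exact hG.comp_quasiMeasurePreserving Measure.quasiMeasurePreserving_snd

/-- Together with its converse below, this describes the slope bound by $L^2$ difference quotients.
In that form, contractions and translations preserve it at once, with no chain rule for weak
derivatives. -/
theorem SlopeBound.lintegral_sq_sub_le {h : ℝ → ℝ} {C : ℝ} (hC : 0 ≤ C) (hc : Continuous h)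
    (hs : SlopeBound h C) {t : ℝ} (ht : 0 ≤ t) :
    ∫⁻ x, ENNReal.ofReal ((h (x + t) - h x) ^ 2) ≤ ENNReal.ofReal (C * t ^ 2) := by
  obtain ⟨g, hg, hgm, hgC⟩ := exists_weakDeriv_of_slopeBound hC hc.locallyIntegrable hs
  calc ∫⁻ x, ENNReal.ofReal ((h (x + t) - h x) ^ 2)
      ≤ ∫⁻ x, ENNReal.ofReal t * ∫⁻ y in Ioc x (x + t), ENNReal.ofReal (g y ^ 2) := by
        refine lintegral_mono fun x => ?_
        rw [lintegral_ofReal_sq (hgm.restrict _), ← ENNReal.ofReal_mul ht]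
        exact ENNReal.ofReal_le_ofReal (sq_sub_le_of_hasWeakDeriv hc hg hgm ht)
    _ = ENNReal.ofReal t * (ENNReal.ofReal t * ∫⁻ y, ENNReal.ofReal (g y ^ 2)) := by
        rw [lintegral_const_mul' _ _ ENNReal.ofReal_ne_top, lintegral_lintegral_Ioc]
        exact (hgm.aestronglyMeasurable.aemeasurable.pow_const 2).ennreal_ofReal
    _ ≤ ENNReal.ofReal t * (ENNReal.ofReal t * ENNReal.ofReal C) := by gcongr
    _ = ENNReal.ofReal (C * t ^ 2) := by
        rw [← ENNReal.ofReal_mul ht, ← ENNReal.ofReal_mul ht]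
        congr 1
        ring

/-- The difference quotient is moved from $h$ to $\varphi$ by a shift of the variable,
Cauchy–Schwarz is applied, and then $t\to0$. -/
theorem slopeBound_of_lintegral_sq_sub_le {h : ℝ → ℝ} {C : ℝ} (hC : 0 ≤ C) (hc : Continuous h)
    (H : ∀ t : ℝ, 0 < t → ∫⁻ x, ENNReal.ofReal ((h (x + t) - h x) ^ 2) ≤ ENNReal.ofReal (C * t ^ 2)) :
    SlopeBound h C := by
  intro φ hφ
  have hl : ∀ τ : ℝ, Continuous fun x => h (x + τ) := fun τ => by fun_prop
  have hli : ∀ τ : ℝ, Integrable fun x => h (x + τ) * φ x := fun τ =>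
    hφ.integrable_mul ((hl τ).locallyIntegrable.locallyIntegrableOn _)
  have h1 : ∀ t : ℝ, 0 < t → (∫ x, h x * (t⁻¹ * (φ x - φ (x - t)))) ^ 2 ≤ C * ∫ x, φ x ^ 2 := by
    intro t ht
    have hm : MemLp (fun x => h (x + t) - h x) 2 volume :=
      memLp_two_of_lintegral_lt_top ((hl t).sub hc).aestronglyMeasurable
        ((H t ht).trans_lt ENNReal.ofReal_lt_top)
    have h2 := H t ht
    rw [lintegral_ofReal_sq hm, ENNReal.ofReal_le_ofReal_iff (by positivity)] at h2
    have h3 := sq_integral_mul_le hm (hφ.memLp 2 volume)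
    have h4 : ∫ x, h x * φ (x - t) = ∫ x, h (x + t) * φ x := by
      rw [← integral_add_right_eq_self (fun x => h x * φ (x - t)) t]
      simp
    have i0 : Integrable fun x => h x * φ x := by simpa using hli 0
    have i1 : Integrable fun x => h x * φ (x - t) := by
      have := (hli t).comp_sub_right t
      simpa using this
    have h5 : ∫ x, h x * (t⁻¹ * (φ x - φ (x - t))) = -(t⁻¹ * ∫ x, (h (x + t) - h x) * φ x) := by
      have e1 : ∀ x, h x * (t⁻¹ * (φ x - φ (x - t))) = t⁻¹ * (h x * φ x - h x * φ (x - t)) :=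
        fun x => by ring
      simp_rw [e1, sub_mul]
      rw [integral_const_mul, integral_sub i0 i1, integral_sub (hli t) i0, h4]
      ring
    rw [h5, neg_sq, mul_pow]
    calc t⁻¹ ^ 2 * (∫ x, (h (x + t) - h x) * φ x) ^ 2
        ≤ t⁻¹ ^ 2 * ((C * t ^ 2) * ∫ x, φ x ^ 2) := by
          gcongr
          exact h3.trans (mul_le_mul_of_nonneg_right h2 (integral_nonneg fun _ => sq_nonneg _))
      _ = C * ∫ x, φ x ^ 2 := by
          field_simp
  obtain ⟨R, hR, hsupp⟩ := HasCompactSupport.exists_Ioo hφ.2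
  have hsφ : ∀ x, x ∉ Ioo (-R) R → φ x = 0 := fun x hx =>
    image_eq_zero_of_notMem_tsupport fun h' => hx (hsupp h')
  obtain ⟨K, hK⟩ := hφ.isTest_deriv.continuous.bounded_above_of_compact_support hφ.isTest_deriv.2
  have hK0 : 0 ≤ K := (norm_nonneg _).trans (hK 0)
  have hlip : ∀ x y, |φ x - φ y| ≤ K * |x - y| := fun x y =>
    (convex_univ.norm_image_sub_le_of_norm_deriv_le (fun z _ => hφ.differentiable z)
      (fun z _ => hK z) (mem_univ y) (mem_univ x))
  -- Dominated convergence: for $0<t<1$ the integrand lives on $[-R-1,R+1]$, and the quotients of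
  -- $\varphi$ are bounded by its Lipschitz constant.
  have hlim : Tendsto (fun t : ℝ => ∫ x, h x * (t⁻¹ * (φ x - φ (x - t)))) (𝓝[>] 0)
      (𝓝 (∫ x, h x * deriv φ x)) := by
    refine tendsto_integral_filter_of_dominated_convergence
      ((Icc (-(R + 1)) (R + 1)).indicator fun x => |h x| * K) ?_ ?_ ?_ ?_
    · refine Eventually.of_forall fun t => Continuous.aestronglyMeasurable ?_
      have := hφ.continuous
      fun_prop
    · have : Ioo (0 : ℝ) 1 ∈ 𝓝[>] (0 : ℝ) := Ioo_mem_nhdsGT one_pos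
      filter_upwards [this] with t ht
      refine Eventually.of_forall fun x => ?_
      by_cases hx : x ∈ Icc (-(R + 1)) (R + 1)
      · rw [indicator_of_mem hx, norm_mul, norm_mul, norm_inv, Real.norm_eq_abs, Real.norm_eq_abs,
          Real.norm_eq_abs, abs_of_pos ht.1]
        gcongr
        rw [inv_mul_le_iff₀ ht.1]
        have := hlip x (x - t)
        rw [sub_sub_cancel, abs_of_pos ht.1] at this
        linarith
      · rw [indicator_of_notMem hx, hsφ x, hsφ (x - t)]
        · simp
        · exact fun h' => hx ⟨by linarith [h'.1, ht.1], by linarith [h'.2, ht.2]⟩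
        · exact fun h' => hx ⟨by linarith [h'.1], by linarith [h'.2]⟩
    · rw [integrable_indicator_iff measurableSet_Icc]
      exact (hc.abs.mul_const K).continuousOn.integrableOn_compact isCompact_Icc
    · refine Eventually.of_forall fun x => Tendsto.const_mul _ ?_
      have h6 := (hφ.differentiable x).hasDerivAt.tendsto_slope_zero_left
      have h7 : Tendsto (fun t : ℝ => -t) (𝓝[>] 0) (𝓝[<] 0) := by
        have := tendsto_neg_nhdsGT (a := (0 : ℝ))
        rwa [neg_zero] at this
      refine (h6.comp h7).congr fun t => ?_
      simp only [Function.comp, smul_eq_mul]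
      rw [← sub_eq_add_neg, inv_neg]
      ring
  exact le_of_tendsto (hlim.pow 2) (eventually_nhdsWithin_of_forall fun t ht => h1 t ht)

theorem SlopeBound.comp_contraction {h f : ℝ → ℝ} {C : ℝ} (hC : 0 ≤ C) (hc : Continuous h)
    (hs : SlopeBound h C) (hf : ∀ a b, |f a - f b| ≤ |a - b|) :
    SlopeBound (fun x => f (h x)) C := by
  have hfc : Continuous f := (LipschitzWith.of_dist_le_mul (K := 1) fun a b => by
    simpa [Real.dist_eq] using hf a b).continuous
  refine slopeBound_of_lintegral_sq_sub_le hC (hfc.comp hc) fun t ht => ?_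
  refine le_trans (lintegral_mono fun x => ?_) (hs.lintegral_sq_sub_le hC hc ht.le)
  exact ENNReal.ofReal_le_ofReal (sq_le_sq.2 (hf _ _))

theorem SlopeBound.comp_sub_right {h : ℝ → ℝ} {C : ℝ} (hC : 0 ≤ C) (hc : Continuous h)
    (hs : SlopeBound h C) (τ : ℝ) : SlopeBound (fun x => h (x - τ)) C := by
  refine slopeBound_of_lintegral_sq_sub_le hC (by fun_prop) fun t ht => ?_
  refine le_trans (le_of_eq ?_) (hs.lintegral_sq_sub_le hC hc ht.le)
  rw [← lintegral_sub_right_eq_self (fun x => ENNReal.ofReal ((h (x + t) - h x) ^ 2)) τ]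
  refine lintegral_congr fun x => ?_
  rw [sub_add_eq_add_sub]

theorem IsTest.comp_mul_left {φ : ℝ → ℝ} (h : IsTest univ φ) {b : ℝ} (hb : b ≠ 0) :
    IsTest univ (fun x => φ (b * x)) := by
  refine ⟨h.1.comp (contDiff_const.mul contDiff_id), ?_, subset_univ _⟩
  exact h.2.comp_homeomorph (Homeomorph.mulLeft₀ b hb)

theorem SlopeBound.rescale {h : ℝ → ℝ} {C : ℝ} (hs : SlopeBound h C) (a : ℝ) {b : ℝ}
    (hb : 0 < b) : SlopeBound (fun x => a * h (b * x)) (a ^ 2 * b * C) := by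
  intro φ hφ
  have h1 := hs _ (hφ.comp_mul_left (inv_ne_zero hb.ne'))
  have h2 : ∫ x, a * h (b * x) * deriv φ x
      = a * ∫ y, h y * deriv (fun x => φ (b⁻¹ * x)) y := by
    have e1 : ∀ y, deriv (fun x => φ (b⁻¹ * x)) y = b⁻¹ * deriv φ (b⁻¹ * y) := fun y => by
      rw [deriv_comp_mul_left, smul_eq_mul]
    simp_rw [e1]
    rw [← integral_const_mul]
    have e2 := Measure.integral_comp_mul_left (fun y => h y * (b⁻¹ * deriv φ (b⁻¹ * y))) b
    rw [abs_of_pos (inv_pos.2 hb), smul_eq_mul] at e2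
    rw [integral_const_mul, ← inv_mul_cancel_left₀ (inv_ne_zero hb.ne')
      (∫ y, h y * (b⁻¹ * deriv φ (b⁻¹ * y))), ← e2, ← integral_const_mul, ← integral_const_mul]
    refine integral_congr_ae (Eventually.of_forall fun x => ?_)
    simp only [inv_mul_cancel_left₀ hb.ne', inv_inv]
    field_simp
  have h3 : ∫ x, φ (b⁻¹ * x) ^ 2 = b * ∫ x, φ x ^ 2 := by
    have e2 := Measure.integral_comp_mul_left (fun y => φ y ^ 2) b⁻¹
    rwa [inv_inv, abs_of_pos hb, smul_eq_mul] at e2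
  rw [h2, mul_pow]
  rw [h3] at h1
  nlinarith [sq_nonneg a]

theorem MemH1Line.of_slopeBound {h : ℝ → ℝ} {C : ℝ} (hc : Continuous h)
    (hm : MemLp h 2 volume) (hC : 0 ≤ C) (hs : SlopeBound h C) : MemH1Line h := by
  obtain ⟨g, hg, hgm, _⟩ := exists_weakDeriv_of_slopeBound hC hc.locallyIntegrable hs
  exact ⟨hc, hm, g, hg, hgm⟩

/-! ### Profiles: decay, cutting at zeros, smooth approximation from below -/

/-- By Hölder continuity a point with $h\ge\delta$ carries mass at least $r\delta/2$ on an interval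
of fixed length $r$ to its right. Far out this exceeds the tail of $\int h$. -/
theorem IsProfile.exists_forall_lt {V : ℝ} {h : ℝ → ℝ} (hh : IsProfile V h) {δ : ℝ}
    (hδ : 0 < δ) : ∃ R : ℝ, 0 < R ∧ ∀ x, R ≤ |x| → h x < δ := by
  obtain ⟨h1, h0, hi, -⟩ := hh
  have hs := h1.slopeBound
  set C := (surfaceEnergy h).toReal
  have hC : 0 ≤ C := ENNReal.toReal_nonneg
  set r : ℝ := (δ / 2) ^ 2 / (C + 1) with hr
  have hr0 : 0 < r := by positivity
  have hosc : ∀ x y, |y - x| ≤ r → h x - δ / 2 ≤ h y := by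
    intro x y hxy
    have h2 := hs.sq_sub_le hC h1.1 x y
    have h3 : (h x - h y) ^ 2 ≤ (δ / 2) ^ 2 := by
      refine h2.trans ?_
      rw [abs_sub_comm]
      calc C * |y - x| ≤ (C + 1) * r := by gcongr; linarith
        _ = (δ / 2) ^ 2 := by rw [hr]; field_simp
    have := abs_le_of_sq_le_sq' h3 (by positivity)
    linarith [this.2]
  have hmass : ∀ x, δ ≤ h x → r * (δ / 2) ≤ ∫ y in Ioc x (x + r), h y := by
    intro x hx
    have h2 : ∫ _ in Ioc x (x + r), (δ / 2) = r * (δ / 2) := by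
      simp [hr0.le]
    rw [← h2]
    refine setIntegral_mono_on (by simp) hi.integrableOn measurableSet_Ioc
      fun y hy => ?_
    have := hosc x y (by rw [abs_of_nonneg (by linarith [hy.1])]; linarith [hy.2])
    linarith
  have hlim := intervalIntegral_tendsto_integral hi (tendsto_neg_atTop_atBot)
    (tendsto_id (α := ℝ) (x := atTop))
  have hev : ∀ᶠ R : ℝ in atTop, (∫ x, h x) - r * (δ / 2) < ∫ x in (-R)..R, h x :=
    hlim.eventually (lt_mem_nhds (by
      have : 0 < r * (δ / 2) := by positivity
      linarith))
  obtain ⟨R, hR, hR0⟩ := (hev.and (eventually_gt_atTop 0)).exists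
  refine ⟨R + r, by positivity, fun x hx => ?_⟩
  by_contra hlt
  have h2 := hmass x (not_lt.1 hlt)
  rw [intervalIntegral.integral_of_le (by linarith)] at hR
  have hdisj : Disjoint (Ioc (-R) R) (Ioc x (x + r)) := by
    rw [Set.disjoint_left]
    rintro y ⟨h3, h4⟩ ⟨h5, h6⟩
    rcases le_abs.1 hx with h7 | h7 <;> linarith
  have h3 : (∫ y in Ioc (-R) R, h y) + ∫ y in Ioc x (x + r), h y ≤ ∫ y, h y := by
    rw [← setIntegral_union hdisj measurableSet_Ioc hi.integrableOn hi.integrableOn]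
    exact setIntegral_le_integral hi (Eventually.of_forall h0)
  linarith

/-- As $h(a)=0$, the cut function is $x\mapsto h(\min(x,a))$, so the cut creates no jump. -/
theorem hasWeakDeriv_indicator_Iic {h g : ℝ → ℝ} {a : ℝ} (hc : Continuous h)
    (hg : HasWeakDeriv univ 1 h g) (ha : h a = 0) :
    Continuous ((Iic a).indicator h) ∧
      HasWeakDeriv univ 1 ((Iic a).indicator h) ((Iic a).indicator g) := by
  have hgl : LocallyIntegrable g volume := locallyIntegrableOn_univ.1 hg.2.1
  have hgl' : LocallyIntegrable ((Iic a).indicator g) volume := hgl.indicator measurableSet_Iic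
  have he : (Iic a).indicator h = fun x => h (min x a) := by
    ext x
    rcases le_or_gt x a with hx | hx
    · rw [indicator_of_mem (mem_Iic.2 hx), min_eq_left hx]
    · rw [indicator_of_notMem (notMem_Iic.2 hx), min_eq_right hx.le, ha]
  have hcont : Continuous ((Iic a).indicator h) := by
    rw [he]
    fun_prop
  refine ⟨hcont, hasWeakDeriv_of_eq_integral hgl' hcont fun c d => ?_⟩
  have key : ∀ d, (Iic a).indicator h d = ∫ x in a..d, (Iic a).indicator g x := by
    intro d
    rcases le_or_gt d a with hd | hd
    · rw [indicator_of_mem (mem_Iic.2 hd), ← sub_zero (h d), ← ha, hg.sub_eq_integral hc]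
      refine intervalIntegral.integral_congr_ae (Eventually.of_forall fun x hx => ?_)
      rw [uIoc_of_ge hd] at hx
      rw [indicator_of_mem (mem_Iic.2 hx.2)]
    · rw [indicator_of_notMem (notMem_Iic.2 hd)]
      refine (intervalIntegral.integral_zero_ae (Eventually.of_forall fun x hx => ?_)).symm
      rw [uIoc_of_le hd.le] at hx
      rw [indicator_of_notMem (notMem_Iic.2 hx.1)]
  rw [key, key, intervalIntegral.integral_interval_sub_left
    (intervalIntegrable_of_locallyIntegrable hgl' _ _)
    (intervalIntegrable_of_locallyIntegrable hgl' _ _)]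

theorem hasWeakDeriv_indicator_Ioi {h g : ℝ → ℝ} {a : ℝ} (hc : Continuous h)
    (hg : HasWeakDeriv univ 1 h g) (ha : h a = 0) :
    Continuous ((Ioi a).indicator h) ∧
      HasWeakDeriv univ 1 ((Ioi a).indicator h) ((Ioi a).indicator g) := by
  have hgl : LocallyIntegrable g volume := locallyIntegrableOn_univ.1 hg.2.1
  have hgl' : LocallyIntegrable ((Ioi a).indicator g) volume := hgl.indicator measurableSet_Ioi
  have he : (Ioi a).indicator h = fun x => h (max x a) := by
    ext x
    rcases lt_or_ge a x with hx | hx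
    · rw [indicator_of_mem (mem_Ioi.2 hx), max_eq_left hx.le]
    · rw [indicator_of_notMem (notMem_Ioi.2 hx), max_eq_right hx, ha]
  have hcont : Continuous ((Ioi a).indicator h) := by
    rw [he]
    fun_prop
  refine ⟨hcont, hasWeakDeriv_of_eq_integral hgl' hcont fun c d => ?_⟩
  have key : ∀ d, (Ioi a).indicator h d = ∫ x in a..d, (Ioi a).indicator g x := by
    intro d
    rcases lt_or_ge a d with hd | hd
    · rw [indicator_of_mem (mem_Ioi.2 hd), ← sub_zero (h d), ← ha, hg.sub_eq_integral hc]
      refine intervalIntegral.integral_congr_ae (Eventually.of_forall fun x hx => ?_)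
      rw [uIoc_of_le hd.le] at hx
      rw [indicator_of_mem (mem_Ioi.2 hx.1)]
    · rw [indicator_of_notMem (notMem_Ioi.2 hd)]
      refine (intervalIntegral.integral_zero_ae (Eventually.of_forall fun x hx => ?_)).symm
      rw [uIoc_of_ge hd] at hx
      rw [indicator_of_notMem (notMem_Ioi.2 hx.2)]
  rw [key, key, intervalIntegral.integral_interval_sub_left
    (intervalIntegrable_of_locallyIntegrable hgl' _ _)
    (intervalIntegrable_of_locallyIntegrable hgl' _ _)]

theorem MemH1Line.indicator_Iic {h : ℝ → ℝ} {a : ℝ} (hh : MemH1Line h) (ha : h a = 0) :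
    MemH1Line ((Iic a).indicator h) := by
  obtain ⟨hc, hm, g, hg, hgm⟩ := hh
  obtain ⟨h1, h2⟩ := hasWeakDeriv_indicator_Iic hc hg ha
  exact ⟨h1, hm.indicator measurableSet_Iic, _, h2, hgm.indicator measurableSet_Iic⟩

theorem MemH1Line.indicator_Ioi {h : ℝ → ℝ} {a : ℝ} (hh : MemH1Line h) (ha : h a = 0) :
    MemH1Line ((Ioi a).indicator h) := by
  obtain ⟨hc, hm, g, hg, hgm⟩ := hh
  obtain ⟨h1, h2⟩ := hasWeakDeriv_indicator_Ioi hc hg ha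
  exact ⟨h1, hm.indicator measurableSet_Ioi, _, h2, hgm.indicator measurableSet_Ioi⟩

theorem surfaceEnergy_indicator_add_le {h : ℝ → ℝ} {a : ℝ} (hc : Continuous h) (ha : h a = 0) :
    surfaceEnergy ((Iic a).indicator h) + surfaceEnergy ((Ioi a).indicator h)
      ≤ surfaceEnergy h := by
  refine le_iInf₂ fun g hg => ?_
  have h1 := (hasWeakDeriv_indicator_Iic hc hg ha).2
  have h2 := (hasWeakDeriv_indicator_Ioi hc hg ha).2
  refine (add_le_add (iInf₂_le _ h1) (iInf₂_le _ h2)).trans (le_of_eq ?_)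
  have e : ∀ s : Set ℝ, (fun x => ENNReal.ofReal (s.indicator g x ^ 2))
      = s.indicator fun x => ENNReal.ofReal (g x ^ 2) := fun s => by
    ext x
    by_cases hx : x ∈ s <;> simp [hx]
  rw [e, e, lintegral_indicator measurableSet_Iic, lintegral_indicator measurableSet_Ioi,
    ← compl_Iic, lintegral_add_compl _ measurableSet_Iic]

/-- Testing with $\varphi=w'$ gives $X^2\le CX$ for $X=\int w'^2$. -/
theorem IsTest.integral_sq_deriv_le {w : ℝ → ℝ} {C : ℝ} (hC : 0 ≤ C)
    (hw : IsTest univ w) (hs : SlopeBound w C) : ∫ x, deriv w x ^ 2 ≤ C := by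
  have h1 := hs _ hw.isTest_deriv
  have h2 : ∫ x, w x * deriv (deriv w) x = - ∫ x, deriv w x * deriv w x :=
    integral_mul_deriv_eq_deriv_mul_of_integrable
      (fun x _ => (hw.differentiable x).hasDerivAt)
      (fun x _ => (hw.isTest_deriv.differentiable x).hasDerivAt)
      (hw.isTest_deriv.isTest_deriv.integrable_mul (hw.continuous.locallyIntegrable.locallyIntegrableOn _))
      (hw.isTest_deriv.integrable_mul (hw.isTest_deriv.continuous.locallyIntegrable.locallyIntegrableOn _))
      (hw.isTest_deriv.integrable_mul (hw.continuous.locallyIntegrable.locallyIntegrableOn _))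
  simp_rw [← pow_two] at h2
  rw [h2, neg_sq] at h1
  by_contra hlt
  push Not at hlt
  nlinarith

/-- A convolution with a probability density is an average of translates, and each translate obeys
the same bound. -/
theorem SlopeBound.convolution {T ρ : ℝ → ℝ} {C : ℝ} (hC : 0 ≤ C) (hT : Continuous T)
    (hs : SlopeBound T C) (hρ : Continuous ρ) (hρc : HasCompactSupport ρ) (hρ0 : ∀ x, 0 ≤ ρ x)
    (hρ1 : ∫ x, ρ x = 1) : SlopeBound (fun x => ∫ t, ρ t * T (x - t)) C := by
  intro φ hφ
  have hφ' := hφ.isTest_deriv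
  have hsw : ∫ x, (∫ t, ρ t * T (x - t)) * deriv φ x
      = ∫ t, ρ t * ∫ x, T (x - t) * deriv φ x := by
    simp_rw [← integral_mul_const, ← integral_const_mul]
    rw [integral_integral_swap]
    · simp_rw [mul_assoc]
    · refine Continuous.integrable_of_hasCompactSupport ?_ ?_
      · have := hφ'.continuous
        simp only [Function.uncurry_def]
        fun_prop
      · refine HasCompactSupport.intro (hφ'.2.isCompact.prod hρc.isCompact) fun p hp => ?_
        simp only [Function.uncurry_def]
        rw [mem_prod, not_and_or] at hp
        rcases hp with hp | hp
        · rw [image_eq_zero_of_notMem_tsupport hp, mul_zero]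
        · rw [image_eq_zero_of_notMem_tsupport hp, zero_mul, zero_mul]
  set B := C * ∫ x, φ x ^ 2 with hB
  have hB0 : 0 ≤ B := mul_nonneg hC (integral_nonneg fun _ => sq_nonneg _)
  have hb : ∀ t, |∫ x, T (x - t) * deriv φ x| ≤ √B := fun t =>
    Real.abs_le_sqrt (hs.comp_sub_right hC hT t φ hφ)
  rw [hsw, ← Real.sq_sqrt hB0]
  refine sq_le_sq.2 ?_
  rw [abs_of_nonneg (Real.sqrt_nonneg B)]
  have h1 : ‖∫ t, ρ t * ∫ x, T (x - t) * deriv φ x‖ ≤ ∫ t, ρ t * √B := by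
    refine norm_integral_le_of_norm_le
      ((hρ.integrable_of_hasCompactSupport hρc).mul_const _) (Eventually.of_forall fun t => ?_)
    rw [norm_mul, Real.norm_of_nonneg (hρ0 t)]
    exact mul_le_mul_of_nonneg_left (hb t) (hρ0 t)
  rwa [integral_mul_const, hρ1, one_mul] at h1

/-- The function $(\min(h,M)-2\eta)^+$ is mollified at a scale $r$ on which $\min(h,M)$ oscillates
by at most $\eta$. The margin $2\eta$ keeps the result below $\min(h,M)$ and its support inside
$\{\min(h,M)\ge\eta\}$, a compact subset of $\{h>0\}$. -/
theorem IsProfile.exists_smooth_approx {V : ℝ} {h : ℝ → ℝ} (hh : IsProfile V h) {M ε : ℝ}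
    (hM : 0 < M) (hε : 0 < ε) :
    ∃ w : ℝ → ℝ, IsTest {x | 0 < h x} w ∧ (∀ x, 0 ≤ w x) ∧ (∀ x, w x ≤ min (h x) M) ∧
      (∀ x, min (h x) M - ε ≤ w x) ∧ ∫ x, deriv w x ^ 2 ≤ (surfaceEnergy h).toReal := by
  set C := (surfaceEnergy h).toReal with hCdef
  have hC : 0 ≤ C := ENNReal.toReal_nonneg
  have hc := hh.1.1
  have hs : SlopeBound h C := hh.1.slopeBound
  set η := ε / 3 with hη
  have hη0 : 0 < η := by positivity
  set r : ℝ := η ^ 2 / (C + 1) with hr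
  have hr0 : 0 < r := by positivity
  have hosc : ∀ x y, |x - y| ≤ r → |min (h x) M - min (h y) M| ≤ η := by
    intro x y hxy
    refine (abs_min_sub_min_le_max (h x) M (h y) M).trans ?_
    rw [sub_self, abs_zero, max_eq_left (abs_nonneg _)]
    refine abs_le_of_sq_le_sq ((hs.sq_sub_le hC hc x y).trans ?_) hη0.le
    calc C * |x - y| ≤ (C + 1) * r := by gcongr; linarith
      _ = η ^ 2 := by rw [hr]; field_simp
  set T : ℝ → ℝ := fun x => max (min (h x) M - 2 * η) 0 with hT
  have hTc : Continuous T := by fun_prop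
  have hTs : SlopeBound T C := hs.comp_contraction (f := fun a => max (min a M - 2 * η) 0) hC hc
    fun a b => by
      refine (abs_max_sub_max_le_max _ _ _ _).trans ?_
      rw [sub_self, abs_zero, max_eq_left (abs_nonneg _), sub_sub_sub_cancel_right]
      refine (abs_min_sub_min_le_max a M b M).trans ?_
      rw [sub_self, abs_zero, max_eq_left (abs_nonneg _)]
  have hTosc : ∀ x y, |x - y| ≤ r → |T x - T y| ≤ η := by
    intro x y hxy
    refine (abs_max_sub_max_le_max _ _ _ _).trans ?_
    rw [sub_self, abs_zero, max_eq_left (abs_nonneg _), sub_sub_sub_cancel_right]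
    exact hosc x y hxy
  let β : ContDiffBump (0 : ℝ) := ⟨r / 2, r, by positivity, by linarith⟩
  set w : ℝ → ℝ := fun x => ∫ t, β.normed volume t * T (x - t) with hw
  have hwc : w = convolution (β.normed volume) T (ContinuousLinearMap.lsmul ℝ ℝ) volume := rfl
  have hwT : ∀ x, |w x - T x| ≤ η := fun x => by
    rw [hwc, ← Real.dist_eq]
    refine β.dist_normed_convolution_le hTc.aestronglyMeasurable fun y hy => ?_
    rw [Real.dist_eq]
    refine hTosc y x ?_
    rw [← Real.dist_eq]
    exact (Metric.mem_ball.1 hy).le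
  have hwpos : ∀ x, w x ≠ 0 → η < min (h x) M := by
    intro x hx
    by_contra hlt
    push Not at hlt
    refine hx ?_
    have h1 : dist (w x) (T x) ≤ 0 := by
      rw [hwc]
      have hT0 : ∀ y, |y - x| ≤ r → T y = 0 := fun y hy => by
        have := (abs_le.1 (hosc y x hy)).2
        exact max_eq_right (by linarith)
      refine β.dist_normed_convolution_le hTc.aestronglyMeasurable fun y hy => ?_
      rw [hT0 x (by simp [hr0.le]), hT0 y (by
        rw [← Real.dist_eq]
        exact (Metric.mem_ball.1 hy).le), dist_self]
    have h2 : T x = 0 := max_eq_right (by linarith)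
    rw [h2] at h1
    exact dist_le_zero.1 h1
  have hw0 : ∀ x, 0 ≤ w x := fun x =>
    integral_nonneg fun t => mul_nonneg (β.nonneg_normed t) (le_max_right _ _)
  have hws : SlopeBound w C := hTs.convolution hC hTc β.continuous_normed
    β.hasCompactSupport_normed (fun x => β.nonneg_normed x) β.integral_normed
  obtain ⟨R, hR, hRh⟩ := hh.exists_forall_lt hη0
  have hts : tsupport w ⊆ {x | η ≤ min (h x) M} :=
    closure_minimal (fun x hx => (hwpos x hx).le)
      (isClosed_le continuous_const (hc.min continuous_const))
  have hwt : IsTest {x | 0 < h x} w := by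
    refine ⟨?_, ?_, ?_⟩
    · rw [hwc]
      exact HasCompactSupport.contDiff_convolution_left _ β.hasCompactSupport_normed
        β.contDiff_normed hTc.locallyIntegrable
    · refine HasCompactSupport.intro (isCompact_Icc (a := -R) (b := R)) fun x hx => ?_
      by_contra h1
      have h2 := (lt_min_iff.1 (hwpos x h1)).1
      refine absurd (hRh x ?_) (not_lt.2 h2.le)
      by_contra h3
      exact hx (abs_le.1 (not_le.1 h3).le)
    · exact fun x hx => hη0.trans_le ((hts hx).trans (min_le_left _ _))
  refine ⟨w, hwt, hw0, fun x => ?_, fun x => ?_, (hwt.mono (subset_univ _)).integral_sq_deriv_le hC hws⟩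
  · by_cases hx : w x = 0
    · rw [hx]
      exact le_min (hh.2.1 x) hM.le
    · have h1 := hwpos x hx
      have h2 := (abs_le.1 (hwT x)).2
      have h3 : T x ≤ min (h x) M - η := max_le (by linarith) (by linarith)
      linarith
  · have h2 := (abs_le.1 (hwT x)).1
    have h3 : min (h x) M - 2 * η ≤ T x := le_max_left _ _
    linarith

/-! ### The dual problem and weak duality -/

/-- The dual functional `2 ∫ ψ(x,0) dx - ∫_{y > 0} |∇ψ|²`. -/
def dualValue (ψ : ℝ × ℝ → ℝ) : ℝ :=
  2 * (∫ x, ψ (x, 0)) -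
    ∫ p in {p : ℝ × ℝ | 0 < p.2}, (fderiv ℝ ψ p (1, 0) ^ 2 + fderiv ℝ ψ p (0, 1) ^ 2)

/-- The supremum of the dual functional over the test functions in `D`. -/
def dualEnergy (D : Set (ℝ × ℝ)) : ℝ≥0∞ :=
  ⨆ (ψ : ℝ × ℝ → ℝ) (_ : IsTest D ψ), ENNReal.ofReal (dualValue ψ)

theorem dualEnergy_mono {D D' : Set (ℝ × ℝ)} (h : D ⊆ D') : dualEnergy D ≤ dualEnergy D' :=
  iSup₂_le fun ψ hψ => le_iSup₂ (f := fun ψ (_ : IsTest D' ψ) => ENNReal.ofReal (dualValue ψ)) ψ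
    (hψ.mono h)

theorem IsTest.le_dualEnergy {D : Set (ℝ × ℝ)} {ψ : ℝ × ℝ → ℝ} (hψ : IsTest D ψ) :
    ENNReal.ofReal (dualValue ψ) ≤ dualEnergy D :=
  le_iSup₂ (f := fun ψ (_ : IsTest D ψ) => ENNReal.ofReal (dualValue ψ)) ψ hψ

theorem isOpen_upperPart {D : Set (ℝ × ℝ)} (hD : IsOpen D) : IsOpen (upperPart D) :=
  hD.inter (isOpen_lt continuous_const continuous_snd)

theorem IsTest.isTest_slice {D : Set (ℝ × ℝ)} {ψ : ℝ × ℝ → ℝ} (h : IsTest D ψ) (y : ℝ) :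
    IsTest univ (fun x => ψ (x, y)) := by
  refine ⟨h.1.comp (contDiff_id.prodMk contDiff_const), ?_, subset_univ _⟩
  refine HasCompactSupport.intro (h.2.isCompact.image continuous_fst) fun x hx => ?_
  exact image_eq_zero_of_notMem_tsupport fun h' => hx ⟨_, h', rfl⟩

theorem IsTest.isTest_slice_snd {D : Set (ℝ × ℝ)} {ψ : ℝ × ℝ → ℝ} (h : IsTest D ψ) (x : ℝ) :
    IsTest univ (fun y => ψ (x, y)) := by
  refine ⟨h.1.comp (contDiff_const.prodMk contDiff_id), ?_, subset_univ _⟩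
  refine HasCompactSupport.intro (h.2.isCompact.image continuous_snd) fun x hx => ?_
  exact image_eq_zero_of_notMem_tsupport fun h' => hx ⟨_, h', rfl⟩

theorem IsTest.hasDerivAt_slice {D : Set (ℝ × ℝ)} {ψ : ℝ × ℝ → ℝ} (h : IsTest D ψ) (x y : ℝ) :
    HasDerivAt (fun x => ψ (x, y)) (fderiv ℝ ψ (x, y) (1, 0)) x :=
  (h.differentiable (x, y)).hasFDerivAt.comp_hasDerivAt x
    ((hasDerivAt_id x).prodMk (hasDerivAt_const x y))

theorem IsTest.hasDerivAt_slice_snd {D : Set (ℝ × ℝ)} {ψ : ℝ × ℝ → ℝ} (h : IsTest D ψ)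
    (x y : ℝ) : HasDerivAt (fun y => ψ (x, y)) (fderiv ℝ ψ (x, y) (0, 1)) y :=
  (h.differentiable (x, y)).hasFDerivAt.comp_hasDerivAt y
    ((hasDerivAt_const y x).prodMk (hasDerivAt_id y))

theorem IsTest.fderiv_fderiv_comm {D : Set (ℝ × ℝ)} {ψ : ℝ × ℝ → ℝ} (h : IsTest D ψ)
    (p v w : ℝ × ℝ) : fderiv ℝ (fun q => fderiv ℝ ψ q v) p w
      = fderiv ℝ (fun q => fderiv ℝ ψ q w) p v := by
  have h1 : DifferentiableAt ℝ (fderiv ℝ ψ) p :=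
    (h.1.fderiv_right (m := ∞) (by simp)).differentiable (by simp) p
  have h2 : ∀ v w : ℝ × ℝ, fderiv ℝ (fun q => fderiv ℝ ψ q v) p w
      = fderiv ℝ (fderiv ℝ ψ) p w v := fun v w => by
    rw [fderiv_clm_apply h1 (differentiableAt_const v)]
    simp
  rw [h2, h2]
  exact (h.1.contDiffAt.isSymmSndFDerivAt (by
    rw [minSmoothness_of_isRCLikeNormedField]
    exact WithTop.coe_le_coe.2 (le_top (a := (2 : ℕ∞))))) w v

theorem IsTest.integrableOn_mul_upperPart {D : Set (ℝ × ℝ)} {ψ u : ℝ × ℝ → ℝ} (h : IsTest D ψ)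
    (hu : LocallyIntegrableOn u {p ∈ D | 0 ≤ p.2} volume) :
    IntegrableOn (fun p => u p * ψ p) (upperPart D) volume := by
  have hK : IsCompact (tsupport ψ ∩ {p : ℝ × ℝ | 0 ≤ p.2}) :=
    h.2.isCompact.inter_right (isClosed_le continuous_const continuous_snd)
  have h1 : IntegrableOn u (tsupport ψ ∩ {p : ℝ × ℝ | 0 ≤ p.2}) volume :=
    hu.integrableOn_compact_subset (fun p hp => ⟨h.3 hp.1, hp.2⟩) hK
  have h2 : IntegrableOn (fun p => u p * ψ p) (tsupport ψ ∩ {p : ℝ × ℝ | 0 ≤ p.2}) volume :=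
    h1.mul_continuousOn h.continuous.continuousOn hK
  have h3 : IntegrableOn (fun p => u p * ψ p) {p : ℝ × ℝ | 0 ≤ p.2} volume := by
    refine h2.of_forall_sdiff_eq_zero (measurableSet_le measurable_const measurable_snd)
      fun p hp => ?_
    rw [image_eq_zero_of_notMem_tsupport fun h' => hp.2 ⟨h', hp.1⟩, mul_zero]
  exact h3.mono_set fun p hp => hp.2.le

theorem HasWeakDeriv.ae_eq {D : Set (ℝ × ℝ)} (hD : IsOpen D) {v : ℝ × ℝ} {u g g' : ℝ × ℝ → ℝ}
    (h : HasWeakDeriv D v u g) (h' : HasWeakDeriv D v u g') : g =ᵐ[volume.restrict D] g' := by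
  have h1 := hD.ae_eq_zero_of_integral_contDiff_smul_eq_zero (μ := volume) (h.2.1.sub h'.2.1)
    (fun φ h1 h2 h3 => by
      have hφ : IsTest D φ := ⟨h1, h2, h3⟩
      have h4 := h.2.2 φ h1 h2 h3
      rw [h'.2.2 φ h1 h2 h3, neg_inj] at h4
      have i1 := (hφ.integrable_mul h.2.1).integrableOn (s := D)
      have i2 := (hφ.integrable_mul h'.2.1).integrableOn (s := D)
      rw [← setIntegral_eq_integral_of_forall_compl_eq_zero (s := D) fun p hp => by
        rw [hφ.eq_zero hp, zero_smul]]
      have h5 : ∀ p, φ p • (g - g') p = g p * φ p - g' p * φ p := fun p => by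
        simp only [Pi.sub_apply, smul_eq_mul]
        ring
      simp_rw [h5]
      rw [integral_sub i1 i2, h4, sub_self])
  rw [Filter.EventuallyEq, ae_restrict_iff' hD.measurableSet]
  filter_upwards [h1] with p hp hpD
  exact sub_eq_zero.1 (hp hpD)

/-- The integration by parts formula in the direction of the `x`-axis holds for test functions
that do not vanish on the bottom boundary. -/
theorem integral_mul_fderiv_of_bottom {D : Set (ℝ × ℝ)} (hD : IsOpen D) {u g ψ : ℝ × ℝ → ℝ}
    (hu : LocallyIntegrableOn u {p ∈ D | 0 ≤ p.2} volume)
    (hg : HasWeakDeriv (upperPart D) (1, 0) u g)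
    (hgm : MemLp g 2 (volume.restrict (upperPart D))) (hψ : IsTest D ψ) :
    ∫ p in upperPart D, u p * fderiv ℝ ψ p (1, 0) = - ∫ p in upperPart D, g p * ψ p := by
  -- The cutoffs vanish near $y=0$ and tend to $1$ on $y>0$. They depend on $y$ alone, so the
  -- $x$-derivative does not see them and no boundary term appears.
  let χ : ℕ → ℝ × ℝ → ℝ := fun k p => Real.smoothTransition (k * p.2 - 1)
  have hχs : ∀ k, ContDiff ℝ ∞ (χ k) := fun k =>
    Real.smoothTransition.contDiff.comp ((contDiff_const.mul contDiff_snd).sub contDiff_const)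
  have hχ1 : ∀ k p, |χ k p| ≤ 1 := fun k p => by
    rw [abs_of_nonneg (Real.smoothTransition.nonneg _)]
    exact Real.smoothTransition.le_one _
  have hχlim : ∀ p : ℝ × ℝ, 0 < p.2 → Tendsto (fun k => χ k p) atTop (𝓝 1) := by
    intro p hp
    refine tendsto_const_nhds.congr' ?_
    obtain ⟨n, hn⟩ := exists_nat_ge (2 / p.2)
    filter_upwards [eventually_ge_atTop n] with k hk
    refine (Real.smoothTransition.one_of_one_le ?_).symm
    rw [div_le_iff₀ hp] at hn
    have : (n : ℝ) * p.2 ≤ k * p.2 := by gcongr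
    linarith
  have hχx : ∀ k p, HasFDerivAt (χ k) (fderiv ℝ (χ k) p) p := fun k p =>
    ((hχs k).differentiable (by simp) p).hasFDerivAt
  have hχx0 : ∀ k p, fderiv ℝ (χ k) p (1, 0) = 0 := by
    intro k p
    have h1 : HasDerivAt (fun x : ℝ => χ k (x, p.2)) (fderiv ℝ (χ k) p (1, 0)) p.1 :=
      HasFDerivAt.comp_hasDerivAt (f := fun x : ℝ => (x, p.2)) p.1 (hχx k p)
        ((hasDerivAt_id p.1).prodMk (hasDerivAt_const p.1 p.2))
    exact h1.unique (hasDerivAt_const p.1 (Real.smoothTransition (k * p.2 - 1)))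
  have hmeas := (isOpen_upperPart hD).measurableSet
  have i1 := (hψ.fderiv_apply (1, 0)).integrableOn_mul_upperPart hu
  have i2 : IntegrableOn (fun p => g p * ψ p) (upperPart D) volume :=
    hgm.integrable_mul ((hψ.memLp 2 volume).restrict _)
  have hk : ∀ k : ℕ, ∫ p in upperPart D, χ k p * (u p * fderiv ℝ ψ p (1, 0))
      = - ∫ p in upperPart D, χ k p * (g p * ψ p) := by
    intro k
    have ht : tsupport (fun p => χ k p * ψ p) ⊆ upperPart D := by
      intro p hp
      refine ⟨hψ.3 (tsupport_mul_subset_right hp), ?_⟩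
      have h1 : tsupport (χ k) ⊆ {p : ℝ × ℝ | 1 ≤ k * p.2} := by
        refine closure_minimal (fun q hq => ?_)
          (isClosed_le continuous_const (continuous_const.mul continuous_snd))
        by_contra hlt
        have hlt' : (k : ℝ) * q.2 < 1 := not_le.1 hlt
        exact hq (Real.smoothTransition.zero_of_nonpos (by linarith))
      have h2 : 1 ≤ (k : ℝ) * p.2 := h1 (tsupport_mul_subset_left hp)
      by_contra h3
      have : (k : ℝ) * p.2 ≤ 0 := mul_nonpos_of_nonneg_of_nonpos (Nat.cast_nonneg k) (not_lt.1 h3)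
      linarith
    have h1 := hg.2.2 (fun p => χ k p * ψ p) ((hχs k).mul hψ.1) hψ.2.mul_left ht
    have h2 : ∀ p, fderiv ℝ (fun p => χ k p * ψ p) p (1, 0) = χ k p * fderiv ℝ ψ p (1, 0) := by
      intro p
      rw [fderiv_fun_mul (hχx k p).differentiableAt (hψ.differentiable p)]
      simp [hχx0]
    simp_rw [h2] at h1
    calc _ = ∫ p in upperPart D, u p * (χ k p * fderiv ℝ ψ p (1, 0)) :=
          integral_congr_ae (Eventually.of_forall fun p => by ring)
      _ = _ := h1
      _ = _ := by
          congr 1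
          exact integral_congr_ae (Eventually.of_forall fun p => by ring)
  have hlim : ∀ f : ℝ × ℝ → ℝ, IntegrableOn f (upperPart D) volume →
      Tendsto (fun k => ∫ p in upperPart D, χ k p * f p) atTop (𝓝 (∫ p in upperPart D, f p)) := by
    intro f hf
    refine tendsto_integral_of_dominated_convergence (fun p => |f p|) (fun k => ?_) hf.abs
      (fun k => Eventually.of_forall fun p => ?_) ?_
    · exact (hχs k).continuous.aestronglyMeasurable.mul hf.aestronglyMeasurable
    · rw [norm_mul]
      exact mul_le_of_le_one_left (abs_nonneg _) (hχ1 k p)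
    · rw [ae_restrict_iff' hmeas]
      refine Eventually.of_forall fun p hp => ?_
      simpa using (hχlim p hp.2).mul_const (f p)
  refine tendsto_nhds_unique (hlim _ i1) ?_
  simp_rw [hk]
  exact (hlim _ i2).neg

/-- Integrating $u\,\psi_{xy}$ by parts both in $x$ and in $y$ gives
$\int\psi(x,0)\,dx=\int(u_y\psi_x-u_x\psi_y)$: the trace $x$ enters through $-\int
x\,\psi_x(x,0)\,dx=\int\psi(x,0)\,dx$. Then $2ab\le a^2+b^2$ pointwise. -/
theorem dualEnergy_le_dirichletEnergy {D : Set (ℝ × ℝ)} (hD : IsOpen D) {u : ℝ × ℝ → ℝ}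
    (hu : HasBottomTrace D u fun x => x) : dualEnergy D ≤ dirichletEnergy (upperPart D) u := by
  refine iSup₂_le fun ψ hψ => ?_
  refine le_iInf fun g₁ => le_iInf fun g₂ => le_iInf fun h₁ => le_iInf fun h₂ => ?_
  obtain ⟨g, hg, hul, -, htr⟩ := hu
  by_cases htop : ∫⁻ p in upperPart D, ENNReal.ofReal (g₁ p ^ 2 + g₂ p ^ 2) = ⊤
  · rw [htop]
    exact le_top
  have hm1 : MemLp g₁ 2 (volume.restrict (upperPart D)) :=
    memLp_two_of_lintegral_lt_top (h₁.2.1.aestronglyMeasurable)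
      (lt_of_le_of_lt (lintegral_mono fun p => ENNReal.ofReal_le_ofReal (by nlinarith))
        (Ne.lt_top htop))
  have hm2 : MemLp g₂ 2 (volume.restrict (upperPart D)) :=
    memLp_two_of_lintegral_lt_top (h₂.2.1.aestronglyMeasurable)
      (lt_of_le_of_lt (lintegral_mono fun p => ENNReal.ofReal_le_ofReal (by nlinarith))
        (Ne.lt_top htop))
  have hψx := hψ.fderiv_apply (1, 0)
  have hψy := hψ.fderiv_apply (0, 1)
  have hmx : MemLp (fun p => fderiv ℝ ψ p (1, 0)) 2 (volume.restrict (upperPart D)) :=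
    (hψx.memLp 2 volume).restrict _
  have hmy : MemLp (fun p => fderiv ℝ ψ p (0, 1)) 2 (volume.restrict (upperPart D)) :=
    (hψy.memLp 2 volume).restrict _
  have e1 := integral_mul_fderiv_of_bottom hD hul h₁ hm1 hψy
  have e2 := htr _ hψx.1 hψx.2 hψx.3
  have e3 : ∫ p in upperPart D, g p * fderiv ℝ ψ p (1, 0)
      = ∫ p in upperPart D, g₂ p * fderiv ℝ ψ p (1, 0) := by
    refine integral_congr_ae ?_
    filter_upwards [hg.ae_eq (isOpen_upperPart hD) h₂] with p hp
    rw [hp]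
  have e4 : ∫ x in {x : ℝ | (x, (0 : ℝ)) ∈ D}, x * fderiv ℝ ψ (x, 0) (1, 0) = - ∫ x, ψ (x, 0) := by
    rw [setIntegral_eq_integral_of_forall_compl_eq_zero fun x hx => by
      rw [hψx.eq_zero hx, mul_zero]]
    have hs := hψ.isTest_slice 0
    have hsd : (fun x => fderiv ℝ ψ (x, 0) (1, 0)) = deriv fun x => ψ (x, 0) :=
      funext fun x => (hψ.hasDerivAt_slice x 0).deriv.symm
    have h1 := integral_mul_deriv_eq_deriv_mul_of_integrable (u := fun x : ℝ => x)
      (u' := fun _ => (1 : ℝ)) (v := fun x => ψ (x, 0))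
      (v' := fun x => fderiv ℝ ψ (x, 0) (1, 0))
      (fun x _ => hasDerivAt_id x) (fun x _ => hψ.hasDerivAt_slice x 0)
      (by
        rw [hsd]
        exact hs.isTest_deriv.integrable_mul
          (continuous_id.locallyIntegrable.locallyIntegrableOn _))
      (hs.integrable_mul (continuous_const.locallyIntegrable.locallyIntegrableOn _))
      (hs.integrable_mul (continuous_id.locallyIntegrable.locallyIntegrableOn _))
    simpa using h1
  simp_rw [hψ.fderiv_fderiv_comm _ (0, 1) (1, 0)] at e1
  rw [e1, e3, e4] at e2
  have i1 : IntegrableOn (fun p => g₁ p * fderiv ℝ ψ p (0, 1)) (upperPart D) volume :=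
    hm1.integrable_mul hmy
  have i2 : IntegrableOn (fun p => g₂ p * fderiv ℝ ψ p (1, 0)) (upperPart D) volume :=
    hm2.integrable_mul hmx
  have j12 : IntegrableOn (fun p => g₁ p ^ 2 + g₂ p ^ 2) (upperPart D) volume :=
    hm1.integrable_sq.add hm2.integrable_sq
  have kxy : IntegrableOn (fun p => fderiv ℝ ψ p (1, 0) ^ 2 + fderiv ℝ ψ p (0, 1) ^ 2)
      (upperPart D) volume := hmx.integrable_sq.add hmy.integrable_sq
  have e5 : 2 * (∫ x, ψ (x, 0)) ≤ (∫ p in upperPart D, (g₁ p ^ 2 + g₂ p ^ 2)) +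
      ∫ p in upperPart D, (fderiv ℝ ψ p (1, 0) ^ 2 + fderiv ℝ ψ p (0, 1) ^ 2) := by
    have e6 : ∫ x, ψ (x, 0) = ∫ p in upperPart D,
        (g₂ p * fderiv ℝ ψ p (1, 0) - g₁ p * fderiv ℝ ψ p (0, 1)) := by
      rw [integral_sub i2 i1]
      linarith
    rw [e6, ← integral_const_mul, ← integral_add j12 kxy]
    refine integral_mono ((i2.sub i1).const_mul 2) (j12.add kxy) fun p => ?_
    simp only
    nlinarith [sq_nonneg (g₂ p - fderiv ℝ ψ p (1, 0)), sq_nonneg (g₁ p + fderiv ℝ ψ p (0, 1))]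
  have e7 : ∫ p in upperPart D, (fderiv ℝ ψ p (1, 0) ^ 2 + fderiv ℝ ψ p (0, 1) ^ 2)
      ≤ ∫ p in {p : ℝ × ℝ | 0 < p.2}, (fderiv ℝ ψ p (1, 0) ^ 2 + fderiv ℝ ψ p (0, 1) ^ 2) := by
    refine setIntegral_mono_set ?_ (Eventually.of_forall fun p => by positivity)
      (Eventually.of_forall fun p hp => hp.2)
    exact ((hψx.memLp 2 volume).integrable_sq.add (hψy.memLp 2 volume).integrable_sq).integrableOn
  rw [← ofReal_integral_eq_lintegral_ofReal j12
    (Eventually.of_forall fun p => by positivity)]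
  refine ENNReal.ofReal_le_ofReal ?_
  unfold dualValue
  linarith

/-! ### Vertical primitives and strong duality on strips -/

/-- The primitive of `F` in the vertical direction. -/
def verticalPrimitive (F : ℝ × ℝ → ℝ) (p : ℝ × ℝ) : ℝ := ∫ t in Iic p.2, F (p.1, t)

theorem stronglyMeasurable_verticalPrimitive {F : ℝ × ℝ → ℝ} (hF : StronglyMeasurable F) :
    StronglyMeasurable (verticalPrimitive F) := by
  have hs : MeasurableSet {q : (ℝ × ℝ) × ℝ | q.2 ≤ q.1.2} :=
    measurableSet_le measurable_snd (measurable_snd.comp measurable_fst)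
  have h1 : StronglyMeasurable ({q : (ℝ × ℝ) × ℝ | q.2 ≤ q.1.2}.indicator
      fun q => F (q.1.1, q.2)) :=
    (hF.comp_measurable ((measurable_fst.comp measurable_fst).prodMk measurable_snd)).indicator hs
  have h2 : verticalPrimitive F = fun p : ℝ × ℝ => ∫ t, {q : (ℝ × ℝ) × ℝ | q.2 ≤ q.1.2}.indicator
      (fun q => F (q.1.1, q.2)) (p, t) := by
    ext p
    rw [verticalPrimitive, ← integral_indicator measurableSet_Iic]
    rfl
  rw [h2]
  exact h1.integral_prod_right'

theorem verticalPrimitive_eq_zero {F : ℝ × ℝ → ℝ} (h0 : ∀ p : ℝ × ℝ, p.2 ≤ 0 → F p = 0)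
    {p : ℝ × ℝ} (hp : p.2 ≤ 0) : verticalPrimitive F p = 0 :=
  setIntegral_eq_zero_of_forall_eq_zero fun _ ht => h0 _ (le_trans ht hp)

theorem memLp_slice {F : ℝ × ℝ → ℝ} (hF : StronglyMeasurable F) (hm : MemLp F 2 volume) :
    ∀ᵐ x : ℝ, MemLp (fun t => F (x, t)) 2 volume := by
  have h1 : Integrable (fun p => F p ^ 2) (volume.prod volume) := hm.integrable_sq
  filter_upwards [h1.prod_right_ae] with x hx
  exact (memLp_two_iff_integrable_sq
    (hF.comp_measurable measurable_prodMk_left).aestronglyMeasurable).2 hx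

theorem verticalPrimitive_sub {F : ℝ × ℝ → ℝ} (h0 : ∀ p : ℝ × ℝ, p.2 ≤ 0 → F p = 0) {x : ℝ}
    (hx : LocallyIntegrable (fun t => F (x, t)) volume) (a b : ℝ) :
    verticalPrimitive F (x, b) - verticalPrimitive F (x, a) = ∫ t in a..b, F (x, t) := by
  have hi : ∀ b, IntegrableOn (fun t => F (x, t)) (Iic b) volume := by
    intro b
    have h1 : IntegrableOn (fun t => F (x, t)) (Icc 0 b) volume :=
      hx.integrableOn_isCompact isCompact_Icc
    refine h1.of_forall_sdiff_eq_zero measurableSet_Iic fun t ht => h0 _ ?_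
    by_contra hlt
    exact ht.2 ⟨(not_le.1 hlt).le, ht.1⟩
  exact intervalIntegral.integral_Iic_sub_Iic (hi a) (hi b)

/-- Cauchy–Schwarz on $(0,y)$. The factor $y$ is why the primitive is square integrable only below a
finite height. -/
theorem sq_verticalPrimitive_le {F : ℝ × ℝ → ℝ} (hF : StronglyMeasurable F)
    (h0 : ∀ p : ℝ × ℝ, p.2 ≤ 0 → F p = 0) (x y : ℝ) :
    ENNReal.ofReal (verticalPrimitive F (x, y) ^ 2)
      ≤ ENNReal.ofReal y * ∫⁻ t, ENNReal.ofReal (F (x, t) ^ 2) := by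
  rcases le_or_gt y 0 with hy | hy
  · rw [verticalPrimitive_eq_zero h0 (by exact hy)]
    simp
  by_cases htop : ∫⁻ t, ENNReal.ofReal (F (x, t) ^ 2) = ⊤
  · rw [htop, ENNReal.mul_top (by simpa using hy)]
    exact le_top
  have hm : MemLp (fun t => F (x, t)) 2 volume := memLp_two_of_lintegral_lt_top
    (hF.comp_measurable measurable_prodMk_left).aestronglyMeasurable (Ne.lt_top htop)
  rw [lintegral_ofReal_sq hm, ← ENNReal.ofReal_mul hy.le]
  refine ENNReal.ofReal_le_ofReal ?_
  have h1 := verticalPrimitive_sub h0 (hm.locallyIntegrable (by norm_num)) 0 y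
  rw [verticalPrimitive_eq_zero h0 (p := (x, 0)) le_rfl, sub_zero] at h1
  rw [h1, intervalIntegral.integral_of_le hy.le]
  have h2 := sq_integral_mul_le (μ := volume.restrict (Ioc 0 y)) (f := fun _ => (1 : ℝ))
    (memLp_const 1) (hm.restrict _)
  simp only [one_mul, one_pow, integral_const, smul_eq_mul, mul_one, MeasurableSet.univ,
    measureReal_restrict_apply, univ_inter, Real.volume_real_Ioc_of_le hy.le, sub_zero] at h2
  refine h2.trans (mul_le_mul_of_nonneg_left ?_ hy.le)
  exact setIntegral_le_integral hm.integrable_sq (Eventually.of_forall fun _ => sq_nonneg _)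

theorem memLp_verticalPrimitive {F : ℝ × ℝ → ℝ} (hF : StronglyMeasurable F)
    (hm : MemLp F 2 volume) (h0 : ∀ p : ℝ × ℝ, p.2 ≤ 0 → F p = 0) (H : ℝ) :
    MemLp (verticalPrimitive F) 2 (volume.restrict (univ ×ˢ Iio H)) := by
  refine memLp_two_of_lintegral_lt_top
    (stronglyMeasurable_verticalPrimitive hF).aestronglyMeasurable ?_
  have hmeas : Measurable fun p => ENNReal.ofReal (verticalPrimitive F p ^ 2) :=
    ((stronglyMeasurable_verticalPrimitive hF).measurable.pow_const 2).ennreal_ofReal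
  have hmF : Measurable fun p => ENNReal.ofReal (F p ^ 2) :=
    (hF.measurable.pow_const 2).ennreal_ofReal
  have hQ : ∫⁻ x, ∫⁻ t, ENNReal.ofReal (F (x, t) ^ 2) < ⊤ := by
    have h1 := lintegral_ofReal_sq hm
    rw [Measure.volume_eq_prod, lintegral_prod _ hmF.aemeasurable] at h1
    rw [h1]
    exact ENNReal.ofReal_lt_top
  have hzero : ∀ x, ∀ y, y ∈ Iio H → y ∉ Ioo 0 H →
      ENNReal.ofReal (verticalPrimitive F (x, y) ^ 2) = 0 := by
    intro x y hy hy'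
    have : y ≤ 0 := by
      by_contra hlt
      exact hy' ⟨not_le.1 hlt, hy⟩
    rw [verticalPrimitive_eq_zero h0 (by exact this)]
    simp
  rw [Measure.volume_eq_prod, ← Measure.prod_restrict, Measure.restrict_univ,
    lintegral_prod _ hmeas.aemeasurable]
  calc ∫⁻ x, ∫⁻ y in Iio H, ENNReal.ofReal (verticalPrimitive F (x, y) ^ 2)
      ≤ ∫⁻ x, ENNReal.ofReal H * ENNReal.ofReal H * ∫⁻ t, ENNReal.ofReal (F (x, t) ^ 2) := by
        refine lintegral_mono fun x => ?_
        calc ∫⁻ y in Iio H, ENNReal.ofReal (verticalPrimitive F (x, y) ^ 2)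
            ≤ ∫⁻ y in Iio H, (Ioo 0 H).indicator (fun _ =>
              ENNReal.ofReal H * ∫⁻ t, ENNReal.ofReal (F (x, t) ^ 2)) y := by
              refine setLIntegral_mono' measurableSet_Iio fun y hy => ?_
              by_cases hy' : y ∈ Ioo 0 H
              · rw [indicator_of_mem hy']
                refine (sq_verticalPrimitive_le hF h0 x y).trans ?_
                gcongr
                exact hy'.2.le
              · rw [hzero x y hy hy']
                exact zero_le
          _ ≤ ∫⁻ y, (Ioo 0 H).indicator (fun _ =>
              ENNReal.ofReal H * ∫⁻ t, ENNReal.ofReal (F (x, t) ^ 2)) y := setLIntegral_le_lintegral _ _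
          _ = _ := by
              rw [lintegral_indicator measurableSet_Ioo, setLIntegral_const, Real.volume_Ioo,
                sub_zero]
              ring
    _ < ⊤ := by
        rw [lintegral_const_mul' _ _ (by finiteness)]
        exact ENNReal.mul_lt_top (by finiteness) hQ

theorem locallyIntegrable_verticalPrimitive {F : ℝ × ℝ → ℝ} (hF : StronglyMeasurable F)
    (hm : MemLp F 2 volume) (h0 : ∀ p : ℝ × ℝ, p.2 ≤ 0 → F p = 0) :
    LocallyIntegrable (verticalPrimitive F) volume := by
  rw [locallyIntegrable_iff]
  intro K hK
  obtain ⟨H, hH⟩ := (hK.image continuous_snd).bddAbove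
  have hs : K ⊆ univ ×ˢ Iio (H + 1) := fun p hp =>
    ⟨mem_univ _, (hH ⟨p, hp, rfl⟩).trans_lt (lt_add_one H)⟩
  have h1 : MemLp (verticalPrimitive F) 2 (volume.restrict K) :=
    (memLp_verticalPrimitive hF hm h0 (H + 1)).mono_measure (Measure.restrict_mono hs le_rfl)
  have : IsFiniteMeasure (volume.restrict K) := isFiniteMeasure_restrict.2 hK.measure_lt_top.ne
  exact h1.integrable (by norm_num)

theorem integral_verticalPrimitive_mul {F : ℝ × ℝ → ℝ} (hF : StronglyMeasurable F)
    (hm : MemLp F 2 volume) (h0 : ∀ p : ℝ × ℝ, p.2 ≤ 0 → F p = 0) {ψ : ℝ × ℝ → ℝ}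
    (hψ : IsTest univ ψ) :
    ∫ p, verticalPrimitive F p * fderiv ℝ ψ p (0, 1) = - ∫ p, F p * ψ p := by
  have i1 := (hψ.fderiv_apply (0, 1)).integrable_mul
    ((locallyIntegrable_verticalPrimitive hF hm h0).locallyIntegrableOn univ)
  have i2 := hψ.integrable_mul ((hm.locallyIntegrable (by norm_num)).locallyIntegrableOn univ)
  rw [Measure.volume_eq_prod] at i1 i2 ⊢
  rw [integral_prod _ i1, integral_prod _ i2, ← integral_neg]
  refine integral_congr_ae ?_
  filter_upwards [memLp_slice hF hm] with x hx
  have hxl := hx.locallyIntegrable (by norm_num)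
  have hcont : Continuous fun y => verticalPrimitive F (x, y) := by
    have h1 : (fun y => verticalPrimitive F (x, y)) = fun y => ∫ t in (0 : ℝ)..y, F (x, t) := by
      ext y
      rw [← verticalPrimitive_sub h0 hxl, verticalPrimitive_eq_zero h0 (p := (x, 0)) le_rfl,
        sub_zero]
    rw [h1]
    exact intervalIntegral.continuous_primitive (intervalIntegrable_of_locallyIntegrable hxl) 0
  have h1 := (hasWeakDeriv_of_eq_integral hxl hcont fun a b => verticalPrimitive_sub h0 hxl a b)
  have hs := hψ.isTest_slice_snd x
  have h2 := h1.2.2 _ hs.1 hs.2 hs.3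
  simp only [Measure.restrict_univ] at h2
  rw [← h2]
  refine integral_congr_ae (Eventually.of_forall fun y => ?_)
  change _ = _ * deriv (fun y => ψ (x, y)) y
  rw [(hψ.hasDerivAt_slice_snd x y).deriv]

/-- A test function on a strip that decreases with slope `φ` in the upper half plane. -/
theorem IsTest.exists_vertical_antiderivative {I : Set ℝ} {φ : ℝ × ℝ → ℝ}
    (hφ : IsTest (I ×ˢ Ioi 0) φ) :
    ∃ ψ : ℝ × ℝ → ℝ, IsTest (I ×ˢ univ) ψ ∧ (∀ p : ℝ × ℝ, 0 < p.2 →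
      fderiv ℝ ψ p (0, 1) = - φ p) ∧ ∀ x, ψ (x, 0) = ∫ y, φ (x, y) := by
  set K := Prod.fst '' tsupport φ with hK
  set L := Prod.snd '' tsupport φ with hL
  have hKc : IsCompact K := hφ.2.isCompact.image continuous_fst
  have hLc : IsCompact L := hφ.2.isCompact.image continuous_snd
  obtain ⟨R, hR⟩ := hLc.bddAbove
  have hφK : ∀ x y, x ∉ K → φ (x, y) = 0 := fun x y hx =>
    image_eq_zero_of_notMem_tsupport fun h' => hx ⟨_, h', rfl⟩
  have hφL : ∀ x y, y ∉ L → φ (x, y) = 0 := fun x y hy =>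
    image_eq_zero_of_notMem_tsupport fun h' => hy ⟨_, h', rfl⟩
  -- Convolution with the indicator of $(-\infty,0]$ in the vertical variable is
  -- $t\mapsto\int_t^\infty\varphi(x,y)\,dy$; smoothness in both variables then comes from the
  -- theory of convolutions with parameters.
  let f : ℝ → ℝ := (Iic 0).indicator fun _ => 1
  have hf : LocallyIntegrable f volume :=
    (locallyIntegrable_const (1 : ℝ)).indicator measurableSet_Iic
  let Φ : ℝ × ℝ → ℝ := fun q => (convolution f (fun y => φ (q.1, y))
    (ContinuousLinearMap.lsmul ℝ ℝ) volume) q.2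
  have hΦs : ContDiff ℝ ∞ Φ := by
    rw [← contDiffOn_univ, ← univ_prod_univ]
    refine contDiffOn_convolution_right_with_param (ContinuousLinearMap.lsmul ℝ ℝ)
      (g := fun x y => φ (x, y)) isOpen_univ hLc (fun x y _ hy => hφL x y hy) hf ?_
    exact hφ.1.contDiffOn
  have hΦe : ∀ x t, Φ (x, t) = ∫ y in Ici t, φ (x, y) := by
    intro x t
    change ∫ s, f s • φ (x, t - s) = _
    rw [← integral_indicator measurableSet_Ici, ← integral_sub_left_eq_self _ volume t]
    refine integral_congr_ae (Eventually.of_forall fun s => ?_)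
    simp only [f, sub_sub_cancel]
    by_cases hs : s ∈ Ici t
    · rw [indicator_of_mem hs, indicator_of_mem (mem_Iic.2 (sub_nonpos.2 hs)), one_smul]
    · rw [indicator_of_notMem hs, indicator_of_notMem (show t - s ∉ Iic 0 from
        fun h' => hs (sub_nonpos.1 (mem_Iic.1 h'))), zero_smul]
  have hslice : ∀ x, Integrable fun y => φ (x, y) := fun x =>
    (hφ.isTest_slice_snd x).integrable volume
  have hΦd : ∀ x t, HasDerivAt (fun t => Φ (x, t)) (- φ (x, t)) t := by
    intro x t
    have h1 : (fun t => Φ (x, t)) = fun t => (∫ y, φ (x, y)) - ∫ y in Iic t, φ (x, y) := by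
      ext t
      rw [hΦe, integral_Ici_eq_integral_Ioi, ← integral_add_compl measurableSet_Iic (hslice x),
        compl_Iic]
      ring
    have h2 : (fun t => ∫ y in Iic t, φ (x, y))
        = fun t => (∫ y in Iic 0, φ (x, y)) + ∫ y in (0 : ℝ)..t, φ (x, y) := by
      ext t
      rw [← intervalIntegral.integral_Iic_sub_Iic (hslice x).integrableOn (hslice x).integrableOn]
      ring
    have hcs : Continuous fun y => φ (x, y) := (hφ.isTest_slice_snd x).continuous
    have h3 : HasDerivAt (fun t => ∫ y in (0 : ℝ)..t, φ (x, y)) (φ (x, t)) t :=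
      intervalIntegral.integral_hasDerivAt_right (hcs.intervalIntegrable _ _)
        (hcs.stronglyMeasurableAtFilter _ _) hcs.continuousAt
    have h4 : HasDerivAt (fun t => ∫ y in Iic t, φ (x, y)) (φ (x, t)) t := by
      rw [h2]
      exact h3.const_add _
    rw [h1]
    exact h4.const_sub _
  -- Below the support of $\varphi$ the primitive is constant in $y$; this cutoff makes the support
  -- compact and equals $1$ for $y\ge0$.
  let χ : ℝ × ℝ → ℝ := fun p => Real.smoothTransition (p.2 + 1)
  have hχs : ContDiff ℝ ∞ χ :=
    Real.smoothTransition.contDiff.comp (contDiff_snd.add contDiff_const)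
  have hsupp : ∀ p, p ∉ K ×ˢ Icc (-1) R → χ p * Φ p = 0 := by
    rintro ⟨x, t⟩ hp
    rw [mem_prod, not_and_or] at hp
    rcases hp with hp | hp
    · rw [hΦe, setIntegral_eq_zero_of_forall_eq_zero fun y _ => hφK x y hp, mul_zero]
    · rcases lt_or_ge t (-1) with h1 | h1
      · have : χ (x, t) = 0 := Real.smoothTransition.zero_of_nonpos (by
          simp only
          linarith)
        rw [this, zero_mul]
      · have h2 : R < t := by
          by_contra h2
          exact hp ⟨h1, not_lt.1 h2⟩
        rw [hΦe, setIntegral_eq_zero_of_forall_eq_zero, mul_zero]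
        intro y hy
        exact hφL x y fun h' => absurd (hR h') (not_le.2 (h2.trans_le hy))
  have hclosed : IsClosed (K ×ˢ Icc (-1 : ℝ) R) := hKc.isClosed.prod isClosed_Icc
  have hts : tsupport (fun p => χ p * Φ p) ⊆ K ×ˢ Icc (-1 : ℝ) R :=
    closure_minimal (fun p hp => by_contra fun h' => hp (hsupp p h')) hclosed
  have hψ : IsTest (I ×ˢ univ) (fun p => χ p * Φ p) := by
    refine ⟨hχs.mul hΦs, HasCompactSupport.intro (hKc.prod isCompact_Icc) hsupp, ?_⟩
    intro p hp
    obtain ⟨q, hq, hq'⟩ := (hts hp).1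
    exact ⟨hq' ▸ (hφ.3 hq).1, mem_univ _⟩
  refine ⟨_, hψ, ?_, fun x => ?_⟩
  · rintro ⟨x, t⟩ (ht : 0 < t)
    refine (hψ.hasDerivAt_slice_snd x t).unique ((hΦd x t).congr_of_eventuallyEq ?_)
    filter_upwards [lt_mem_nhds ht] with s hs
    have : χ (x, s) = 1 := Real.smoothTransition.one_of_one_le (by
      simp only
      linarith)
    rw [this, one_mul]
  · have : χ (x, 0) = 1 := Real.smoothTransition.one_of_one_le (by simp)
    rw [this, one_mul, hΦe]
    refine setIntegral_eq_integral_of_forall_compl_eq_zero fun y hy => ?_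
    exact hφ.eq_zero fun h' => hy (mem_Ici.2 (le_of_lt h'.2))

theorem IsTest.setIntegral_upperHalf_eq {I : Set ℝ} {ψ f : ℝ × ℝ → ℝ} (hψ : IsTest (I ×ˢ univ) ψ)
    (hf : ∀ p, p ∉ tsupport ψ → f p = 0) :
    ∫ p in {p : ℝ × ℝ | 0 < p.2}, f p = ∫ p in I ×ˢ Ioi 0, f p := by
  refine (setIntegral_eq_of_subset_of_forall_sdiff_eq_zero
    (measurableSet_lt measurable_const measurable_snd) (fun p hp => hp.2) fun p hp => ?_)
  exact hf p fun h' => hp.2 ⟨(hψ.3 h').1, hp.1⟩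

theorem dualValue_smul {D : Set (ℝ × ℝ)} {ψ : ℝ × ℝ → ℝ} (hψ : IsTest D ψ) (s : ℝ) :
    dualValue (s • ψ) = 2 * s * (∫ x, ψ (x, 0)) - s ^ 2 *
      ∫ p in {p : ℝ × ℝ | 0 < p.2}, (fderiv ℝ ψ p (1, 0) ^ 2 + fderiv ℝ ψ p (0, 1) ^ 2) := by
  have h1 : ∀ p v, fderiv ℝ (s • ψ) p v = s * fderiv ℝ ψ p v := fun p v => by
    rw [fderiv_const_smul (hψ.differentiable p)]
    rfl
  unfold dualValue
  simp_rw [h1]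
  rw [← integral_const_mul (s ^ 2)]
  simp only [Pi.smul_apply, smul_eq_mul]
  rw [integral_const_mul]
  congr 1
  · ring
  · exact integral_congr_ae (Eventually.of_forall fun p => by ring)

/-- The dual value of $s\psi$ is quadratic in $s$ and at most $A$ for all $s$; the claim is the sign
of the discriminant. -/
theorem IsTest.sq_integral_le_of_dualEnergy_le {D : Set (ℝ × ℝ)} {A : ℝ} (hA : 0 ≤ A)
    (hd : dualEnergy D ≤ ENNReal.ofReal A) {ψ : ℝ × ℝ → ℝ} (hψ : IsTest D ψ) :
    (∫ x, ψ (x, 0)) ^ 2 ≤ A * ∫ p in {p : ℝ × ℝ | 0 < p.2},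
      (fderiv ℝ ψ p (1, 0) ^ 2 + fderiv ℝ ψ p (0, 1) ^ 2) := by
  set N := ∫ p in {p : ℝ × ℝ | 0 < p.2},
    (fderiv ℝ ψ p (1, 0) ^ 2 + fderiv ℝ ψ p (0, 1) ^ 2) with hN
  have key : ∀ s : ℝ, 0 ≤ N * (s * s) + (-2 * ∫ x, ψ (x, 0)) * s + A := fun s => by
    have h1 := (hψ.smul s).le_dualEnergy.trans hd
    rw [ENNReal.ofReal_le_ofReal_iff hA, dualValue_smul hψ, ← hN] at h1
    linarith
  have := discrim_le_zero key
  rw [discrim] at this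
  nlinarith

/-- The rotated gradient `(-∂ψ/∂y, ∂ψ/∂x)` as a complex-valued function. -/
def rotGrad (ψ : ℝ × ℝ → ℝ) (p : ℝ × ℝ) : ℂ :=
  -(fderiv ℝ ψ p (0, 1) : ℂ) + (fderiv ℝ ψ p (1, 0) : ℂ) * Complex.I

theorem IsTest.memLp_rotGrad {D : Set (ℝ × ℝ)} {ψ : ℝ × ℝ → ℝ} (h : IsTest D ψ) (S : Set (ℝ × ℝ)) :
    MemLp (rotGrad ψ) 2 (volume.restrict S) := by
  have h1 := (((h.fderiv_apply (0, 1)).memLp 2 volume).restrict S).ofReal (K := ℂ)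
  have h2 := (((h.fderiv_apply (1, 0)).memLp 2 volume).restrict S).ofReal (K := ℂ)
  exact h1.neg.add (h2.mul_const Complex.I)

theorem inner_rotGrad (ψ : ℝ × ℝ → ℝ) (p : ℝ × ℝ) (z : ℂ) :
    inner ℝ z (rotGrad ψ p) = z.im * fderiv ℝ ψ p (1, 0) - z.re * fderiv ℝ ψ p (0, 1) := by
  rw [Complex.inner]
  simp [rotGrad]
  ring

/-- The extremal field of the dual problem on a strip. -/
theorem exists_field_of_dualEnergy_le {I : Set ℝ} (hI : IsOpen I) {A : ℝ} (hA : 0 ≤ A)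
    (hd : dualEnergy (I ×ˢ univ) ≤ ENNReal.ofReal A) :
    ∃ F₁ F₂ : ℝ × ℝ → ℝ, StronglyMeasurable F₁ ∧ StronglyMeasurable F₂ ∧ MemLp F₁ 2 volume ∧
      MemLp F₂ 2 volume ∧ (∀ p : ℝ × ℝ, p ∉ I ×ˢ Ioi 0 → F₁ p = 0) ∧
      (∀ p : ℝ × ℝ, p ∉ I ×ˢ Ioi 0 → F₂ p = 0) ∧
      (∫ p, (F₁ p ^ 2 + F₂ p ^ 2) ≤ A) ∧
      ∀ ψ : ℝ × ℝ → ℝ, IsTest (I ×ˢ univ) ψ →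
        ∫ p, (F₂ p * fderiv ℝ ψ p (1, 0) - F₁ p * fderiv ℝ ψ p (0, 1)) = ∫ x, ψ (x, 0) := by
  set S : Set (ℝ × ℝ) := I ×ˢ Ioi 0 with hS
  have hSm : MeasurableSet S := hI.measurableSet.prod measurableSet_Ioi
  -- Complex values serve as the Euclidean plane. The Riesz representative $F$ of
  -- $\psi\mapsto\int\psi(x,0)\,dx$ with respect to the rotated gradients is the gradient sought:
  -- real part $u_x$, imaginary part $u_y$.
  let B : testSpace (I ×ˢ (univ : Set ℝ)) →ₗ[ℝ] Lp ℂ 2 (volume.restrict S) :=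
    { toFun := fun ψ => (ψ.2.memLp_rotGrad S).toLp (rotGrad ψ.1)
      map_add' := fun ψ ψ' => by
        rw [← MemLp.toLp_add]
        refine MemLp.toLp_congr _ _ (Eventually.of_forall fun p => ?_)
        change rotGrad (ψ.1 + ψ'.1) p = rotGrad ψ.1 p + rotGrad ψ'.1 p
        unfold rotGrad
        rw [fderiv_add (ψ.2.differentiable p) (ψ'.2.differentiable p)]
        simp only [add_apply, Complex.ofReal_add]
        ring
      map_smul' := fun c ψ => by
        rw [RingHom.id_apply, ← MemLp.toLp_const_smul]
        refine MemLp.toLp_congr _ _ (Eventually.of_forall fun p => ?_)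
        change rotGrad (c • ψ.1) p = c • rotGrad ψ.1 p
        unfold rotGrad
        rw [fderiv_const_smul (ψ.2.differentiable p)]
        simp only [smul_apply, smul_eq_mul, Complex.ofReal_mul,
          Complex.real_smul]
        ring }
  let l : testSpace (I ×ˢ (univ : Set ℝ)) →ₗ[ℝ] ℝ :=
    { toFun := fun ψ => ∫ x, ψ.1 (x, 0)
      map_add' := fun ψ ψ' =>
        integral_add ((ψ.2.isTest_slice 0).integrable _) ((ψ'.2.isTest_slice 0).integrable _)
      map_smul' := fun c ψ => integral_const_mul c _ }
  have hB : ∀ ψ : testSpace (I ×ˢ (univ : Set ℝ)), ‖B ψ‖ ^ 2 = ∫ p in {p : ℝ × ℝ | 0 < p.2},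
      (fderiv ℝ ψ.1 p (1, 0) ^ 2 + fderiv ℝ ψ.1 p (0, 1) ^ 2) := fun ψ => by
    rw [IsTest.setIntegral_upperHalf_eq ψ.2, ← real_inner_self_eq_norm_sq, L2.inner_def]
    · refine integral_congr_ae ?_
      filter_upwards [(ψ.2.memLp_rotGrad S).coeFn_toLp] with p hp
      change inner ℝ ((ψ.2.memLp_rotGrad S).toLp _ p) ((ψ.2.memLp_rotGrad S).toLp _ p) = _
      rw [hp, inner_rotGrad]
      simp [rotGrad]
      ring
    · intro p hp
      have h1 : ∀ v, fderiv ℝ ψ.1 p v = 0 := fun v =>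
        image_eq_zero_of_notMem_tsupport (f := fun p => fderiv ℝ ψ.1 p v)
          fun h' => hp (tsupport_fderiv_apply_subset ℝ v h')
      rw [h1, h1]
      simp
  obtain ⟨F, hF, hFl⟩ := exists_inner_eq_of_sq_le B l hA (fun ψ => by
    rw [hB]
    exact ψ.2.sq_integral_le_of_dualEnergy_le hA hd)
  have hFm := Lp.memLp F
  have hFs := Lp.stronglyMeasurable F
  have hre : StronglyMeasurable fun p => (F p).re :=
    Complex.continuous_re.comp_stronglyMeasurable hFs
  have him : StronglyMeasurable fun p => (F p).im :=
    Complex.continuous_im.comp_stronglyMeasurable hFs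
  refine ⟨S.indicator fun p => (F p).re, S.indicator fun p => (F p).im, hre.indicator hSm,
    him.indicator hSm, (memLp_indicator_iff_restrict hSm).2 hFm.re,
    (memLp_indicator_iff_restrict hSm).2 hFm.im, fun p hp => indicator_of_notMem hp _,
    fun p hp => indicator_of_notMem hp _, ?_, fun ψ hψ => ?_⟩
  · refine le_trans (le_of_eq ?_) hF
    rw [← real_inner_self_eq_norm_sq, L2.inner_def, ← integral_indicator hSm]
    refine integral_congr_ae (Eventually.of_forall fun p => ?_)
    by_cases hp : p ∈ S
    · simp only [indicator_of_mem hp]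
      rw [Complex.inner]
      simp
      ring
    · simp [indicator_of_notMem hp]
  · have h1 := hFl ⟨ψ, hψ⟩
    rw [L2.inner_def] at h1
    refine Eq.trans ?_ h1
    rw [← integral_indicator hSm]
    have h2 := (ae_restrict_iff' hSm).1 (hψ.memLp_rotGrad S).coeFn_toLp
    refine integral_congr_ae ?_
    filter_upwards [h2] with p hp
    by_cases hpS : p ∈ S
    · simp only [indicator_of_mem hpS]
      change _ = inner ℝ (F p) ((hψ.memLp_rotGrad S).toLp _ p)
      rw [hp hpS, inner_rotGrad]
    · simp [indicator_of_notMem hpS]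

theorem IsTest.integral_fst_mul_fderiv_snd {D : Set (ℝ × ℝ)} {φ : ℝ × ℝ → ℝ} (hφ : IsTest D φ) :
    ∫ p in {p : ℝ × ℝ | 0 < p.2}, p.1 * fderiv ℝ φ p (0, 1) = - ∫ x, x * φ (x, 0) := by
  have hi := ((hφ.fderiv_apply (0, 1)).integrable_mul (u := fun p => p.1)
    (continuous_fst.locallyIntegrable.locallyIntegrableOn (μ := volume) _)).integrableOn
    (s := univ ×ˢ Ioi 0)
  have he : {p : ℝ × ℝ | 0 < p.2} = univ ×ˢ Ioi 0 := by
    ext p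
    simp
  rw [Measure.volume_eq_prod] at hi
  rw [he, Measure.volume_eq_prod, setIntegral_prod _ hi, Measure.restrict_univ, ← integral_neg]
  refine integral_congr_ae (Eventually.of_forall fun x => ?_)
  simp only
  rw [integral_const_mul, ← mul_neg]
  congr 1
  have hs := hφ.isTest_slice_snd x
  have h1 := integral_Ioi_of_hasDerivAt_of_tendsto' (a := 0) (m := 0)
    (fun y _ => hφ.hasDerivAt_slice_snd x y) (by
      have := ((hφ.fderiv_apply (0, 1)).isTest_slice_snd x).integrable volume
      exact this.integrableOn) (by
      have := hs.2.is_zero_at_infty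
      exact this.mono_left atTop_le_cocompact)
  rw [h1, zero_sub]

theorem IsTest.integral_fst_mul_fderiv_fst {D : Set (ℝ × ℝ)} {φ : ℝ × ℝ → ℝ} (hφ : IsTest D φ) :
    ∫ p, p.1 * fderiv ℝ φ p (1, 0) = - ∫ p, φ p := by
  have h0 : ∀ p, fderiv ℝ (fun p : ℝ × ℝ => p.1) p (1, 0) = 1 := fun p => by
    rw [show (fun p : ℝ × ℝ => p.1) = Prod.fst from rfl, fderiv_fst]
    rfl
  have h1 := integral_mul_fderiv_eq_neg_fderiv_mul_of_integrable (μ := volume)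
    (f := fun p : ℝ × ℝ => p.1) (g := φ) (v := (1, 0))
    (by simpa only [h0, one_mul] using hφ.integrable volume)
    ((hφ.fderiv_apply (1, 0)).integrable_mul
      (continuous_fst.locallyIntegrable.locallyIntegrableOn _))
    (hφ.integrable_mul (continuous_fst.locallyIntegrable.locallyIntegrableOn _))
    (fun p _ => differentiableAt_fst) (fun p _ => hφ.differentiable p)
  simpa only [h0, one_mul] using h1

theorem upperPart_prod_univ (I : Set ℝ) : upperPart (I ×ˢ univ) = I ×ˢ Ioi 0 := by
  ext p
  simp [upperPart]

/-- Strong duality on a strip, with the additional information that the extremal function differs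
from `x` by a square integrable function on bounded parts of the strip. -/
theorem exists_strip_extremal {I : Set ℝ} (hI : IsOpen I) {A : ℝ} (hA : 0 ≤ A)
    (hd : dualEnergy (I ×ˢ univ) ≤ ENNReal.ofReal A) :
    ∃ u F₁ F₂ : ℝ × ℝ → ℝ, HasBottomTrace (I ×ˢ univ) u (fun x => x) ∧
      HasWeakDeriv (I ×ˢ Ioi 0) (1, 0) u F₁ ∧ HasWeakDeriv (I ×ˢ Ioi 0) (0, 1) u F₂ ∧
      MemLp F₁ 2 volume ∧ MemLp F₂ 2 volume ∧ (∫ p, (F₁ p ^ 2 + F₂ p ^ 2) ≤ A) ∧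
      ∀ H : ℝ, MemLp (fun p => u p - p.1) 2 (volume.restrict (univ ×ˢ Iio H)) := by
  obtain ⟨F₁, F₂, hs1, hs2, hm1, hm2, hz1, hz2, hFA, hF⟩ := exists_field_of_dualEnergy_le hI hA hd
  have h0 : ∀ p : ℝ × ℝ, p.2 ≤ 0 → F₂ p = 0 := fun p hp =>
    hz2 p fun h' => absurd h'.2 (not_lt.2 hp)
  -- The extremal function is $u=x+w$. It has the trace $x$ and vertical derivative $F_2$ by
  -- construction; that $u_x=F_1$ is what the field equation has to supply.
  set w := verticalPrimitive F₂ with hw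
  have hwl : LocallyIntegrable w volume := locallyIntegrable_verticalPrimitive hs2 hm2 h0
  have hfl : LocallyIntegrable (fun p : ℝ × ℝ => p.1) volume := continuous_fst.locallyIntegrable
  have hul : LocallyIntegrable (fun p : ℝ × ℝ => p.1 + w p) volume := hfl.add hwl
  have hl1 : LocallyIntegrable F₁ volume := hm1.locallyIntegrable (by norm_num)
  have hl2 : LocallyIntegrable F₂ volume := hm2.locallyIntegrable (by norm_num)
  have hw0 : ∀ p : ℝ × ℝ, p.2 ≤ 0 → w p = 0 := fun p hp => verticalPrimitive_eq_zero h0 hp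
  have hSeq : ∀ φ f : ℝ × ℝ → ℝ, IsTest (I ×ˢ univ) φ → (∀ p, p ∉ tsupport φ → f p = 0) →
      (∀ p : ℝ × ℝ, p.2 ≤ 0 → f p = 0) → ∫ p in I ×ˢ Ioi 0, f p = ∫ p, f p := by
    intro φ f hφ h1 h2
    refine setIntegral_eq_integral_of_forall_compl_eq_zero fun p hp => ?_
    by_cases hpφ : p ∈ tsupport φ
    · refine h2 p ?_
      by_contra h3
      exact hp ⟨(hφ.3 hpφ).1, not_le.1 h3⟩
    · exact h1 p hpφ
  have hfd : ∀ (φ : ℝ × ℝ → ℝ) (v p : ℝ × ℝ), p ∉ tsupport φ → fderiv ℝ φ p v = 0 :=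
    fun φ v p hp => image_eq_zero_of_notMem_tsupport (f := fun p => fderiv ℝ φ p v)
      fun h' => hp (tsupport_fderiv_apply_subset ℝ v h')
  have htr : ∀ φ : ℝ × ℝ → ℝ, IsTest (I ×ˢ univ) φ →
      ∫ p in I ×ˢ Ioi 0, (p.1 + w p) * fderiv ℝ φ p (0, 1)
        = - (∫ p in I ×ˢ Ioi 0, F₂ p * φ p) - ∫ x, x * φ (x, 0) := by
    intro φ hφ
    have i1 := ((hφ.fderiv_apply (0, 1)).integrable_mul (hfl.locallyIntegrableOn _)).integrableOn
      (s := I ×ˢ Ioi 0)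
    have i2 := ((hφ.fderiv_apply (0, 1)).integrable_mul (hwl.locallyIntegrableOn _)).integrableOn
      (s := I ×ˢ Ioi 0)
    simp_rw [add_mul]
    rw [integral_add i1 i2, ← hφ.setIntegral_upperHalf_eq fun p hp => by
      rw [hfd φ _ p hp, mul_zero], hφ.integral_fst_mul_fderiv_snd,
      hSeq φ _ hφ (fun p hp => by rw [hfd φ _ p hp, mul_zero])
        (fun p hp => by rw [hw0 p hp, zero_mul]),
      hSeq φ _ hφ (fun p hp => by rw [image_eq_zero_of_notMem_tsupport hp, mul_zero])
        (fun p hp => by rw [h0 p hp, zero_mul]),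
      integral_verticalPrimitive_mul hs2 hm2 h0 (hφ.mono (subset_univ _))]
    ring
  have hsub : I ×ˢ Ioi (0 : ℝ) ⊆ I ×ˢ univ := prod_mono_right (subset_univ _)
  have hy : HasWeakDeriv (I ×ˢ Ioi 0) (0, 1) (fun p => p.1 + w p) F₂ := by
    refine ⟨hul.locallyIntegrableOn _, hl2.locallyIntegrableOn _, fun φ h1 h2 h3 => ?_⟩
    have hφ : IsTest (I ×ˢ Ioi 0) φ := ⟨h1, h2, h3⟩
    rw [htr φ (hφ.mono hsub)]
    have : ∀ x : ℝ, x * φ (x, 0) = 0 := fun x => by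
      rw [hφ.eq_zero (x := (x, 0)) (fun h' => lt_irrefl (0 : ℝ) h'.2), mul_zero]
    simp [this]
  have hx : HasWeakDeriv (I ×ˢ Ioi 0) (1, 0) (fun p => p.1 + w p) F₁ := by
    refine ⟨hul.locallyIntegrableOn _, hl1.locallyIntegrableOn _, fun φ h1 h2 h3 => ?_⟩
    have hφ : IsTest (I ×ˢ Ioi 0) φ := ⟨h1, h2, h3⟩
    -- The field equation is tested with $\psi$ such that $\psi_y=-\varphi$ for $y>0$. Then $\int
    -- w\varphi_x=\int F_2\psi_x=\int\varphi-\int F_1\varphi$, and $\int x\varphi_x=-\int\varphi$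
    -- cancels the first term.
    obtain ⟨ψ, hψ, hψy, hψ0⟩ := hφ.exists_vertical_antiderivative
    have hψx := hψ.fderiv_apply (1, 0)
    have i1 := (hφ.fderiv_apply (1, 0)).integrable_mul (hfl.locallyIntegrableOn _)
    have i2 := (hφ.fderiv_apply (1, 0)).integrable_mul (hwl.locallyIntegrableOn _)
    rw [setIntegral_eq_integral_of_forall_compl_eq_zero (fun p hp => by
      rw [(hφ.fderiv_apply (1, 0)).eq_zero hp, mul_zero]),
      setIntegral_eq_integral_of_forall_compl_eq_zero (fun p hp => by
      rw [hφ.eq_zero hp, mul_zero])]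
    simp_rw [add_mul]
    rw [integral_add i1 i2, hφ.integral_fst_mul_fderiv_fst]
    have e1 : ∫ p, w p * fderiv ℝ φ p (1, 0)
        = - ∫ p, w p * fderiv ℝ (fun q => fderiv ℝ ψ q (1, 0)) p (0, 1) := by
      rw [← integral_neg]
      refine integral_congr_ae (Eventually.of_forall fun p => ?_)
      simp only
      rcases le_or_gt p.2 0 with hp | hp
      · rw [hw0 p hp]
        simp
      · rw [hψ.fderiv_fderiv_comm p (1, 0) (0, 1), ← mul_neg]
        congr 1
        have h4 : (fun q => fderiv ℝ ψ q (0, 1)) =ᶠ[𝓝 p] fun q => - φ q := by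
          filter_upwards [(isOpen_lt continuous_const continuous_snd).mem_nhds hp] with q hq
          exact hψy q hq
        rw [h4.fderiv_eq, fderiv_fun_neg]
        simp
    have e2 := integral_verticalPrimitive_mul hs2 hm2 h0 (hψx.mono (subset_univ _))
    have j1 := hψx.integrable_mul (hl2.locallyIntegrableOn _)
    have j2 := (hψ.fderiv_apply (0, 1)).integrable_mul (hl1.locallyIntegrableOn _)
    have e3 := hF ψ hψ
    rw [integral_sub j1 j2] at e3
    have e4 : ∫ p, F₁ p * fderiv ℝ ψ p (0, 1) = - ∫ p, F₁ p * φ p := by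
      rw [← integral_neg]
      refine integral_congr_ae (Eventually.of_forall fun p => ?_)
      simp only
      rcases le_or_gt p.2 0 with hp | hp
      · rw [hz1 p fun h' => absurd h'.2 (not_lt.2 hp)]
        simp
      · rw [hψy p hp]
        ring
    have e5 : ∫ x, ψ (x, 0) = ∫ p, φ p := by
      have := hφ.integrable volume
      rw [Measure.volume_eq_prod] at this ⊢
      rw [integral_prod _ this]
      exact integral_congr_ae (Eventually.of_forall fun x => hψ0 x)
    rw [e1, e2, neg_neg]
    rw [e4, e5] at e3
    linarith
  refine ⟨fun p => p.1 + w p, F₁, F₂, ⟨F₂, ?_, hul.locallyIntegrableOn _,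
    hl2.locallyIntegrableOn _, fun φ h1 h2 h3 => ?_⟩, hx, hy, hm1, hm2, hFA, fun H => ?_⟩
  · rwa [upperPart_prod_univ]
  · have hφ : IsTest (I ×ˢ univ) φ := ⟨h1, h2, h3⟩
    rw [upperPart_prod_univ, htr φ hφ]
    congr 1
    refine (setIntegral_eq_integral_of_forall_compl_eq_zero fun x hx => ?_).symm
    rw [hφ.eq_zero (x := (x, 0)) hx, mul_zero]
  · simp only [add_sub_cancel_left]
    exact memLp_verticalPrimitive hs2 hm2 h0 H

theorem stripEnergy_eq_dualEnergy {I : Set ℝ} (hI : IsOpen I) :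
    stripEnergy I = dualEnergy (I ×ˢ univ) := by
  refine le_antisymm ?_ (le_iInf₂ fun u hu => ?_)
  · by_cases htop : dualEnergy (I ×ˢ univ) = ⊤
    · rw [htop]
      exact le_top
    obtain ⟨u, F₁, F₂, hu, h1, h2, hm1, hm2, hA, -⟩ := exists_strip_extremal hI
      ENNReal.toReal_nonneg (ENNReal.ofReal_toReal htop).ge
    refine (iInf₂_le u hu).trans ((iInf_le _ F₁).trans ((iInf_le _ F₂).trans
      ((iInf_le _ h1).trans ((iInf_le _ h2).trans ?_))))
    rw [← ENNReal.ofReal_toReal htop]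
    refine le_trans ?_ (ENNReal.ofReal_le_ofReal hA)
    have hi : Integrable (fun p => F₁ p ^ 2 + F₂ p ^ 2) volume :=
      hm1.integrable_sq.add hm2.integrable_sq
    rw [ofReal_integral_eq_lintegral_ofReal hi (Eventually.of_forall fun p => by positivity)]
    exact setLIntegral_le_lintegral _ _
  · rw [← upperPart_prod_univ]
    exact dualEnergy_le_dirichletEnergy (hI.prod isOpen_univ) hu

/-! ### From strips to films: the upper bound for the minimal energy -/

theorem HasWeakDeriv.mono {D D' : Set (ℝ × ℝ)} {v : ℝ × ℝ} {u g : ℝ × ℝ → ℝ}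
    (h : HasWeakDeriv D v u g) (hD : D' ⊆ D) : HasWeakDeriv D' v u g := by
  refine ⟨h.1.mono_set hD, h.2.1.mono_set hD, fun φ h1 h2 h3 => ?_⟩
  have hφ : IsTest D' φ := ⟨h1, h2, h3⟩
  have h4 := h.2.2 φ h1 h2 (h3.trans hD)
  rw [setIntegral_eq_integral_of_forall_compl_eq_zero (fun p hp => by
    rw [((hφ.mono hD).fderiv_apply v).eq_zero hp, mul_zero]),
    setIntegral_eq_integral_of_forall_compl_eq_zero (fun p hp => by
    rw [(hφ.mono hD).eq_zero hp, mul_zero])] at h4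
  rwa [setIntegral_eq_integral_of_forall_compl_eq_zero (fun p hp => by
    rw [(hφ.fderiv_apply v).eq_zero hp, mul_zero]),
    setIntegral_eq_integral_of_forall_compl_eq_zero (fun p hp => by
    rw [hφ.eq_zero hp, mul_zero])]

theorem HasBottomTrace.mono {D D' : Set (ℝ × ℝ)} {u : ℝ × ℝ → ℝ} {t : ℝ → ℝ} (hDo : IsOpen D)
    (h : HasBottomTrace D u t) (hD : D' ⊆ D) : HasBottomTrace D' u t := by
  obtain ⟨g, h1, h2, h3, h4⟩ := h
  refine ⟨g, h1.mono fun p hp => ⟨hD hp.1, hp.2⟩, h2.mono_set fun p hp => ⟨hD hp.1, hp.2⟩,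
    h3.mono_set fun p hp => ⟨hD hp.1, hp.2⟩, fun φ k1 k2 k3 => ?_⟩
  have hφ : IsTest D' φ := ⟨k1, k2, k3⟩
  have h5 := h4 φ k1 k2 (k3.trans hD)
  have e : ∀ f : ℝ × ℝ → ℝ, (∀ p, p ∉ D' → f p = 0) →
      ∫ p in upperPart D, f p = ∫ p in upperPart D', f p := fun f hf =>
    setIntegral_eq_of_subset_of_forall_sdiff_eq_zero (isOpen_upperPart hDo).measurableSet
      (fun p hp => ⟨hD hp.1, hp.2⟩) fun p hp => hf p fun h' => hp.2 ⟨h', hp.1.2⟩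
  rw [e _ fun p hp => by rw [(hφ.fderiv_apply (0, 1)).eq_zero hp, mul_zero],
    e _ fun p hp => by rw [hφ.eq_zero hp, mul_zero]] at h5
  rw [h5]
  congr 1
  rw [setIntegral_eq_integral_of_forall_compl_eq_zero fun x hx => by
    rw [(hφ.mono hD).eq_zero hx, mul_zero],
    setIntegral_eq_integral_of_forall_compl_eq_zero fun x hx => by
    rw [hφ.eq_zero hx, mul_zero]]

theorem isOpen_filmAndSubstrate {h : ℝ → ℝ} (hc : Continuous h) : IsOpen (filmAndSubstrate h) :=
  (isOpen_lt continuous_const (hc.comp continuous_fst)).inter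
    (isOpen_lt continuous_snd (hc.comp continuous_fst))

/-- For a compactly supported profile the restriction of the extremal function of the strip is
admissible. -/
theorem minEnergy_le_limitEnergy {V : ℝ} {h : ℝ → ℝ} (hh : IsProfile V h)
    (hs : HasCompactSupport h) : minEnergy V ≤ limitEnergy h := by
  have hc := hh.1.1
  have hI : IsOpen {x | 0 < h x} := isOpen_lt continuous_const hc
  unfold limitEnergy
  rw [stripEnergy_eq_dualEnergy hI]
  by_cases htop : dualEnergy ({x | 0 < h x} ×ˢ univ) = ⊤
  · rw [htop, top_add]
    exact le_top
  obtain ⟨u, F₁, F₂, hu, h1, h2, hm1, hm2, hA, hL⟩ := exists_strip_extremal hI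
    ENNReal.toReal_nonneg (ENNReal.ofReal_toReal htop).ge
  obtain ⟨H, hH⟩ := hc.bounded_above_of_compact_support hs
  have hfs : film h ⊆ {x | 0 < h x} ×ˢ Ioi 0 := fun p hp => ⟨hp.1.trans hp.2, hp.1⟩
  have hfH : film h ⊆ univ ×ˢ Iio (H + 1) := fun p hp => ⟨mem_univ _, by
    have := (le_abs_self _).trans (hH p.1)
    exact hp.2.trans_le (by linarith)⟩
  obtain ⟨R, hR, hRs⟩ := HasCompactSupport.exists_Ioo hs
  -- Compact support of $h$ bounds the film. This puts the summand $x$ of $u$ into $L^2$; the other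
  -- summand is square integrable below any finite height.
  have hfR : film h ⊆ Icc (-R) R ×ˢ Icc 0 (H + 1) := fun p hp => by
    have h3 : p.1 ∈ tsupport h := subset_tsupport _ (ne_of_gt (hp.1.trans hp.2))
    have h4 := hRs h3
    exact ⟨⟨h4.1.le, h4.2.le⟩, hp.1.le, (hfH hp).2.le⟩
  have hfst : MemLp (fun p : ℝ × ℝ => p.1) 2 (volume.restrict (film h)) := by
    have hK : IsCompact (Icc (-R) R ×ˢ Icc (0 : ℝ) (H + 1)) := isCompact_Icc.prod isCompact_Icc
    refine MemLp.mono_measure (Measure.restrict_mono hfR le_rfl) ?_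
    have : IsFiniteMeasure (volume.restrict (Icc (-R) R ×ˢ Icc (0 : ℝ) (H + 1))) :=
      isFiniteMeasure_restrict.2 hK.measure_lt_top.ne
    refine MemLp.of_bound continuous_fst.aestronglyMeasurable R ?_
    rw [ae_restrict_iff' hK.measurableSet]
    exact Eventually.of_forall fun p hp => abs_le.2 hp.1
  have hum : MemLp u 2 (volume.restrict (film h)) := by
    have h3 := ((hL (H + 1)).mono_measure (Measure.restrict_mono hfH le_rfl)).add hfst
    refine h3.ae_eq (Eventually.of_forall fun p => ?_)
    simp
  have hadm : IsAdmissible V u h := by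
    refine ⟨hh, ⟨hum, F₁, F₂, h1.mono hfs, h2.mono hfs, hm1.restrict _, hm2.restrict _⟩, ?_⟩
    exact hu.mono (hI.prod isOpen_univ) fun p hp => ⟨hp.1, mem_univ _⟩
  refine (iInf_le _ u).trans ((iInf_le _ h).trans ((iInf_le _ hadm).trans ?_))
  unfold energy
  gcongr
  refine (iInf_le _ F₁).trans ((iInf_le _ F₂).trans
    ((iInf_le _ (h1.mono hfs)).trans ((iInf_le _ (h2.mono hfs)).trans ?_)))
  rw [← ENNReal.ofReal_toReal htop]
  refine le_trans ?_ (ENNReal.ofReal_le_ofReal hA)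
  have hi : Integrable (fun p => F₁ p ^ 2 + F₂ p ^ 2) volume :=
    hm1.integrable_sq.add hm2.integrable_sq
  rw [ofReal_integral_eq_lintegral_ofReal hi (Eventually.of_forall fun p => by positivity)]
  exact setLIntegral_le_lintegral _ _

/-! ### Dual energy: scaling, superadditivity, cutoff in height -/

theorem IsTest.integrable_sq_grad {D : Set (ℝ × ℝ)} {ψ : ℝ × ℝ → ℝ} (hψ : IsTest D ψ) :
    Integrable (fun p => fderiv ℝ ψ p (1, 0) ^ 2 + fderiv ℝ ψ p (0, 1) ^ 2) volume :=
  ((hψ.fderiv_apply (1, 0)).memLp 2 volume).integrable_sq.add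
    ((hψ.fderiv_apply (0, 1)).memLp 2 volume).integrable_sq

theorem measurableSet_upperHalf : MeasurableSet {p : ℝ × ℝ | 0 < p.2} :=
  measurableSet_lt measurable_const measurable_snd

theorem upperHalf_eq : {p : ℝ × ℝ | 0 < p.2} = univ ×ˢ Ioi 0 := by
  ext p
  simp

/-- The test function $b\,\psi(b^{-1}(p-(c,0)))$ keeps the size of the gradient, so both terms of
the dual value are multiplied by $b^2$. -/
theorem dualEnergy_affine_le {I : Set ℝ} {b : ℝ} (hb : 0 < b) (c : ℝ) :
    dualEnergy ({x | b * x + c ∈ I} ×ˢ univ)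
      ≤ ENNReal.ofReal (b⁻¹ ^ 2) * dualEnergy (I ×ˢ univ) := by
  refine iSup₂_le fun ψ hψ => ?_
  let T : ℝ × ℝ → ℝ × ℝ := fun p => b⁻¹ • (p - (c, 0))
  let T' : ℝ × ℝ → ℝ × ℝ := fun p => b • p + (c, 0)
  have hTT' : ∀ p, T' (T p) = p := fun p => by simp [T, T', hb.ne']
  have hTc : Continuous T := by fun_prop
  have hT'c : Continuous T' := by fun_prop
  have hφ : IsTest (I ×ˢ univ) (fun p => b * ψ (T p)) := by
    have hs : ∀ p, p ∉ T' '' tsupport ψ → b * ψ (T p) = 0 := fun p hp => by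
      rw [image_eq_zero_of_notMem_tsupport fun h' => hp ⟨_, h', hTT' p⟩, mul_zero]
    have hK : IsCompact (T' '' tsupport ψ) := hψ.2.isCompact.image hT'c
    refine ⟨contDiff_const.mul (hψ.1.comp
      ((contDiff_id.sub contDiff_const).const_smul b⁻¹)), HasCompactSupport.intro hK hs, ?_⟩
    have hts : tsupport (fun p => b * ψ (T p)) ⊆ T' '' tsupport ψ :=
      closure_minimal (fun p hp => by_contra fun h' => hp (hs p h')) hK.isClosed
    refine hts.trans ?_
    rintro _ ⟨p, hp, rfl⟩
    refine ⟨?_, mem_univ _⟩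
    have h1 : b * p.1 + c ∈ I := (hψ.3 hp).1
    simpa [T'] using h1
  have hd : ∀ p v, fderiv ℝ (fun p => b * ψ (T p)) p v = fderiv ℝ ψ (T p) v := fun p v => by
    have h1 : HasFDerivAt T (b⁻¹ • ContinuousLinearMap.id ℝ (ℝ × ℝ)) p :=
      ((hasFDerivAt_id p).sub_const (c, (0 : ℝ))).const_smul b⁻¹
    have h2 := ((hψ.differentiable (T p)).hasFDerivAt.comp p h1).const_mul b
    have h3 : fderiv ℝ (fun p => b * ψ (T p)) p
        = b • (fderiv ℝ ψ (T p)).comp (b⁻¹ • ContinuousLinearMap.id ℝ (ℝ × ℝ)) := h2.fderiv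
    rw [h3]
    simp [hb.ne']
  have hv : dualValue (fun p => b * ψ (T p)) = b ^ 2 * dualValue ψ := by
    unfold dualValue
    simp_rw [hd]
    have e1 : ∫ x, b * ψ (T (x, 0)) = b ^ 2 * ∫ x, ψ (x, 0) := by
      rw [integral_const_mul, ← integral_add_right_eq_self _ c]
      have h1 := Measure.integral_comp_mul_left (fun x => ψ (x, 0)) b⁻¹
      rw [inv_inv, abs_of_pos hb, smul_eq_mul] at h1
      rw [pow_two, mul_assoc, ← h1]
      simp [T]
    have e2 : ∫ p in {p : ℝ × ℝ | 0 < p.2},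
          (fderiv ℝ ψ (T p) (1, 0) ^ 2 + fderiv ℝ ψ (T p) (0, 1) ^ 2)
        = b ^ 2 * ∫ p in {p : ℝ × ℝ | 0 < p.2},
          (fderiv ℝ ψ p (1, 0) ^ 2 + fderiv ℝ ψ p (0, 1) ^ 2) := by
      rw [← integral_indicator measurableSet_upperHalf,
        ← integral_indicator measurableSet_upperHalf]
      set f := {p : ℝ × ℝ | 0 < p.2}.indicator fun p =>
        fderiv ℝ ψ p (1, 0) ^ 2 + fderiv ℝ ψ p (0, 1) ^ 2 with hf
      have h1 := Measure.integral_comp_smul (volume : Measure (ℝ × ℝ)) f b⁻¹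
      have h2 := integral_sub_right_eq_self (μ := (volume : Measure (ℝ × ℝ)))
        (fun p => f (b⁻¹ • p)) (c, 0)
      rw [h1] at h2
      simp only [Module.finrank_prod, Module.finrank_self, smul_eq_mul] at h2
      rw [abs_of_pos (by positivity)] at h2
      have h3 : ((b⁻¹ ^ (1 + 1))⁻¹ : ℝ) = b ^ 2 := by
        rw [inv_pow, inv_inv]
      rw [h3] at h2
      rw [← h2]
      refine integral_congr_ae (Eventually.of_forall fun p => ?_)
      simp only [hf]
      by_cases hp : p ∈ {p : ℝ × ℝ | 0 < p.2}
      · have hp' : b⁻¹ • (p - (c, 0)) ∈ {p : ℝ × ℝ | 0 < p.2} := by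
          have : 0 < p.2 := hp
          simp only [mem_ofPred_eq, Prod.smul_snd, Prod.snd_sub, sub_zero, smul_eq_mul]
          positivity
        rw [indicator_of_mem hp, indicator_of_mem hp']
      · have hp' : b⁻¹ • (p - (c, 0)) ∉ {p : ℝ × ℝ | 0 < p.2} := by
          intro h'
          refine hp ?_
          simp only [mem_ofPred_eq, Prod.smul_snd, Prod.snd_sub, sub_zero, smul_eq_mul] at h' ⊢
          exact (mul_pos_iff_of_pos_left (inv_pos.2 hb)).1 h'
        rw [indicator_of_notMem hp, indicator_of_notMem hp']
    rw [e1, e2]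
    ring
  have h1 := hφ.le_dualEnergy
  rw [hv] at h1
  calc ENNReal.ofReal (dualValue ψ)
      = ENNReal.ofReal (b⁻¹ ^ 2) * ENNReal.ofReal (b ^ 2 * dualValue ψ) := by
        rw [← ENNReal.ofReal_mul (by positivity)]
        congr 1
        field_simp
    _ ≤ _ := by gcongr

/-- Test functions supported in disjoint sets add up without cross terms. -/
theorem dualEnergy_add_le {D₁ D₂ : Set (ℝ × ℝ)} (hD : Disjoint D₁ D₂) :
    dualEnergy D₁ + dualEnergy D₂ ≤ dualEnergy (D₁ ∪ D₂) := by
  refine ENNReal.biSup_add_biSup_le' ⟨0, IsTest.zero⟩ ⟨0, IsTest.zero⟩ fun ψ₁ h₁ ψ₂ h₂ => ?_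
  have h₁' := h₁.mono (D' := D₁ ∪ D₂) subset_union_left
  have h₂' := h₂.mono (D' := D₁ ∪ D₂) subset_union_right
  -- `ENNReal.ofReal` counts a negative value as $0$, so a test function with nonpositive value is
  -- dropped rather than added.
  rcases le_total (dualValue ψ₁) 0 with hn | hp₁
  · rw [ENNReal.ofReal_of_nonpos hn, zero_add]
    exact h₂'.le_dualEnergy
  rcases le_total (dualValue ψ₂) 0 with hn | hp₂
  · rw [ENNReal.ofReal_of_nonpos hn, add_zero]
    exact h₁'.le_dualEnergy
  rw [← ENNReal.ofReal_add hp₁ hp₂]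
  refine le_trans (le_of_eq ?_) (h₁'.add h₂').le_dualEnergy
  congr 1
  unfold dualValue
  have hz : ∀ p v, fderiv ℝ ψ₁ p v * fderiv ℝ ψ₂ p v = 0 := fun p v => by
    by_cases hp : p ∈ D₁
    · rw [(h₂.fderiv_apply v).eq_zero (disjoint_left.1 hD hp), mul_zero]
    · rw [(h₁.fderiv_apply v).eq_zero hp, zero_mul]
  have e1 : ∀ p v, fderiv ℝ (ψ₁ + ψ₂) p v ^ 2 = fderiv ℝ ψ₁ p v ^ 2 + fderiv ℝ ψ₂ p v ^ 2 :=
    fun p v => by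
      rw [fderiv_add (h₁.differentiable p) (h₂.differentiable p), add_apply]
      linear_combination 2 * hz p v
  simp_rw [e1, Pi.add_apply]
  rw [integral_add ((h₁.isTest_slice 0).integrable _) ((h₂.isTest_slice 0).integrable _)]
  have e2 : ∫ p in {p : ℝ × ℝ | 0 < p.2},
      (fderiv ℝ ψ₁ p (1, 0) ^ 2 + fderiv ℝ ψ₂ p (1, 0) ^ 2 +
        (fderiv ℝ ψ₁ p (0, 1) ^ 2 + fderiv ℝ ψ₂ p (0, 1) ^ 2))
      = (∫ p in {p : ℝ × ℝ | 0 < p.2}, (fderiv ℝ ψ₁ p (1, 0) ^ 2 + fderiv ℝ ψ₁ p (0, 1) ^ 2)) +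
        ∫ p in {p : ℝ × ℝ | 0 < p.2}, (fderiv ℝ ψ₂ p (1, 0) ^ 2 + fderiv ℝ ψ₂ p (0, 1) ^ 2) := by
    rw [← integral_add h₁.integrable_sq_grad.integrableOn h₂.integrable_sq_grad.integrableOn]
    exact integral_congr_ae (Eventually.of_forall fun p => by ring)
  rw [e2]
  ring

theorem exists_deriv_smoothTransition_le :
    ∃ K : ℝ, 0 < K ∧ ∀ x, |deriv Real.smoothTransition x| ≤ K := by
  have hc : Continuous (deriv Real.smoothTransition) :=
    (Real.smoothTransition.contDiff (n := 1)).continuous_deriv le_rfl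
  have hs : HasCompactSupport (deriv Real.smoothTransition) := by
    refine HasCompactSupport.intro (isCompact_Icc (a := 0) (b := 1)) fun x hx => ?_
    rcases lt_or_ge x 0 with h | h
    · have : Real.smoothTransition =ᶠ[𝓝 x] fun _ => 0 := by
        filter_upwards [gt_mem_nhds h] with y hy
        exact Real.smoothTransition.zero_of_nonpos hy.le
      rw [this.deriv_eq, deriv_const]
    · have h1 : 1 < x := by
        by_contra h2
        exact hx ⟨h, not_lt.1 h2⟩
      have : Real.smoothTransition =ᶠ[𝓝 x] fun _ => 1 := by
        filter_upwards [lt_mem_nhds h1] with y hy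
        exact Real.smoothTransition.one_of_one_le hy.le
      rw [this.deriv_eq, deriv_const]
  obtain ⟨C, hC⟩ := hc.bounded_above_of_compact_support hs
  exact ⟨max C 1, by positivity, fun x => (hC x).trans (le_max_left _ _)⟩

theorem IsTest.isTest_slice_of_strip {I : Set ℝ} {ψ : ℝ × ℝ → ℝ} (h : IsTest (I ×ˢ univ) ψ)
    (y : ℝ) : IsTest I (fun x => ψ (x, y)) := by
  refine ⟨(h.isTest_slice y).1, (h.isTest_slice y).2, ?_⟩
  have h1 : tsupport (fun x => ψ (x, y)) ⊆ (fun x : ℝ => (x, y)) ⁻¹' tsupport ψ :=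
    closure_minimal (fun x hx => subset_tsupport _ hx)
      ((isClosed_tsupport ψ).preimage (by fun_prop))
  exact fun x hx => (h.3 (h1 hx)).1

/-- Poincaré's inequality with the measure of $I$ in place of its diameter: $f(x)$ is the integral
of $f'$ over $I\cap(-\infty,x]$. This matters for superlevel sets, whose measure is controlled but
whose extent is not. -/
theorem IsTest.integral_sq_le {I : Set ℝ} {L : ℝ} (hL : 0 ≤ L)
    (hv : volume I ≤ ENNReal.ofReal L) {f : ℝ → ℝ} (hf : IsTest I f) :
    ∫ x, f x ^ 2 ≤ L ^ 2 * ∫ x, deriv f x ^ 2 := by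
  have hfin : volume I ≠ ⊤ := ne_top_of_le_ne_top ENNReal.ofReal_ne_top hv
  have hvr : volume.real I ≤ L := ENNReal.toReal_le_of_le_ofReal hL hv
  have : IsFiniteMeasure (volume.restrict I) := isFiniteMeasure_restrict.2 hfin
  have hm : MemLp (deriv f) 2 volume := hf.isTest_deriv.memLp 2 volume
  have h0 : 0 ≤ ∫ x, deriv f x ^ 2 := integral_nonneg fun _ => sq_nonneg _
  have key : ∀ x, f x ^ 2 ≤ L * ∫ x, deriv f x ^ 2 := by
    intro x
    have e1 : f x = ∫ t in I, (Iic x).indicator (fun _ => (1 : ℝ)) t * deriv f t := by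
      have h1 : ∫ t in Iic x, deriv f t = f x - 0 :=
        integral_Iic_of_hasDerivAt_of_tendsto'
          (fun t _ => (hf.differentiable t).hasDerivAt)
          (hf.isTest_deriv.integrable volume).integrableOn
          (hf.2.is_zero_at_infty.mono_left atBot_le_cocompact)
      rw [setIntegral_eq_integral_of_forall_compl_eq_zero fun t ht => by
        rw [hf.isTest_deriv.eq_zero ht, mul_zero], ← sub_zero (f x), ← h1,
        ← integral_indicator measurableSet_Iic]
      refine integral_congr_ae (Eventually.of_forall fun t => ?_)
      by_cases ht : t ∈ Iic x <;> simp [ht]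
    have h2 := sq_integral_mul_le (μ := volume.restrict I)
      (f := (Iic x).indicator fun _ => (1 : ℝ)) ((memLp_const 1).indicator measurableSet_Iic)
      (hm.restrict I)
    rw [← e1] at h2
    refine h2.trans (mul_le_mul ?_ ?_ (integral_nonneg fun _ => sq_nonneg _) hL)
    · calc ∫ t in I, (Iic x).indicator (fun _ => (1 : ℝ)) t ^ 2 ≤ ∫ t in I, (1 : ℝ) := by
            refine integral_mono_of_nonneg (Eventually.of_forall fun _ => sq_nonneg _)
              (integrable_const 1) (Eventually.of_forall fun t => ?_)
            by_cases ht : t ∈ Iic x <;> simp [ht]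
        _ ≤ L := by simpa using hvr
    · exact setIntegral_le_integral hm.integrable_sq (Eventually.of_forall fun _ => sq_nonneg _)
  rw [← setIntegral_eq_integral_of_forall_compl_eq_zero (s := I) fun t ht => by
    rw [hf.eq_zero ht, zero_pow two_ne_zero]]
  calc ∫ x in I, f x ^ 2 ≤ ∫ _ in I, L * ∫ x, deriv f x ^ 2 :=
        integral_mono ((hf.memLp 2 volume).restrict I).integrable_sq (integrable_const _) key
    _ ≤ L ^ 2 * ∫ x, deriv f x ^ 2 := by
        simp only [integral_const, smul_eq_mul, measureReal_restrict_apply_univ]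
        rw [pow_two, mul_assoc]
        gcongr

theorem IsTest.integral_upperHalf_sq_le {I : Set ℝ} {L : ℝ} (hL : 0 ≤ L)
    (hv : volume I ≤ ENNReal.ofReal L) {ψ : ℝ × ℝ → ℝ} (hψ : IsTest (I ×ˢ univ) ψ) :
    ∫ p in {p : ℝ × ℝ | 0 < p.2}, ψ p ^ 2
      ≤ L ^ 2 * ∫ p in {p : ℝ × ℝ | 0 < p.2}, fderiv ℝ ψ p (1, 0) ^ 2 := by
  have i1 : Integrable (fun p => ψ p ^ 2) ((volume.restrict univ).prod (volume.restrict (Ioi 0))) := by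
    rw [Measure.prod_restrict, ← Measure.volume_eq_prod]
    exact (hψ.memLp 2 volume).integrable_sq.restrict
  have i2 : Integrable (fun p => fderiv ℝ ψ p (1, 0) ^ 2)
      ((volume.restrict univ).prod (volume.restrict (Ioi 0))) := by
    rw [Measure.prod_restrict, ← Measure.volume_eq_prod]
    exact ((hψ.fderiv_apply (1, 0)).memLp 2 volume).integrable_sq.restrict
  rw [upperHalf_eq, Measure.volume_eq_prod, ← Measure.prod_restrict, integral_prod_symm _ i1,
    integral_prod_symm _ i2, ← integral_const_mul]
  refine integral_mono i1.integral_prod_right (i2.integral_prod_right.const_mul _) fun y => ?_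
  simp only [Measure.restrict_univ]
  have h1 := (hψ.isTest_slice_of_strip y).integral_sq_le hL hv
  have h2 : deriv (fun x => ψ (x, y)) = fun x => fderiv ℝ ψ (x, y) (1, 0) :=
    funext fun x => (hψ.hasDerivAt_slice x y).deriv
  rwa [h2] at h1

/-- A bound for the derivative of the smooth transition function. -/
def transitionBound : ℝ := exists_deriv_smoothTransition_le.choose

theorem transitionBound_pos : 0 < transitionBound := exists_deriv_smoothTransition_le.choose_spec.1

theorem abs_deriv_smoothTransition_le (x : ℝ) : |deriv Real.smoothTransition x| ≤ transitionBound :=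
  exists_deriv_smoothTransition_le.choose_spec.2 x

theorem hasDerivAt_smoothTransition (x : ℝ) :
    HasDerivAt Real.smoothTransition (deriv Real.smoothTransition x) x :=
  ((Real.smoothTransition.contDiff (n := 1)).differentiable (by simp) x).hasDerivAt

/-- Cutting off a test function at height `M`. -/
theorem IsTest.exists_cutoff {I : Set ℝ} {L : ℝ} (hL : 0 < L)
    (hv : volume I ≤ ENNReal.ofReal L) {M : ℝ} (hM : 0 < M) {ψ : ℝ × ℝ → ℝ}
    (hψ : IsTest (I ×ˢ univ) ψ) :
    ∃ Ψ : ℝ × ℝ → ℝ, IsTest (I ×ˢ univ) Ψ ∧ (tsupport Ψ ⊆ tsupport ψ ∩ {p | p.2 ≤ M}) ∧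
      (∀ x, Ψ (x, 0) = ψ (x, 0)) ∧
      ∫ p in {p : ℝ × ℝ | 0 < p.2}, (fderiv ℝ Ψ p (1, 0) ^ 2 + fderiv ℝ Ψ p (0, 1) ^ 2)
        ≤ (1 + transitionBound * L / M) ^ 2 *
          ∫ p in {p : ℝ × ℝ | 0 < p.2}, (fderiv ℝ ψ p (1, 0) ^ 2 + fderiv ℝ ψ p (0, 1) ^ 2) := by
  set K := transitionBound with hK
  have hK0 : 0 < K := transitionBound_pos
  let χ : ℝ × ℝ → ℝ := fun p => Real.smoothTransition (1 - M⁻¹ * p.2)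
  have hχs : ContDiff ℝ ∞ χ := Real.smoothTransition.contDiff.comp
    (contDiff_const.sub (contDiff_const.mul contDiff_snd))
  have hχx : ∀ p, HasFDerivAt χ (fderiv ℝ χ p) p := fun p =>
    (hχs.differentiable (by simp) p).hasFDerivAt
  have hχ1 : ∀ p : ℝ × ℝ, fderiv ℝ χ p (1, 0) = 0 := fun p => by
    have h1 : HasDerivAt (fun x : ℝ => χ (x, p.2)) (fderiv ℝ χ p (1, 0)) p.1 :=
      HasFDerivAt.comp_hasDerivAt (f := fun x : ℝ => (x, p.2)) p.1 (hχx p)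
        ((hasDerivAt_id p.1).prodMk (hasDerivAt_const p.1 p.2))
    exact h1.unique (hasDerivAt_const p.1 (Real.smoothTransition (1 - M⁻¹ * p.2)))
  have hχ2 : ∀ p : ℝ × ℝ, |fderiv ℝ χ p (0, 1)| ≤ K / M := fun p => by
    have h1 : HasDerivAt (fun y : ℝ => χ (p.1, y)) (fderiv ℝ χ p (0, 1)) p.2 :=
      HasFDerivAt.comp_hasDerivAt (f := fun y : ℝ => (p.1, y)) p.2 (hχx p)
        ((hasDerivAt_const p.2 p.1).prodMk (hasDerivAt_id p.2))
    have h2 : HasDerivAt (fun y : ℝ => 1 - M⁻¹ * y) (-(M⁻¹ * 1)) p.2 :=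
      ((hasDerivAt_id p.2).const_mul M⁻¹).const_sub 1
    have h3 := (hasDerivAt_smoothTransition (1 - M⁻¹ * p.2)).comp p.2 h2
    rw [h1.unique h3, abs_mul, abs_neg, mul_one, abs_of_pos (inv_pos.2 hM), div_eq_mul_inv]
    gcongr
    exact abs_deriv_smoothTransition_le _
  have hχle : ∀ p, χ p ^ 2 ≤ 1 := fun p =>
    pow_le_one₀ (Real.smoothTransition.nonneg _) (Real.smoothTransition.le_one _)
  have hΨ : IsTest (I ×ˢ univ) (fun p => χ p * ψ p) := hψ.mul_left hχs
  have hd : ∀ p v, fderiv ℝ (fun p => χ p * ψ p) p v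
      = χ p * fderiv ℝ ψ p v + fderiv ℝ χ p v * ψ p := fun p v => by
    rw [fderiv_fun_mul (hχx p).differentiableAt (hψ.differentiable p)]
    simp only [add_apply, smul_apply, smul_eq_mul]
    ring
  refine ⟨fun p => χ p * ψ p, hΨ, ?_, fun x => ?_, ?_⟩
  · refine subset_inter tsupport_mul_subset_right (closure_minimal (fun p hp => ?_)
      (isClosed_le continuous_snd continuous_const))
    by_contra hlt
    have h1 : M < p.2 := not_le.1 hlt
    refine left_ne_zero_of_mul hp (Real.smoothTransition.zero_of_nonpos ?_)
    have h2 : 1 ≤ M⁻¹ * p.2 := by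
      rw [inv_mul_eq_div, one_le_div hM]
      exact h1.le
    linarith
  · have : χ (x, 0) = 1 := Real.smoothTransition.one_of_one_le (by simp)
    simp only [this, one_mul]
  · set η := K * L / M with hη
    have hη0 : 0 < η := by positivity
    have hpt : ∀ p, fderiv ℝ (fun p => χ p * ψ p) p (1, 0) ^ 2 +
        fderiv ℝ (fun p => χ p * ψ p) p (0, 1) ^ 2
        ≤ (1 + η) * (fderiv ℝ ψ p (1, 0) ^ 2 + fderiv ℝ ψ p (0, 1) ^ 2) +
          (1 + η⁻¹) * ((K / M) ^ 2 * ψ p ^ 2) := fun p => by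
      rw [hd, hd, hχ1]
      set a := fderiv ℝ ψ p (1, 0)
      set b := fderiv ℝ ψ p (0, 1)
      have h1 : (χ p * a + 0 * ψ p) ^ 2 ≤ (1 + η) * a ^ 2 := by
        have : χ p ^ 2 * a ^ 2 ≤ 1 * a ^ 2 := mul_le_mul_of_nonneg_right (hχle p) (sq_nonneg a)
        nlinarith [mul_nonneg hη0.le (sq_nonneg a)]
      have h2 : ∀ s t : ℝ, (s + t) ^ 2 ≤ (1 + η) * s ^ 2 + (1 + η⁻¹) * t ^ 2 := fun s t => by
        have : (1 + η) * s ^ 2 + (1 + η⁻¹) * t ^ 2 - (s + t) ^ 2 = η⁻¹ * (η * s - t) ^ 2 := by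
          field_simp
          ring
        have h3 : 0 ≤ η⁻¹ * (η * s - t) ^ 2 := by positivity
        linarith
      have h3 := h2 (χ p * b) (fderiv ℝ χ p (0, 1) * ψ p)
      have h4 : (χ p * b) ^ 2 ≤ b ^ 2 := by
        rw [mul_pow]
        exact mul_le_of_le_one_left (sq_nonneg b) (hχle p)
      have h5 : (fderiv ℝ χ p (0, 1) * ψ p) ^ 2 ≤ (K / M) ^ 2 * ψ p ^ 2 := by
        rw [mul_pow]
        refine mul_le_mul_of_nonneg_right ?_ (sq_nonneg _)
        rw [← sq_abs]
        exact pow_le_pow_left₀ (abs_nonneg _) (hχ2 p) 2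
      have h6 : (1 + η) * (χ p * b) ^ 2 ≤ (1 + η) * b ^ 2 := by gcongr
      have h7 : (1 + η⁻¹) * (fderiv ℝ χ p (0, 1) * ψ p) ^ 2
          ≤ (1 + η⁻¹) * ((K / M) ^ 2 * ψ p ^ 2) := by gcongr
      linarith
    have i0 := hψ.integrable_sq_grad.integrableOn (s := {p : ℝ × ℝ | 0 < p.2})
    have i1 := (hψ.memLp 2 volume).integrable_sq.integrableOn (s := {p : ℝ × ℝ | 0 < p.2})
    set B := ∫ p in {p : ℝ × ℝ | 0 < p.2}, (fderiv ℝ ψ p (1, 0) ^ 2 + fderiv ℝ ψ p (0, 1) ^ 2)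
      with hB
    have hP : ∫ p in {p : ℝ × ℝ | 0 < p.2}, ψ p ^ 2 ≤ L ^ 2 * B := by
      refine (hψ.integral_upperHalf_sq_le hL.le hv).trans ?_
      gcongr
      refine setIntegral_mono_on
        ((hψ.fderiv_apply (1, 0)).memLp 2 volume).integrable_sq.integrableOn i0
        measurableSet_upperHalf fun p _ => ?_
      nlinarith [sq_nonneg (fderiv ℝ ψ p (0, 1))]
    calc _ ≤ ∫ p in {p : ℝ × ℝ | 0 < p.2},
          ((1 + η) * (fderiv ℝ ψ p (1, 0) ^ 2 + fderiv ℝ ψ p (0, 1) ^ 2) +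
          (1 + η⁻¹) * ((K / M) ^ 2 * ψ p ^ 2)) :=
          integral_mono hΨ.integrable_sq_grad.integrableOn
            ((i0.const_mul _).add ((i1.const_mul _).const_mul _)) hpt
      _ = (1 + η) * B + (1 + η⁻¹) * ((K / M) ^ 2 * ∫ p in {p : ℝ × ℝ | 0 < p.2}, ψ p ^ 2) := by
          rw [integral_add (i0.const_mul _) ((i1.const_mul _).const_mul _), integral_const_mul,
            integral_const_mul, integral_const_mul]
      _ ≤ (1 + η) * B + (1 + η⁻¹) * ((K / M) ^ 2 * (L ^ 2 * B)) := by gcongr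
      _ = (1 + η) * B + (1 + η⁻¹) * (η ^ 2 * B) := by
          rw [hη]
          ring
      _ = (1 + η) ^ 2 * B := by
          field_simp
          ring

/-- Over $\{h>M\}$ a test function cut off at height $M$ stays inside the film. Cutting multiplies
the gradient energy by at most $c$, so the multiple $c^{-1}\Psi$ keeps a share $c^{-1}$ of the dual
value. -/
theorem dualEnergy_superlevel_le {h : ℝ → ℝ} {L M : ℝ} (hL : 0 < L) (hM : 0 < M)
    (hv : volume {x | M < h x} ≤ ENNReal.ofReal L) :
    dualEnergy ({x | M < h x} ×ˢ univ)
      ≤ ENNReal.ofReal ((1 + transitionBound * L / M) ^ 2) * dualEnergy (filmAndSubstrate h) := by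
  refine iSup₂_le fun ψ hψ => ?_
  obtain ⟨Ψ, hΨ, hsupp, h0, hB⟩ := hψ.exists_cutoff hL hv hM
  set c := (1 + transitionBound * L / M) ^ 2 with hc
  have hc0 : 0 < c := by
    have := transitionBound_pos
    positivity
  have hΨf : IsTest (filmAndSubstrate h) Ψ := ⟨hΨ.1, hΨ.2, fun p hp => by
    have h1 : M < h p.1 := (hΨ.3 hp).1
    exact ⟨hM.trans h1, lt_of_le_of_lt (hsupp hp).2 h1⟩⟩
  have h1 := (hΨf.smul c⁻¹).le_dualEnergy
  rw [dualValue_smul hΨf] at h1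
  simp_rw [h0] at h1
  calc ENNReal.ofReal (dualValue ψ)
      ≤ ENNReal.ofReal (c * (2 * c⁻¹ * (∫ x, ψ (x, 0)) - c⁻¹ ^ 2 *
        ∫ p in {p : ℝ × ℝ | 0 < p.2}, (fderiv ℝ Ψ p (1, 0) ^ 2 + fderiv ℝ Ψ p (0, 1) ^ 2))) := by
        refine ENNReal.ofReal_le_ofReal ?_
        unfold dualValue
        have h2 : c⁻¹ * ∫ p in {p : ℝ × ℝ | 0 < p.2},
            (fderiv ℝ Ψ p (1, 0) ^ 2 + fderiv ℝ Ψ p (0, 1) ^ 2)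
            ≤ ∫ p in {p : ℝ × ℝ | 0 < p.2},
            (fderiv ℝ ψ p (1, 0) ^ 2 + fderiv ℝ ψ p (0, 1) ^ 2) := by
          rw [inv_mul_le_iff₀ hc0]
          exact hB
        have h3 : ∀ a b : ℝ, c * (2 * c⁻¹ * a - c⁻¹ ^ 2 * b) = 2 * a - c⁻¹ * b := fun a b => by
          field_simp
        rw [h3]
        linarith
    _ ≤ _ := by
        rw [ENNReal.ofReal_mul hc0.le]
        gcongr

/-- After a cutoff at height $L$, $\int\psi(x,0)\,dx$ is minus the integral of the vertical
derivative over $I\times(0,L]$, a set of area at most $L^2$, and Cauchy–Schwarz applies. -/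
theorem dualEnergy_strip_le {I : Set ℝ} (hI : MeasurableSet I) {L : ℝ} (hL : 0 < L)
    (hv : volume I ≤ ENNReal.ofReal L) :
    dualEnergy (I ×ˢ univ) ≤ ENNReal.ofReal ((L * (1 + transitionBound)) ^ 2) := by
  refine iSup₂_le fun ψ hψ => ENNReal.ofReal_le_ofReal ?_
  obtain ⟨Ψ, hΨ, hsupp, h0, hB⟩ := hψ.exists_cutoff hL hv hL
  rw [mul_div_assoc, div_self hL.ne', mul_one] at hB
  set S : Set (ℝ × ℝ) := I ×ˢ Ioc 0 L with hS
  have hSm : MeasurableSet S := hI.prod measurableSet_Ioc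
  have hSv : volume S ≤ ENNReal.ofReal (L ^ 2) := by
    rw [hS, Measure.volume_eq_prod, Measure.prod_prod, Real.volume_Ioc, sub_zero, pow_two,
      ENNReal.ofReal_mul hL.le]
    gcongr
  have hSfin : volume S ≠ ⊤ := ne_top_of_le_ne_top ENNReal.ofReal_ne_top hSv
  have : IsFiniteMeasure (volume.restrict S) := isFiniteMeasure_restrict.2 hSfin
  have hΨy := hΨ.fderiv_apply (0, 1)
  have e1 : ∫ x, ψ (x, 0) = - ∫ p in S, 1 * fderiv ℝ Ψ p (0, 1) := by
    have i1 : IntegrableOn (fun p => fderiv ℝ Ψ p (0, 1)) (univ ×ˢ Ioi 0)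
      ((volume : Measure ℝ).prod (volume : Measure ℝ)) := by
      rw [← Measure.volume_eq_prod]
      exact (hΨy.integrable volume).integrableOn
    have h1 : ∫ p in S, 1 * fderiv ℝ Ψ p (0, 1) = ∫ p in univ ×ˢ Ioi 0, fderiv ℝ Ψ p (0, 1) := by
      simp_rw [one_mul]
      refine (setIntegral_eq_of_subset_of_forall_sdiff_eq_zero
        (MeasurableSet.univ.prod measurableSet_Ioi) (fun p hp => ⟨mem_univ _, hp.2.1⟩)
        fun p hp => ?_).symm
      refine image_eq_zero_of_notMem_tsupport (f := fun p => fderiv ℝ Ψ p (0, 1)) fun h' => ?_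
      have h2 := tsupport_fderiv_apply_subset ℝ (0, 1) h'
      exact hp.2 ⟨(hΨ.3 h2).1, hp.1.2, (hsupp h2).2⟩
    rw [h1, Measure.volume_eq_prod, setIntegral_prod _ i1, Measure.restrict_univ, ← integral_neg]
    refine integral_congr_ae (Eventually.of_forall fun x => ?_)
    have h1 := integral_Ioi_of_hasDerivAt_of_tendsto' (a := 0) (m := 0)
      (fun y _ => hΨ.hasDerivAt_slice_snd x y)
      ((hΨy.isTest_slice_snd x).integrable volume).integrableOn
      ((hΨ.isTest_slice_snd x).2.is_zero_at_infty.mono_left atTop_le_cocompact)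
    simp only
    rw [h1, h0, zero_sub, neg_neg]
  have e2 : (∫ x, ψ (x, 0)) ^ 2 ≤ L ^ 2 * ∫ p in {p : ℝ × ℝ | 0 < p.2},
      (fderiv ℝ Ψ p (1, 0) ^ 2 + fderiv ℝ Ψ p (0, 1) ^ 2) := by
    rw [e1, neg_sq]
    refine (sq_integral_mul_le (μ := volume.restrict S) (memLp_const 1)
      ((hΨy.memLp 2 volume).restrict S)).trans ?_
    refine mul_le_mul ?_ ?_ (integral_nonneg fun _ => sq_nonneg _) (sq_nonneg L)
    · have h1 : volume.real S ≤ L ^ 2 := ENNReal.toReal_le_of_le_ofReal (sq_nonneg L) hSv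
      simpa using h1
    · refine (setIntegral_mono_set (hΨy.memLp 2 volume).integrable_sq.integrableOn
        (Eventually.of_forall fun _ => sq_nonneg _)
        (Eventually.of_forall fun p (hp : p ∈ S) => (hp.2.1 : p ∈ {p : ℝ × ℝ | 0 < p.2}))).trans ?_
      refine setIntegral_mono_on (hΨy.memLp 2 volume).integrable_sq.integrableOn
        hΨ.integrable_sq_grad.integrableOn measurableSet_upperHalf fun p _ => ?_
      nlinarith [sq_nonneg (fderiv ℝ Ψ p (1, 0))]
  unfold dualValue
  set B := ∫ p in {p : ℝ × ℝ | 0 < p.2}, (fderiv ℝ ψ p (1, 0) ^ 2 + fderiv ℝ ψ p (0, 1) ^ 2)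
  have hB0 : 0 ≤ B := integral_nonneg fun p => by positivity
  set c := (L * (1 + transitionBound)) ^ 2 with hc
  have hc0 : 0 ≤ c := sq_nonneg _
  have e3 : (∫ x, ψ (x, 0)) ^ 2 ≤ c * B := by
    refine e2.trans ?_
    rw [hc, mul_pow, mul_assoc]
    gcongr
  have e4 : ∫ x, ψ (x, 0) ≤ (c + B) / 2 := by
    refine le_of_abs_le (abs_le_of_sq_le_sq ?_ (by positivity))
    nlinarith [sq_nonneg (c - B)]
  linarith

/-- For a small multiple of a bump the linear term of the dual value beats the quadratic one. -/
theorem dualEnergy_unit_pos : 0 < dualEnergy (Ioo 0 1 ×ˢ univ) := by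
  let f : ContDiffBump ((1 / 2, 0) : ℝ × ℝ) := ⟨1 / 8, 1 / 4, by norm_num, by norm_num⟩
  have hf : IsTest (Ioo (0 : ℝ) 1 ×ˢ univ) f := by
    refine ⟨f.contDiff, f.hasCompactSupport, fun p hp => ⟨?_, mem_univ _⟩⟩
    rw [f.tsupport_eq, Metric.mem_closedBall, Prod.dist_eq, max_le_iff, Real.dist_eq, abs_le] at hp
    have h1 := hp.1
    have h2 : f.rOut = 1 / 4 := rfl
    rw [h2] at h1
    constructor <;> linarith [h1.1, h1.2]
  set A := ∫ x, f (x, 0) with hA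
  have hA0 : 0 < A := by
    refine (hf.isTest_slice 0).continuous.integral_pos_of_hasCompactSupport_nonneg_nonzero
      (hf.isTest_slice 0).2 (fun x => f.nonneg) (x := 1 / 2) ?_
    exact (f.pos_of_mem_ball (Metric.mem_ball_self f.rOut_pos)).ne'
  set N := ∫ p in {p : ℝ × ℝ | 0 < p.2}, (fderiv ℝ f p (1, 0) ^ 2 + fderiv ℝ f p (0, 1) ^ 2)
    with hN
  have hN0 : 0 ≤ N := integral_nonneg fun p => by positivity
  refine lt_of_lt_of_le ?_ (hf.smul (A / (N + 1))).le_dualEnergy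
  rw [dualValue_smul hf, ENNReal.ofReal_pos, ← hA, ← hN]
  have : 2 * (A / (N + 1)) * A - (A / (N + 1)) ^ 2 * N = A ^ 2 * (N + 2) / (N + 1) ^ 2 := by
    field_simp
    ring
  rw [this]
  positivity

theorem ofReal_mul_dualEnergy_unit_le {I : Set ℝ} {a l : ℝ} (hl : 0 < l)
    (hI : Ioo a (a + l) ⊆ I) :
    ENNReal.ofReal (l ^ 2) * dualEnergy (Ioo 0 1 ×ˢ univ) ≤ dualEnergy (I ×ˢ univ) := by
  have h1 := dualEnergy_affine_le (I := Ioo a (a + l)) hl a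
  have h2 : {x | l * x + a ∈ Ioo a (a + l)} = Ioo 0 1 := by
    ext x
    constructor
    · rintro ⟨h3, h4⟩
      have h5 : 0 < l * x := by linarith
      have h6 : l * x < l * 1 := by linarith
      exact ⟨(mul_pos_iff_of_pos_left hl).1 h5, lt_of_mul_lt_mul_left h6 hl.le⟩
    · rintro ⟨h3, h4⟩
      have h5 : 0 < l * x := mul_pos hl h3
      have h6 : l * x < l * 1 := mul_lt_mul_of_pos_left h4 hl
      exact ⟨by linarith, by linarith⟩
  rw [h2] at h1
  calc ENNReal.ofReal (l ^ 2) * dualEnergy (Ioo 0 1 ×ˢ univ)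
      ≤ ENNReal.ofReal (l ^ 2) * (ENNReal.ofReal (l⁻¹ ^ 2) *
        dualEnergy (Ioo a (a + l) ×ˢ univ)) := by gcongr
    _ = dualEnergy (Ioo a (a + l) ×ˢ univ) := by
        rw [← mul_assoc, ← ENNReal.ofReal_mul (by positivity), ← mul_pow, mul_inv_cancel₀ hl.ne',
          one_pow, ENNReal.ofReal_one, one_mul]
    _ ≤ dualEnergy (I ×ˢ univ) := dualEnergy_mono (prod_mono_left hI)

/-! ### The volume of the thin part of a film -/

/-- A smooth approximation of the positive part `t ↦ max t 0`. -/
def smoothPosPart (ε t : ℝ) : ℝ := t * Real.smoothTransition (ε⁻¹ * t - 1)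

theorem contDiff_smoothPosPart (ε : ℝ) : ContDiff ℝ ∞ (smoothPosPart ε) :=
  contDiff_id.mul (Real.smoothTransition.contDiff.comp
    ((contDiff_const.mul contDiff_id).sub contDiff_const))

theorem smoothPosPart_eq_zero {ε t : ℝ} (hε : 0 < ε) (ht : t ≤ ε) : smoothPosPart ε t = 0 := by
  have h1 : ε⁻¹ * t ≤ 1 := by
    rw [inv_mul_le_iff₀ hε]
    linarith
  rw [smoothPosPart, Real.smoothTransition.zero_of_nonpos (by linarith), mul_zero]

theorem smoothPosPart_of_two_mul_le {ε t : ℝ} (hε : 0 < ε) (ht : 2 * ε ≤ t) :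
    smoothPosPart ε t = t := by
  have h1 : 2 ≤ ε⁻¹ * t := by
    rw [le_inv_mul_iff₀ hε]
    linarith
  rw [smoothPosPart, Real.smoothTransition.one_of_one_le (by linarith), mul_one]

theorem smoothPosPart_nonneg {ε t : ℝ} (hε : 0 < ε) : 0 ≤ smoothPosPart ε t := by
  rcases le_total t ε with ht | ht
  · rw [smoothPosPart_eq_zero hε ht]
  · exact mul_nonneg (hε.le.trans ht) (Real.smoothTransition.nonneg _)

theorem sub_le_smoothPosPart {ε t : ℝ} (hε : 0 < ε) : t - 2 * ε ≤ smoothPosPart ε t := by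
  rcases le_total (2 * ε) t with ht | ht
  · rw [smoothPosPart_of_two_mul_le hε ht]
    linarith
  · have := smoothPosPart_nonneg (t := t) hε
    linarith

/-- The bound is uniform in $\varepsilon$: the transition has slope of order $\varepsilon^{-1}$, but
only where $0\le t\le2\varepsilon$. -/
theorem abs_deriv_smoothPosPart_le {ε : ℝ} (hε : 0 < ε) (t : ℝ) :
    |deriv (smoothPosPart ε) t| ≤ 1 + 2 * transitionBound := by
  have hK := transitionBound_pos
  rcases lt_or_ge t 0 with ht | ht
  · have : smoothPosPart ε =ᶠ[𝓝 t] fun _ => 0 := by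
      filter_upwards [gt_mem_nhds (ht.trans hε)] with s hs
      exact smoothPosPart_eq_zero hε hs.le
    rw [this.deriv_eq, deriv_const, abs_zero]
    positivity
  rcases lt_or_ge (2 * ε) t with ht2 | ht2
  · have : smoothPosPart ε =ᶠ[𝓝 t] fun s => s := by
      filter_upwards [lt_mem_nhds ht2] with s hs
      exact smoothPosPart_of_two_mul_le hε hs.le
    rw [this.deriv_eq, deriv_id'', abs_one]
    linarith
  have h2 : HasDerivAt (fun y : ℝ => ε⁻¹ * y - 1) (ε⁻¹ * 1) t :=
    ((hasDerivAt_id t).const_mul ε⁻¹).sub_const 1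
  have h3 := (hasDerivAt_id t).mul ((hasDerivAt_smoothTransition (ε⁻¹ * t - 1)).comp t h2)
  have h4 : deriv (smoothPosPart ε) t = 1 * Real.smoothTransition (ε⁻¹ * t - 1) +
      t * (deriv Real.smoothTransition (ε⁻¹ * t - 1) * (ε⁻¹ * 1)) := h3.deriv
  rw [h4, one_mul, mul_one]
  refine (abs_add_le _ _).trans (add_le_add ?_ ?_)
  · rw [abs_of_nonneg (Real.smoothTransition.nonneg _)]
    exact Real.smoothTransition.le_one _
  · have h5 : t * (deriv Real.smoothTransition (ε⁻¹ * t - 1) * ε⁻¹)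
        = (ε⁻¹ * t) * deriv Real.smoothTransition (ε⁻¹ * t - 1) := by ring
    have h6 : ε⁻¹ * t ≤ 2 := by
      rw [inv_mul_le_iff₀ hε]
      linarith
    have h7 : 0 ≤ ε⁻¹ * t := by positivity
    rw [h5, abs_mul, abs_of_nonneg h7]
    exact mul_le_mul h6 (abs_deriv_smoothTransition_le _) (abs_nonneg _) (by norm_num)

/-- Lower bound for the dual energy of a film by means of the test function `(α w(x) - y)⁺`. -/
theorem mul_integral_le_of_isTest {h w : ℝ → ℝ} {α M C A : ℝ} (hα : 0 < α) (hα1 : α ≤ 1)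
    (hA : 0 ≤ A) (hd : dualEnergy (filmAndSubstrate h) ≤ ENNReal.ofReal A)
    (hw : IsTest {x | 0 < h x} w) (hw0 : ∀ x, 0 ≤ w x) (hwh : ∀ x, w x ≤ h x)
    (hwM : ∀ x, w x ≤ M) (hwC : ∫ x, deriv w x ^ 2 ≤ C) :
    α * ∫ x, w x ≤ (1 + 2 * transitionBound) ^ 2 * A + α ^ 3 * M * C := by
  set k := 1 + 2 * transitionBound with hk
  have hk0 : 0 < k := by
    have := transitionBound_pos
    positivity
  have hM0 : 0 ≤ M := (hw0 0).trans (hwM 0)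
  have key : ∀ ε : ℝ, 0 < ε → α * (∫ x, w x) ≤
      k ^ 2 * A + α ^ 3 * M * C + 4 * ε * volume.real (tsupport w) := by
    intro ε hε
    -- Equal to $1$ for $y\ge0$, this cutoff only makes the support compact from below.
    let χ : ℝ × ℝ → ℝ := fun p => Real.smoothTransition (1 + 2 * ε⁻¹ * p.2)
    have hχs : ContDiff ℝ ∞ χ := Real.smoothTransition.contDiff.comp
      (contDiff_const.add (contDiff_const.mul contDiff_snd))
    have hχ1 : ∀ p : ℝ × ℝ, 0 ≤ p.2 → χ p = 1 := fun p hp =>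
      Real.smoothTransition.one_of_one_le (by
        have : 0 ≤ 2 * ε⁻¹ * p.2 := by positivity
        linarith)
    let θ : ℝ × ℝ → ℝ := fun p => smoothPosPart ε (α * w p.1 - p.2)
    have hθs : ContDiff ℝ ∞ θ := (contDiff_smoothPosPart ε).comp
      ((contDiff_const.mul (hw.1.comp contDiff_fst)).sub contDiff_snd)
    have hlarge : ∀ p, χ p * θ p ≠ 0 →
        p ∈ (tsupport w ×ˢ Icc (-(ε / 2)) M) ∩ {p : ℝ × ℝ | p.2 ≤ α * w p.1 - ε} := by
      intro p hp
      have h1 : -(ε / 2) < p.2 := by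
        by_contra hlt
        refine left_ne_zero_of_mul hp (Real.smoothTransition.zero_of_nonpos ?_)
        have h2 : 2 * ε⁻¹ * p.2 ≤ 2 * ε⁻¹ * (-(ε / 2)) := by
          have := not_lt.1 hlt
          gcongr
        have h3 : 2 * ε⁻¹ * (-(ε / 2)) = -1 := by field_simp
        linarith
      have h2 : ε < α * w p.1 - p.2 := by
        by_contra hlt
        exact right_ne_zero_of_mul hp (smoothPosPart_eq_zero hε (not_lt.1 hlt))
      have h3 : w p.1 ≠ 0 := fun h3 => by
        rw [h3] at h2
        linarith
      have h4 : α * w p.1 ≤ M := (mul_le_of_le_one_left (hw0 _) hα1).trans (hwM _)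
      refine ⟨⟨subset_tsupport _ h3, h1.le, by linarith⟩, ?_⟩
      change p.2 ≤ α * w p.1 - ε
      linarith
    have hclosed : IsClosed {p : ℝ × ℝ | p.2 ≤ α * w p.1 - ε} :=
      isClosed_le continuous_snd (by
        have := hw.continuous
        fun_prop)
    have hcompact : IsCompact ((tsupport w ×ˢ Icc (-(ε / 2)) M) ∩
        {p : ℝ × ℝ | p.2 ≤ α * w p.1 - ε}) :=
      (hw.2.isCompact.prod isCompact_Icc).inter_right hclosed
    have hts : tsupport (fun p => χ p * θ p) ⊆ (tsupport w ×ˢ Icc (-(ε / 2)) M) ∩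
        {p : ℝ × ℝ | p.2 ≤ α * w p.1 - ε} := closure_minimal hlarge hcompact.isClosed
    have hψ : IsTest (filmAndSubstrate h) (fun p => χ p * θ p) := by
      refine ⟨hχs.mul hθs, HasCompactSupport.intro hcompact fun p hp =>
        by_contra fun h' => hp (hlarge p h'), fun p hp => ?_⟩
      obtain ⟨⟨h1, -⟩, h2⟩ := hts hp
      refine ⟨hw.3 h1, ?_⟩
      have h3 : p.2 ≤ α * w p.1 - ε := h2
      have h4 : α * w p.1 ≤ h p.1 := (mul_le_of_le_one_left (hw0 _) hα1).trans (hwh _)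
      linarith
    have hθd : ∀ p, HasFDerivAt θ (deriv (smoothPosPart ε) (α * w p.1 - p.2) •
        (α • (deriv w p.1 • ContinuousLinearMap.fst ℝ ℝ ℝ) - ContinuousLinearMap.snd ℝ ℝ ℝ)) p := by
      intro p
      have h1 : HasFDerivAt (fun p : ℝ × ℝ => w p.1) (deriv w p.1 • ContinuousLinearMap.fst ℝ ℝ ℝ) p :=
        (hw.differentiable p.1).hasDerivAt.comp_hasFDerivAt p hasFDerivAt_fst
      have h2 : HasFDerivAt (fun p : ℝ × ℝ => α * w p.1 - p.2)
          (α • (deriv w p.1 • ContinuousLinearMap.fst ℝ ℝ ℝ) - ContinuousLinearMap.snd ℝ ℝ ℝ) p :=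
        (h1.const_mul α).sub hasFDerivAt_snd
      exact ((contDiff_smoothPosPart ε).differentiable (by simp) _).hasDerivAt.comp_hasFDerivAt p h2
    have hgrad : ∀ p : ℝ × ℝ, 0 < p.2 → fderiv ℝ (fun p => χ p * θ p) p (1, 0) ^ 2 +
        fderiv ℝ (fun p => χ p * θ p) p (0, 1) ^ 2
        = deriv (smoothPosPart ε) (α * w p.1 - p.2) ^ 2 * (1 + α ^ 2 * deriv w p.1 ^ 2) := by
      intro p hp
      have h1 : (fun p => χ p * θ p) =ᶠ[𝓝 p] θ := by
        filter_upwards [(isOpen_lt continuous_const continuous_snd).mem_nhds hp] with q hq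
        rw [hχ1 q (le_of_lt hq), one_mul]
      rw [h1.fderiv_eq, (hθd p).fderiv]
      simp
      ring
    have hN : ∫ p in {p : ℝ × ℝ | 0 < p.2}, (fderiv ℝ (fun p => χ p * θ p) p (1, 0) ^ 2 +
        fderiv ℝ (fun p => χ p * θ p) p (0, 1) ^ 2)
        ≤ k ^ 2 * (α * (∫ x, w x) + α ^ 3 * M * C) := by
      have i0 := hψ.integrable_sq_grad
      have i1 : IntegrableOn (fun p => fderiv ℝ (fun p => χ p * θ p) p (1, 0) ^ 2 +
          fderiv ℝ (fun p => χ p * θ p) p (0, 1) ^ 2) (univ ×ˢ Ioi 0)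
          ((volume : Measure ℝ).prod (volume : Measure ℝ)) := by
        rw [← Measure.volume_eq_prod]
        exact i0.integrableOn
      have i1' := i1
      rw [IntegrableOn, ← Measure.prod_restrict, Measure.restrict_univ] at i1'
      have jw : Integrable w volume := hw.integrable volume
      have jw2 : Integrable (fun x => w x * deriv w x ^ 2) volume := by
        refine Continuous.integrable_of_hasCompactSupport
          (hw.continuous.mul (hw.isTest_deriv.continuous.pow 2)) ?_
        exact hw.2.mul_right
      have jd : Integrable (fun x => deriv w x ^ 2) volume :=
        (hw.isTest_deriv.memLp 2 volume).integrable_sq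
      -- Over $x$ the gradient is nonzero only for $y\le\alpha w(x)$, and its square there is at
      -- most $k^2(1+\alpha^2w'^2)$.
      have hslice : ∀ x, ∫ y in Ioi (0 : ℝ), (fderiv ℝ (fun p => χ p * θ p) (x, y) (1, 0) ^ 2 +
          fderiv ℝ (fun p => χ p * θ p) (x, y) (0, 1) ^ 2)
          ≤ k ^ 2 * (α * w x + α ^ 3 * (w x * deriv w x ^ 2)) := by
        intro x
        set c := k ^ 2 * (1 + α ^ 2 * deriv w x ^ 2) with hc
        have hc0 : 0 ≤ c := by positivity
        have haw : 0 ≤ α * w x := mul_nonneg hα.le (hw0 x)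
        calc _ ≤ ∫ y in Ioi (0 : ℝ), (Ioc 0 (α * w x)).indicator (fun _ => c) y := by
              refine integral_mono_of_nonneg (Eventually.of_forall fun y => by positivity) ?_ ?_
              · exact ((integrable_indicator_iff measurableSet_Ioc).2
                  (integrableOn_const (by simp))).integrableOn
              · rw [EventuallyLE, ae_restrict_iff' measurableSet_Ioi]
                refine Eventually.of_forall fun y hy => ?_
                rw [hgrad (x, y) hy]
                simp only
                by_cases hy' : y ≤ α * w x
                · rw [indicator_of_mem (show y ∈ Ioc 0 (α * w x) from ⟨hy, hy'⟩), hc]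
                  refine mul_le_mul_of_nonneg_right ?_ (by positivity)
                  exact sq_le_sq' (by linarith [(abs_le.1 (abs_deriv_smoothPosPart_le hε
                    (α * w x - y))).1]) (abs_le.1 (abs_deriv_smoothPosPart_le hε _)).2
                · have h1 : smoothPosPart ε =ᶠ[𝓝 (α * w x - y)] fun _ => 0 := by
                    filter_upwards [gt_mem_nhds (show α * w x - y < ε by linarith)] with s hs
                    exact smoothPosPart_eq_zero hε hs.le
                  rw [indicator_of_notMem (fun h' => hy' h'.2), h1.deriv_eq, deriv_const]
                  simp
          _ = (α * w x) * c := by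
              have hint : Ioc 0 (α * w x) ∩ Ioi 0 = Ioc 0 (α * w x) :=
                inter_eq_left.2 fun y hy => hy.1
              rw [integral_indicator measurableSet_Ioc, Measure.restrict_restrict measurableSet_Ioc,
                hint]
              simp [haw]
          _ = _ := by
              rw [hc]
              ring
      rw [upperHalf_eq, Measure.volume_eq_prod, setIntegral_prod _ i1, Measure.restrict_univ]
      calc _ ≤ ∫ x, k ^ 2 * (α * w x + α ^ 3 * (w x * deriv w x ^ 2)) :=
            integral_mono i1'.integral_prod_left
              (((jw.const_mul α).add (jw2.const_mul _)).const_mul _) hslice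
        _ = k ^ 2 * (α * (∫ x, w x) + α ^ 3 * ∫ x, w x * deriv w x ^ 2) := by
            rw [integral_const_mul, integral_add (jw.const_mul α) (jw2.const_mul _),
              integral_const_mul, integral_const_mul]
        _ ≤ k ^ 2 * (α * (∫ x, w x) + α ^ 3 * M * C) := by
            have h1 : ∫ x, w x * deriv w x ^ 2 ≤ M * C := by
              calc ∫ x, w x * deriv w x ^ 2 ≤ ∫ x, M * deriv w x ^ 2 :=
                    integral_mono jw2 (jd.const_mul M) fun x =>
                      mul_le_mul_of_nonneg_right (hwM x) (sq_nonneg _)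
                _ = M * ∫ x, deriv w x ^ 2 := integral_const_mul _ _
                _ ≤ M * C := by gcongr
            rw [mul_assoc (α ^ 3)]
            gcongr
    have hA1 : α * (∫ x, w x) - 2 * ε * volume.real (tsupport w) ≤ ∫ x, χ (x, 0) * θ (x, 0) := by
      have e1 : ∀ x, χ (x, 0) * θ (x, 0) = smoothPosPart ε (α * w x) := fun x => by
        rw [hχ1 _ le_rfl, one_mul]
        simp [θ]
      simp_rw [e1]
      have hz : ∀ x, x ∉ tsupport w → smoothPosPart ε (α * w x) = 0 := fun x hx => by
        rw [image_eq_zero_of_notMem_tsupport hx, mul_zero, smoothPosPart_eq_zero hε hε.le]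
      have hfin : volume (tsupport w) ≠ ⊤ := hw.2.isCompact.measure_lt_top.ne
      rw [← setIntegral_eq_integral_of_forall_compl_eq_zero hz, ← setIntegral_tsupport (F := w),
        ← integral_const_mul]
      have h2 : ∫ _ in tsupport w, (2 * ε) = 2 * ε * volume.real (tsupport w) := by
        simp [mul_comm]
      rw [← h2, ← integral_sub ((hw.integrable volume).integrableOn.const_mul α)
        (integrableOn_const hfin)]
      refine integral_mono (((hw.integrable volume).integrableOn.const_mul α).sub
        (integrableOn_const hfin)) ?_ fun x => sub_le_smoothPosPart hε
      have hcs : Continuous fun x => smoothPosPart ε (α * w x) :=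
        (contDiff_smoothPosPart ε).continuous.comp (continuous_const.mul hw.continuous)
      exact hcs.continuousOn.integrableOn_compact hw.2.isCompact
    -- The factor $k^{-2}$ offsets the constant in the gradient bound: of the two copies of
    -- $\alpha\int w$ in the linear term, one absorbs the quadratic term and one survives.
    have h1 := (hψ.smul (k ^ 2)⁻¹).le_dualEnergy.trans hd
    rw [ENNReal.ofReal_le_ofReal_iff hA, dualValue_smul hψ] at h1
    set a := ∫ x, χ (x, 0) * θ (x, 0)
    set N := ∫ p in {p : ℝ × ℝ | 0 < p.2}, (fderiv ℝ (fun p => χ p * θ p) p (1, 0) ^ 2 +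
        fderiv ℝ (fun p => χ p * θ p) p (0, 1) ^ 2)
    have h2 : 2 * a - (k ^ 2)⁻¹ * N ≤ k ^ 2 * A := by
      have h3 : 2 * a - (k ^ 2)⁻¹ * N = k ^ 2 * (2 * (k ^ 2)⁻¹ * a - (k ^ 2)⁻¹ ^ 2 * N) := by
        field_simp
      rw [h3]
      gcongr
    have h4 : (k ^ 2)⁻¹ * N ≤ α * (∫ x, w x) + α ^ 3 * M * C := by
      rw [inv_mul_le_iff₀ (by positivity)]
      exact hN
    linarith
  have hlim : Tendsto (fun ε : ℝ => k ^ 2 * A + α ^ 3 * M * C + 4 * ε * volume.real (tsupport w))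
      (𝓝[>] 0) (𝓝 (k ^ 2 * A + α ^ 3 * M * C + 4 * 0 * volume.real (tsupport w))) :=
    (Continuous.tendsto (by fun_prop) 0).mono_left nhdsWithin_le_nhds
  rw [mul_zero, zero_mul, add_zero] at hlim
  exact ge_of_tendsto hlim (eventually_nhdsWithin_of_forall fun ε hε => key ε hε)

/-- A film of small height that carries volume has large energy. -/
theorem IsProfile.mul_integral_min_le {V : ℝ} {h : ℝ → ℝ} (hh : IsProfile V h) {α M A : ℝ}
    (hα : 0 < α) (hα1 : α ≤ 1) (hM : 0 < M) (hA : 0 ≤ A)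
    (hd : dualEnergy (filmAndSubstrate h) ≤ ENNReal.ofReal A) :
    α * ∫ x, min (h x) M ≤ (1 + 2 * transitionBound) ^ 2 * A +
      α ^ 3 * M * (surfaceEnergy h).toReal := by
  choose w hw hw0 hw1 hw2 hwC using fun n : ℕ =>
    hh.exists_smooth_approx hM (Nat.one_div_pos_of_nat (n := n) (α := ℝ))
  have hlim : Tendsto (fun n => ∫ x, w n x) atTop (𝓝 (∫ x, min (h x) M)) := by
    refine tendsto_integral_of_dominated_convergence h
      (fun n => (hw n).continuous.aestronglyMeasurable) hh.2.2.1
      (fun n => Eventually.of_forall fun x => ?_) (Eventually.of_forall fun x => ?_)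
    · rw [Real.norm_of_nonneg (hw0 n x)]
      exact (hw1 n x).trans (min_le_left _ _)
    · have h1 : Tendsto (fun n : ℕ => min (h x) M - 1 / ((n : ℝ) + 1)) atTop
          (𝓝 (min (h x) M - 0)) := tendsto_const_nhds.sub tendsto_one_div_add_atTop_nhds_zero_nat
      rw [sub_zero] at h1
      exact tendsto_of_tendsto_of_tendsto_of_le_of_le h1 tendsto_const_nhds
        (fun n => hw2 n x) (fun n => hw1 n x)
  refine le_of_tendsto (hlim.const_mul α) (Eventually.of_forall fun n => ?_)
  exact mul_integral_le_of_isTest hα hα1 hA hd (hw n) (hw0 n)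
    (fun x => (hw1 n x).trans (min_le_left _ _)) (fun x => (hw1 n x).trans (min_le_right _ _)) (hwC n)

/-! ### The limit energy under scaling, translation and truncation -/

theorem isProfile_of_hasCompactSupport {V C : ℝ} {h : ℝ → ℝ} (hc : Continuous h)
    (hs : HasCompactSupport h) (h0 : ∀ x, 0 ≤ h x) (hC : 0 ≤ C) (hb : SlopeBound h C)
    (hV : ∫ x, h x = V) : IsProfile V h :=
  ⟨MemH1Line.of_slopeBound hc (hc.memLp_of_hasCompactSupport hs) hC hb, h0,
    hc.integrable_of_hasCompactSupport hs, hV⟩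

theorem limitEnergy_eq {h : ℝ → ℝ} (hc : Continuous h) :
    limitEnergy h = dualEnergy ({x | 0 < h x} ×ˢ univ) + surfaceEnergy h := by
  rw [limitEnergy, stripEnergy_eq_dualEnergy (isOpen_lt continuous_const hc)]

/-- The energy of an amplified profile on an affinely transformed axis. -/
theorem limitEnergy_affine_le {h : ℝ → ℝ} (hh : MemH1Line h) {a b : ℝ} (ha : 0 < a) (hb : 0 < b)
    (c : ℝ) : SlopeBound (fun x => a * h (b * x + c)) (a ^ 2 * b * (surfaceEnergy h).toReal) ∧
      limitEnergy (fun x => a * h (b * x + c))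
        ≤ ENNReal.ofReal (b⁻¹ ^ 2) * dualEnergy ({x | 0 < h x} ×ˢ univ) +
          ENNReal.ofReal (a ^ 2 * b) * surfaceEnergy h := by
  have hc : Continuous fun x => a * h (b * x + c) := by
    have := hh.1
    fun_prop
  have h1 : SlopeBound (fun x => a * h (b * x + c)) (a ^ 2 * b * (surfaceEnergy h).toReal) := by
    have h2 := (hh.slopeBound.comp_sub_right ENNReal.toReal_nonneg hh.1 (-c)).rescale a hb
    simpa using h2
  refine ⟨h1, ?_⟩
  rw [limitEnergy_eq hc]
  refine add_le_add ?_ ?_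
  · refine le_trans (le_of_eq ?_) (dualEnergy_affine_le hb c)
    congr 2
    ext x
    exact mul_pos_iff_of_pos_left ha
  · rw [← ENNReal.ofReal_toReal (surfaceEnergy_ne_top hh), ← ENNReal.ofReal_mul (by positivity),
      surfaceEnergy_le_iff hc.locallyIntegrable (by positivity)]
    exact h1

theorem HasCompactSupport.affine {h : ℝ → ℝ} (hs : HasCompactSupport h) (a : ℝ) {b : ℝ}
    (hb : 0 < b) (c : ℝ) : HasCompactSupport fun x => a * h (b * x + c) := by
  refine HasCompactSupport.intro (hs.isCompact.image (f := fun x => b⁻¹ * (x - c)) (by fun_prop))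
    fun x hx => ?_
  rw [image_eq_zero_of_notMem_tsupport fun h' => hx ⟨_, h', by field_simp; ring⟩, mul_zero]

theorem integral_affine (h : ℝ → ℝ) (a : ℝ) {b : ℝ} (hb : 0 < b) (c : ℝ) :
    ∫ x, a * h (b * x + c) = a * b⁻¹ * ∫ x, h x := by
  have h1 := Measure.integral_comp_mul_left (fun x => h (x + c)) b
  rw [abs_of_pos (inv_pos.2 hb), smul_eq_mul, integral_add_right_eq_self] at h1
  rw [integral_const_mul, h1, mul_assoc]

/-- The exponents $3/5$ and $2/5$ are those for which volume is divided by $V$ and both energies by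
the same power $V^{4/5}$. -/
theorem IsProfile.rescaled {W V : ℝ} (hV : 0 < V) {h : ℝ → ℝ} (hh : IsProfile W h)
    (hs : HasCompactSupport h) :
    IsProfile (W / V) (rescaled V h) ∧ HasCompactSupport (Film.rescaled V h) ∧
      limitEnergy (Film.rescaled V h) ≤ ENNReal.ofReal (V ^ (-(4 / 5) : ℝ)) * limitEnergy h := by
  have ha : 0 < V ^ (-(3 / 5) : ℝ) := Real.rpow_pos_of_pos hV _
  have hb : 0 < V ^ (2 / 5 : ℝ) := Real.rpow_pos_of_pos hV _
  have e1 : (V ^ (2 / 5 : ℝ))⁻¹ ^ 2 = V ^ (-(4 / 5) : ℝ) := by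
    rw [← Real.rpow_neg hV.le, ← Real.rpow_natCast, ← Real.rpow_mul hV.le]
    norm_num
  have e2 : (V ^ (-(3 / 5) : ℝ)) ^ 2 * V ^ (2 / 5 : ℝ) = V ^ (-(4 / 5) : ℝ) := by
    rw [← Real.rpow_natCast, ← Real.rpow_mul hV.le, ← Real.rpow_add hV]
    norm_num
  have e3 : V ^ (-(3 / 5) : ℝ) * (V ^ (2 / 5 : ℝ))⁻¹ = V⁻¹ := by
    rw [← Real.rpow_neg hV.le, ← Real.rpow_add hV, ← Real.rpow_neg_one]
    norm_num
  have he : Film.rescaled V h = fun x => V ^ (-(3 / 5) : ℝ) * h (V ^ (2 / 5 : ℝ) * x + 0) := by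
    ext x
    rw [add_zero]
    rfl
  obtain ⟨h1, h2⟩ := limitEnergy_affine_le hh.1 ha hb 0
  rw [← he] at h1 h2
  have hsc : HasCompactSupport (Film.rescaled V h) := by
    rw [he]
    exact HasCompactSupport.affine hs _ hb 0
  have hc : Continuous (Film.rescaled V h) := by
    rw [he]
    have := hh.1.1
    fun_prop
  refine ⟨isProfile_of_hasCompactSupport hc hsc (fun x => mul_nonneg ha.le (hh.2.1 _))
    (mul_nonneg (by positivity) ENNReal.toReal_nonneg) h1 ?_, hsc, h2.trans (le_of_eq ?_)⟩
  · rw [he, integral_affine h _ hb, e3, hh.2.2.2, inv_mul_eq_div]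
  · rw [limitEnergy_eq hh.1.1, e1, e2, mul_add]

/-- The strip term depends only on $\{h>0\}$ and does not change; the surface term gains $t^2$. With
$t\ge1$ both are covered by $t^2$. -/
theorem IsProfile.const_mul {W : ℝ} {h : ℝ → ℝ} (hh : IsProfile W h)
    (hs : HasCompactSupport h) {t : ℝ} (ht : 1 ≤ t) :
    IsProfile (t * W) (fun x => t * h x) ∧ HasCompactSupport (fun x => t * h x) ∧
      limitEnergy (fun x => t * h x) ≤ ENNReal.ofReal (t ^ 2) * limitEnergy h := by
  have ht0 : 0 < t := one_pos.trans_le ht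
  obtain ⟨h1, h2⟩ := limitEnergy_affine_le hh.1 ht0 one_pos 0
  have hsc := HasCompactSupport.affine hs t one_pos 0
  simp only [one_mul, add_zero] at h1 h2 hsc
  refine ⟨isProfile_of_hasCompactSupport (continuous_const.mul hh.1.1) hsc
    (fun x => mul_nonneg ht0.le (hh.2.1 _))
    (mul_nonneg (by positivity) ENNReal.toReal_nonneg) h1 ?_, hsc, h2.trans ?_⟩
  · rw [integral_const_mul, hh.2.2.2]
  · rw [limitEnergy_eq hh.1.1, mul_add, mul_one]
    gcongr
    rw [inv_one]
    exact ht

theorem IsProfile.comp_add_right {W : ℝ} {h : ℝ → ℝ} (hh : IsProfile W h)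
    (hs : HasCompactSupport h) (c : ℝ) :
    IsProfile W (fun x => h (x + c)) ∧ HasCompactSupport (fun x => h (x + c)) ∧
      limitEnergy (fun x => h (x + c)) ≤ limitEnergy h := by
  obtain ⟨h1, h2⟩ := limitEnergy_affine_le hh.1 one_pos one_pos c
  have hsc := HasCompactSupport.affine hs 1 one_pos c
  simp only [one_mul] at h1 h2 hsc
  have hc : Continuous fun x => h (x + c) := hh.1.1.comp (continuous_add_const c)
  refine ⟨isProfile_of_hasCompactSupport hc hsc (fun x => hh.2.1 _)
    (mul_nonneg (by positivity) ENNReal.toReal_nonneg) h1 ?_, hsc, h2.trans ?_⟩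
  · rw [integral_add_right_eq_self, hh.2.2.2]
  · rw [limitEnergy_eq hh.1.1]
    simp

/-- Lowering a profile by $\delta$ makes its support compact and replaces the strip by the one over
the superlevel set, without raising the surface energy. -/
theorem IsProfile.sub_posPart {W : ℝ} {h : ℝ → ℝ} (hh : IsProfile W h) {δ : ℝ} (hδ : 0 < δ) :
    IsProfile (W - ∫ x, min (h x) δ) (fun x => max (h x - δ) 0) ∧
      HasCompactSupport (fun x => max (h x - δ) 0) ∧
      limitEnergy (fun x => max (h x - δ) 0)
        ≤ dualEnergy ({x | δ < h x} ×ˢ univ) + surfaceEnergy h := by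
  have hc : Continuous fun x => max (h x - δ) 0 := by
    have := hh.1.1
    fun_prop
  have hb : SlopeBound (fun x => max (h x - δ) 0) (surfaceEnergy h).toReal :=
    hh.1.slopeBound.comp_contraction (f := fun a => max (a - δ) 0) ENNReal.toReal_nonneg hh.1.1
      fun a b => by
        refine (abs_max_sub_max_le_max _ _ _ _).trans ?_
        rw [sub_self, abs_zero, max_eq_left (abs_nonneg _), sub_sub_sub_cancel_right]
  obtain ⟨R, hR, hRh⟩ := hh.exists_forall_lt hδ
  have hs : HasCompactSupport fun x => max (h x - δ) 0 := by
    refine HasCompactSupport.intro (isCompact_Icc (a := -R) (b := R)) fun x hx => ?_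
    refine max_eq_right (sub_nonpos.2 (hRh x ?_).le)
    by_contra hlt
    exact hx (abs_le.1 (not_le.1 hlt).le)
  have him : Integrable (fun x => min (h x) δ) volume := by
    refine hh.2.2.1.mono' (hh.1.1.min continuous_const).aestronglyMeasurable
      (Eventually.of_forall fun x => ?_)
    rw [Real.norm_of_nonneg (le_min (hh.2.1 x) hδ.le)]
    exact min_le_left _ _
  refine ⟨isProfile_of_hasCompactSupport hc hs (fun x => le_max_right _ _) ENNReal.toReal_nonneg hb
    ?_, hs, ?_⟩
  · rw [← hh.2.2.2, ← integral_sub hh.2.2.1 him]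
    refine integral_congr_ae (Eventually.of_forall fun x => ?_)
    simp only
    rcases le_total (h x) δ with h1 | h1
    · rw [max_eq_right (by linarith), min_eq_left h1, sub_self]
    · rw [max_eq_left (by linarith), min_eq_right h1]
  · rw [limitEnergy_eq hc]
    refine add_le_add (le_of_eq ?_) ?_
    · congr 2
      ext x
      change 0 < max (h x - δ) 0 ↔ δ < h x
      simp
    · rw [← ENNReal.ofReal_toReal (surfaceEnergy_ne_top hh.1),
        surfaceEnergy_le_iff hc.locallyIntegrable ENNReal.toReal_nonneg]
      exact hb

/-! ### The minimal limit energy -/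

/-- The infimum of the limit functional over the profiles of volume one with compact support. -/
def minLimitEnergy : ℝ≥0∞ :=
  ⨅ (g : ℝ → ℝ) (_ : IsProfile 1 g ∧ HasCompactSupport g), limitEnergy g

theorem minLimitEnergy_le {g : ℝ → ℝ} (hg : IsProfile 1 g) (hs : HasCompactSupport g) :
    minLimitEnergy ≤ limitEnergy g :=
  iInf₂_le (f := fun g (_ : IsProfile 1 g ∧ HasCompactSupport g) => limitEnergy g) g ⟨hg, hs⟩

theorem IsProfile.tendsto_integral_min {W : ℝ} {h : ℝ → ℝ} (hh : IsProfile W h) :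
    Tendsto (fun n : ℕ => ∫ x, min (h x) (1 / ((n : ℝ) + 1))) atTop (𝓝 0) := by
  have h1 : ∫ _ : ℝ, (0 : ℝ) = 0 := integral_zero _ _
  rw [← h1]
  refine tendsto_integral_of_dominated_convergence h
    (fun n => (hh.1.1.min continuous_const).aestronglyMeasurable) hh.2.2.1
    (fun n => Eventually.of_forall fun x => ?_) (Eventually.of_forall fun x => ?_)
  · rw [Real.norm_of_nonneg (le_min (hh.2.1 x) (by positivity))]
    exact min_le_left _ _
  · exact tendsto_of_tendsto_of_tendsto_of_le_of_le tendsto_const_nhds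
      tendsto_one_div_add_atTop_nhds_zero_nat (fun n => le_min (hh.2.1 x) (by positivity))
      (fun n => min_le_right _ _)

/-- Compact support is no restriction: the profile is lowered by $1/(n+1)$ and multiplied up to
volume one, and the multiplier tends to $1$. -/
theorem minLimitEnergy_le_limitEnergy {g : ℝ → ℝ} (hg : IsProfile 1 g) :
    minLimitEnergy ≤ limitEnergy g := by
  by_cases htop : limitEnergy g = ⊤
  · rw [htop]
    exact le_top
  have h1 := hg.tendsto_integral_min
  set m : ℕ → ℝ := fun n => ∫ x, min (g x) (1 / ((n : ℝ) + 1)) with hm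
  have hm0 : ∀ n, 0 ≤ m n := fun n => integral_nonneg fun x => le_min (hg.2.1 x) (by positivity)
  have hev : ∀ᶠ n in atTop, minLimitEnergy ≤ ENNReal.ofReal ((1 - m n)⁻¹ ^ 2) * limitEnergy g := by
    filter_upwards [h1.eventually (gt_mem_nhds one_pos)] with n hn
    obtain ⟨k1, k2, k3⟩ := hg.sub_posPart (δ := 1 / ((n : ℝ) + 1)) (by positivity)
    have hv : 0 < 1 - m n := by linarith
    obtain ⟨l1, l2, l3⟩ := k1.const_mul k2 (t := (1 - m n)⁻¹)
      ((one_le_inv₀ hv).2 (by linarith [hm0 n]))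
    rw [inv_mul_cancel₀ hv.ne'] at l1
    refine (minLimitEnergy_le l1 l2).trans (l3.trans ?_)
    gcongr
    rw [limitEnergy_eq hg.1.1]
    refine k3.trans ?_
    gcongr
    refine dualEnergy_mono (prod_mono_left fun x hx => ?_)
    have h2 : 1 / ((n : ℝ) + 1) < g x := hx
    exact (by positivity : (0 : ℝ) < 1 / ((n : ℝ) + 1)).trans h2
  have hlim : Tendsto (fun n => ENNReal.ofReal ((1 - m n)⁻¹ ^ 2) * limitEnergy g) atTop
      (𝓝 (ENNReal.ofReal ((1 - 0)⁻¹ ^ 2) * limitEnergy g)) := by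
    refine ENNReal.Tendsto.mul_const (ENNReal.tendsto_ofReal ?_) (Or.inr htop)
    exact ((tendsto_const_nhds.sub h1).inv₀ (by norm_num)).pow 2
  simp only [sub_zero, inv_one, one_pow, ENNReal.ofReal_one, one_mul] at hlim
  exact ge_of_tendsto hlim hev

theorem minLimitEnergy_ne_top : minLimitEnergy ≠ ⊤ := by
  let f : ContDiffBump (0 : ℝ) := ⟨1, 2, one_pos, one_lt_two⟩
  set ρ := f.normed volume with hρ
  have hρt : IsTest univ ρ := ⟨f.contDiff_normed, f.hasCompactSupport_normed, subset_univ _⟩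
  have hw : HasWeakDeriv univ 1 ρ (deriv ρ) :=
    hasWeakDeriv_of_eq_integral hρt.isTest_deriv.continuous.locallyIntegrable hρt.continuous
      fun a b => (intervalIntegral.integral_deriv_eq_sub
        (fun x _ => hρt.differentiable x)
        (hρt.isTest_deriv.continuous.intervalIntegrable _ _)).symm
  have hP : IsProfile 1 ρ := ⟨⟨hρt.continuous, hρt.memLp 2 volume, _, hw,
    hρt.isTest_deriv.memLp 2 volume⟩, fun x => f.nonneg_normed x, hρt.integrable volume,
    f.integral_normed⟩
  refine ne_top_of_le_ne_top ?_ (minLimitEnergy_le hP hρt.2)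
  rw [limitEnergy_eq hρt.continuous]
  refine ENNReal.add_ne_top.2 ⟨?_, surfaceEnergy_ne_top hP.1⟩
  refine ne_top_of_le_ne_top ENNReal.ofReal_ne_top (dualEnergy_strip_le
    (measurableSet_lt measurable_const hρt.continuous.measurable) (L := 4) (by norm_num) ?_)
  have h1 : {x | 0 < ρ x} ⊆ Ioo (-2) 2 := by
    intro x hx
    have h2 : x ∈ Function.support ρ := ne_of_gt hx
    rw [f.support_normed_eq, Real.ball_eq_Ioo] at h2
    simpa [f] using h2
  refine (measure_mono h1).trans ?_
  rw [Real.volume_Ioo]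
  norm_num

/-- On an interval of length $(h(x)/2)^2/C$ to the right of $x$ the function stays above $h(x)/2$,
so it carries mass at least $h(x)^3/(8C)$. -/
theorem pow_three_le_of_sq_sub_le {h : ℝ → ℝ} {C m : ℝ} (hC : 0 < C) (hi : Integrable h volume)
    (h0 : ∀ x, 0 ≤ h x) (hs : ∀ x y, (h x - h y) ^ 2 ≤ C * |x - y|) (hm : ∫ x, h x ≤ m) (x : ℝ) :
    h x ^ 3 ≤ 8 * C * m := by
  set r := (h x / 2) ^ 2 / C with hr
  have hr0 : 0 ≤ r := by positivity
  have h1 : ∀ y ∈ Ioc x (x + r), h x / 2 ≤ h y := by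
    intro y hy
    have h2 : (h x - h y) ^ 2 ≤ (h x / 2) ^ 2 := by
      refine (hs x y).trans ?_
      rw [abs_sub_comm, abs_of_nonneg (by linarith [hy.1])]
      calc C * (y - x) ≤ C * r := by
            gcongr
            linarith [hy.2]
        _ = (h x / 2) ^ 2 := by
            rw [hr]
            field_simp
    have := abs_le_of_sq_le_sq' h2 (by linarith [h0 x])
    linarith [this.2]
  have h3 : r * (h x / 2) ≤ ∫ y in Ioc x (x + r), h y := by
    have h2 : ∫ _ in Ioc x (x + r), (h x / 2) = r * (h x / 2) := by
      simp [hr0]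
    rw [← h2]
    exact setIntegral_mono_on (by simp) hi.integrableOn measurableSet_Ioc h1
  have h4 : ∫ y in Ioc x (x + r), h y ≤ m :=
    (setIntegral_le_integral hi (Eventually.of_forall h0)).trans hm
  have h5 : r * (h x / 2) = h x ^ 3 / (8 * C) := by
    rw [hr]
    field_simp
    norm_num
  rw [h5] at h3
  have h6 := h3.trans h4
  rw [div_le_iff₀ (by positivity)] at h6
  linarith

theorem dualEnergy_filmAndSubstrate_le (h : ℝ → ℝ) :
    dualEnergy (filmAndSubstrate h) ≤ dualEnergy ({x | 0 < h x} ×ˢ univ) :=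
  dualEnergy_mono fun _ hp => ⟨hp.1, mem_univ _⟩

/-- A profile of volume one and energy at most $e\le1/8$ satisfies $g\le1$, so all of it counts as
thin for $M=1$. The thin-film estimate with $\alpha=1$ gives $1\le(k+1)e$, which $e\le1/(k+2)$
excludes. -/
theorem minLimitEnergy_pos : 0 < minLimitEnergy := by
  set k := (1 + 2 * transitionBound) ^ 2 with hk
  have hk0 : 0 ≤ k := sq_nonneg _
  set e : ℝ := min (1 / 8) (1 / (k + 2)) with he
  have he0 : 0 < e := by positivity
  refine (ENNReal.ofReal_pos.2 he0).trans_le (le_iInf₂ fun g hg => ?_)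
  by_contra hlt
  have hlt' := (not_le.1 hlt).le
  rw [limitEnergy_eq hg.1.1.1] at hlt'
  have hS : surfaceEnergy g ≤ ENNReal.ofReal e := le_add_self.trans hlt'
  have hD := (dualEnergy_filmAndSubstrate_le g).trans (le_self_add.trans hlt')
  have hSr : (surfaceEnergy g).toReal ≤ e := ENNReal.toReal_le_of_le_ofReal he0.le hS
  have hsb := (surfaceEnergy_le_iff hg.1.1.1.locallyIntegrable he0.le).1 hS
  have hle1 : ∀ x, g x ≤ 1 := by
    intro x
    have h1 := pow_three_le_of_sq_sub_le he0 hg.1.2.2.1 hg.1.2.1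
      (fun x y => hsb.sq_sub_le he0.le hg.1.1.1 x y) hg.1.2.2.2.le x
    have h2 : e ≤ 1 / 8 := min_le_left _ _
    refine (pow_le_one_iff_of_nonneg (hg.1.2.1 x) three_ne_zero).1 ?_
    linarith
  have h1 := hg.1.mul_integral_min_le one_pos le_rfl one_pos he0.le hD
  have h2 : ∫ x, min (g x) 1 = 1 :=
    (integral_congr_ae (Eventually.of_forall fun x => min_eq_left (hle1 x))).trans hg.1.2.2.2
  rw [h2] at h1
  have h3 : e ≤ 1 / (k + 2) := min_le_right _ _
  rw [le_div_iff₀ (by positivity)] at h3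
  linarith

/-- Rescaling to volume one. The exponent $4/5<1$ is what will penalize splitting the mass. -/
theorem IsProfile.mul_minLimitEnergy_le {v : ℝ} {g : ℝ → ℝ} (hg : IsProfile v g)
    (hs : HasCompactSupport g) (hv : 0 < v) :
    ENNReal.ofReal (v ^ (4 / 5 : ℝ)) * minLimitEnergy ≤ limitEnergy g := by
  obtain ⟨h1, h2, h3⟩ := hg.rescaled hv hs
  rw [div_self hv.ne'] at h1
  calc _ ≤ ENNReal.ofReal (v ^ (4 / 5 : ℝ)) *
        (ENNReal.ofReal (v ^ (-(4 / 5) : ℝ)) * limitEnergy g) := by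
        gcongr
        exact (minLimitEnergy_le h1 h2).trans h3
    _ = limitEnergy g := by
        rw [← mul_assoc, ← ENNReal.ofReal_mul (by positivity), ← Real.rpow_add hv, add_neg_cancel,
          Real.rpow_zero, ENNReal.ofReal_one, one_mul]

theorem minEnergy_le {V : ℝ} (hV : 0 < V) :
    minEnergy V ≤ ENNReal.ofReal (V ^ (4 / 5 : ℝ)) * minLimitEnergy := by
  unfold minLimitEnergy
  rw [ENNReal.mul_iInf_of_ne (ENNReal.ofReal_pos.2 (Real.rpow_pos_of_pos hV _)).ne'
    ENNReal.ofReal_ne_top]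
  refine le_iInf fun g => ?_
  rw [ENNReal.mul_iInf_of_ne (ENNReal.ofReal_pos.2 (Real.rpow_pos_of_pos hV _)).ne'
    ENNReal.ofReal_ne_top]
  refine le_iInf fun hg => ?_
  obtain ⟨h1, h2, h3⟩ := hg.1.rescaled (inv_pos.2 hV) hg.2
  rw [one_div, inv_inv] at h1
  refine (minEnergy_le_limitEnergy h1 h2).trans (h3.trans (le_of_eq ?_))
  rw [Real.inv_rpow hV.le, Real.rpow_neg hV.le, inv_inv]

/-! ### Concentration of almost minimizers on one component -/

/-- The zeros nearest to $m$ on either side; if $g(m)=0$ they coincide and the interval is empty. -/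
theorem exists_zeros_around {g : ℝ → ℝ} (hc : Continuous g) (hs : HasCompactSupport g)
    (h0 : ∀ x, 0 ≤ g x) (m : ℝ) :
    ∃ a b, a ≤ m ∧ m ≤ b ∧ g a = 0 ∧ g b = 0 ∧ ∀ x ∈ Ioo a b, 0 < g x := by
  obtain ⟨R, hR, hRs⟩ := HasCompactSupport.exists_Ioo hs
  have hz : ∀ x, x ∉ Ioo (-R) R → g x = 0 := fun x hx =>
    image_eq_zero_of_notMem_tsupport fun h' => hx (hRs h')
  have hcl : IsClosed {x | g x = 0} := isClosed_eq hc continuous_const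
  have hA : BddAbove (Iic m ∩ {x | g x = 0}) := ⟨m, fun x hx => hx.1⟩
  have hB : BddBelow (Ici m ∩ {x | g x = 0}) := ⟨m, fun x hx => hx.1⟩
  have ha := (isClosed_Iic.inter hcl).csSup_mem (s := Iic m ∩ {x | g x = 0})
    ⟨min m (-R), mem_Iic.2 (min_le_left _ _), hz _ fun h' => (h'.1.trans_le (min_le_right _ _)).false⟩ hA
  have hb := (isClosed_Ici.inter hcl).csInf_mem (s := Ici m ∩ {x | g x = 0})
    ⟨max m R, mem_Ici.2 (le_max_left _ _), hz _ fun h' => (h'.2.trans_le (le_max_right _ _)).false⟩ hB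
  refine ⟨_, _, ha.1, hb.1, ha.2, hb.2, fun x hx => (h0 x).lt_of_ne fun h' => ?_⟩
  rcases le_total x m with hxm | hxm
  · exact (hx.1.trans_le (le_csSup hA ⟨hxm, h'.symm⟩)).false
  · exact (hx.2.trans_le (csInf_le hB ⟨hxm, h'.symm⟩)).false

theorem exists_setIntegral_Iic_eq_half {g : ℝ → ℝ} (hc : Continuous g) (hs : HasCompactSupport g)
    (h0 : ∀ x, 0 ≤ g x) : ∃ m, ∫ x in Iic m, g x = (∫ x, g x) / 2 := by
  obtain ⟨R, hR, hRs⟩ := HasCompactSupport.exists_Ioo hs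
  have hi : Integrable g volume := hc.integrable_of_hasCompactSupport hs
  have h1 : ∀ m, ∫ x in Iic m, g x = ∫ x in (-R)..m, g x := by
    intro m
    rw [← intervalIntegral.integral_Iic_sub_Iic hi.integrableOn hi.integrableOn]
    rw [setIntegral_eq_zero_of_forall_eq_zero (t := Iic (-R)) fun x hx =>
      image_eq_zero_of_notMem_tsupport fun h' => (hx.trans_lt (hRs h').1).false, sub_zero]
  have h2 : ∫ x in (-R)..R, g x = ∫ x, g x :=
    intervalIntegral.integral_eq_integral_of_support_subset
      ((subset_tsupport g).trans (hRs.trans Ioo_subset_Ioc_self))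
  have h3 := intermediate_value_Icc (f := fun m => ∫ x in (-R)..m, g x) (a := -R) (b := R)
    (by linarith) (intervalIntegral.continuous_primitive
      (fun a b => hc.intervalIntegrable a b) _).continuousOn
  have h4 : 0 ≤ ∫ x, g x := integral_nonneg h0
  obtain ⟨m, -, hm⟩ := h3 (a := (∫ x, g x) / 2) ⟨by simpa using div_nonneg h4 zero_le_two, by simp only [h2]; linarith⟩
  exact ⟨m, (h1 m).trans hm⟩

theorem IsProfile.mul_minLimitEnergy_toReal_le {v : ℝ} {g : ℝ → ℝ} (hg : IsProfile v g)
    (hs : HasCompactSupport g) :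
    ENNReal.ofReal (minLimitEnergy.toReal * v ^ (4 / 5 : ℝ)) ≤ limitEnergy g := by
  have hv : 0 ≤ v := hg.2.2.2 ▸ integral_nonneg hg.2.1
  rcases hv.eq_or_lt with rfl | hv
  · rw [Real.zero_rpow (by norm_num), mul_zero, ENNReal.ofReal_zero]
    exact zero_le
  · rw [mul_comm, ENNReal.ofReal_mul (by positivity), ENNReal.ofReal_toReal minLimitEnergy_ne_top]
    exact hg.mul_minLimitEnergy_le hs hv

/-- Cutting a profile at a zero does not increase the limit energy. -/
theorem IsProfile.minLimitEnergy_mul_add_le {v E a : ℝ} {g : ℝ → ℝ} (hg : IsProfile v g)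
    (hs : HasCompactSupport g) (ha : g a = 0) (hE0 : 0 ≤ E)
    (hE : limitEnergy g ≤ ENNReal.ofReal E) :
    minLimitEnergy.toReal * ((∫ x in Iic a, g x) ^ (4 / 5 : ℝ) +
      (v - ∫ x in Iic a, g x) ^ (4 / 5 : ℝ)) ≤ E := by
  have hm1 := hg.1.indicator_Iic ha
  have hm2 := hg.1.indicator_Ioi ha
  have hs1 : HasCompactSupport ((Iic a).indicator g) :=
    hs.mono (support_indicator.trans_subset inter_subset_right)
  have hs2 : HasCompactSupport ((Ioi a).indicator g) :=
    hs.mono (support_indicator.trans_subset inter_subset_right)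
  have hp1 : IsProfile (∫ x in Iic a, g x) ((Iic a).indicator g) :=
    ⟨hm1, fun x => indicator_nonneg (fun y _ => hg.2.1 y) x, hg.2.2.1.indicator measurableSet_Iic,
      integral_indicator measurableSet_Iic⟩
  have hp2 : IsProfile (v - ∫ x in Iic a, g x) ((Ioi a).indicator g) := by
    refine ⟨hm2, fun x => indicator_nonneg (fun y _ => hg.2.1 y) x,
      hg.2.2.1.indicator measurableSet_Ioi, ?_⟩
    rw [integral_indicator measurableSet_Ioi, ← hg.2.2.2, ← compl_Iic,
      ← integral_add_compl (measurableSet_Iic (a := a)) hg.2.2.1]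
    ring
  have hκ : 0 ≤ minLimitEnergy.toReal := ENNReal.toReal_nonneg
  have hn1 : 0 ≤ ∫ x in Iic a, g x := integral_nonneg fun x => hg.2.1 x
  have hn2 : 0 ≤ v - ∫ x in Iic a, g x := hp2.2.2.2 ▸ integral_nonneg hp2.2.1
  rw [← ENNReal.ofReal_le_ofReal_iff hE0, mul_add, ENNReal.ofReal_add (by positivity)
    (by positivity)]
  refine le_trans (add_le_add (hp1.mul_minLimitEnergy_toReal_le hs1)
    (hp2.mul_minLimitEnergy_toReal_le hs2)) (le_trans ?_ hE)
  -- The surface energy splits at the zero, and the strips over the two halves are disjoint, so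
  -- superadditivity of the dual energy applies.
  rw [limitEnergy_eq hm1.1, limitEnergy_eq hm2.1, limitEnergy_eq hg.1.1, add_add_add_comm]
  refine add_le_add ?_ (surfaceEnergy_indicator_add_le hg.1.1 ha)
  refine (dualEnergy_add_le ?_).trans (dualEnergy_mono ?_)
  · rw [Set.disjoint_left]
    intro p hp hq
    have h1 : p.1 ≤ a := mem_Iic.1 <| mem_of_indicator_ne_zero (ne_of_gt (show 0 < (Iic a).indicator g p.1 from hp.1))
    have h2 : a < p.1 := mem_Ioi.1 <| mem_of_indicator_ne_zero (ne_of_gt (show 0 < (Ioi a).indicator g p.1 from hq.1))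
    exact (h1.trans_lt h2).false
  · rintro p (hp | hp)
    · refine ⟨?_, mem_univ _⟩
      exact lt_of_lt_of_le hp.1 (indicator_le_self' (fun y _ => hg.2.1 y) _)
    · refine ⟨?_, mem_univ _⟩
      exact lt_of_lt_of_le hp.1 (indicator_le_self' (fun y _ => hg.2.1 y) _)

/-- Quantitative strict subadditivity, with $x=s/v\le1/2$: $x^{4/5}\ge2^{1/5}x$ because $2x\le1$,
and $(1-x)^{4/5}\ge1-x$. -/
theorem rpow_add_rpow_ge {v s : ℝ} (hv : 0 < v) (hs : 0 ≤ s) (hsv : s ≤ v / 2) :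
    v ^ (4 / 5 : ℝ) * (1 + (2 ^ (1 / 5 : ℝ) - 1) * (s / v))
      ≤ s ^ (4 / 5 : ℝ) + (v - s) ^ (4 / 5 : ℝ) := by
  have key : ∀ x : ℝ, 0 ≤ x → x ≤ 1 → x ≤ x ^ (4 / 5 : ℝ) := fun x h0 h1 => by
    have := Real.rpow_le_rpow_of_exponent_ge' h0 h1 (z := 4 / 5) (y := 1) (by norm_num)
      (by norm_num)
    rwa [Real.rpow_one] at this
  set x := s / v with hx
  have hx0 : 0 ≤ x := by positivity
  have hx1 : x ≤ 1 / 2 := by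
    rw [hx, div_le_iff₀ hv]
    linarith
  have e1 : s = v * x := by
    rw [hx]
    field_simp
  have e2 : v - s = v * (1 - x) := by
    rw [e1]
    ring
  rw [e2, Real.mul_rpow hv.le (by linarith), e1, Real.mul_rpow hv.le hx0, ← mul_add]
  refine mul_le_mul_of_nonneg_left ?_ (by positivity)
  have h1 := key (1 - x) (by linarith) (by linarith)
  have h2 := key (2 * x) (by linarith) (by linarith)
  rw [Real.mul_rpow zero_le_two hx0] at h2
  have h3 : (2 : ℝ) ^ (1 / 5 : ℝ) * 2 ^ (4 / 5 : ℝ) = 2 := by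
    rw [← Real.rpow_add two_pos]
    norm_num
  have h4 : (0 : ℝ) < 2 ^ (4 / 5 : ℝ) := by positivity
  have h5 : (2 : ℝ) ^ (1 / 5 : ℝ) * x ≤ x ^ (4 / 5 : ℝ) := by
    refine le_of_mul_le_mul_left ?_ h4
    calc (2 : ℝ) ^ (4 / 5 : ℝ) * (2 ^ (1 / 5 : ℝ) * x) = 2 * x := by
          rw [← mul_assoc, mul_comm ((2 : ℝ) ^ (4 / 5 : ℝ)), h3]
      _ ≤ _ := h2
  linarith

/-- A bound for the mass which a profile of volume `v` and limit energy at most `E` can have off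
its main component. -/
def massDefect (v E : ℝ) : ℝ :=
  v * ((E / (minLimitEnergy.toReal * v ^ (4 / 5 : ℝ)) - 1) / (2 ^ (1 / 5 : ℝ) - 1))

theorem minLimitEnergy_toReal_pos : 0 < minLimitEnergy.toReal :=
  ENNReal.toReal_pos minLimitEnergy_pos.ne' minLimitEnergy_ne_top

theorem le_massDefect {v E s : ℝ} (hv : 0 < v) (hs : 0 ≤ s) (hsv : s ≤ v / 2)
    (h : minLimitEnergy.toReal * (s ^ (4 / 5 : ℝ) + (v - s) ^ (4 / 5 : ℝ)) ≤ E) :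
    s ≤ massDefect v E := by
  have hκ := minLimitEnergy_toReal_pos
  have h1 : (0 : ℝ) < 2 ^ (1 / 5 : ℝ) - 1 :=
    sub_pos.2 (Real.one_lt_rpow one_lt_two (by norm_num))
  have hvp : 0 < v ^ (4 / 5 : ℝ) := Real.rpow_pos_of_pos hv _
  have h2 := (mul_le_mul_of_nonneg_left (rpow_add_rpow_ge hv hs hsv) hκ.le).trans h
  rw [← mul_assoc, mul_comm, ← le_div_iff₀ (by positivity)] at h2
  have h3 : s / v ≤ (E / (minLimitEnergy.toReal * v ^ (4 / 5 : ℝ)) - 1) / (2 ^ (1 / 5 : ℝ) - 1) := by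
    rw [le_div_iff₀ h1]
    linarith
  rw [div_le_iff₀ hv] at h3
  rw [massDefect]
  linarith

theorem tendsto_massDefect {v E : ℕ → ℝ} (hv : Tendsto v atTop (𝓝 1))
    (hE : Tendsto E atTop (𝓝 minLimitEnergy.toReal)) :
    Tendsto (fun n => massDefect (v n) (E n)) atTop (𝓝 0) := by
  have hκ := minLimitEnergy_toReal_pos
  have h1 : Tendsto (fun n => v n ^ (4 / 5 : ℝ)) atTop (𝓝 1) := by
    simpa using hv.rpow_const (p := 4 / 5) (Or.inl one_ne_zero)
  have h2 := hv.mul (((hE.div (h1.const_mul minLimitEnergy.toReal)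
    (by simpa using hκ.ne')).sub_const 1).div_const (2 ^ (1 / 5 : ℝ) - 1))
  simpa [massDefect, hκ.ne'] using h2

/-- The main component of a compactly supported profile. -/
theorem IsProfile.exists_main_component {v E : ℝ} {g : ℝ → ℝ} (hg : IsProfile v g)
    (hs : HasCompactSupport g) (hv : 0 < v) (hE0 : 0 ≤ E)
    (hE : limitEnergy g ≤ ENNReal.ofReal E) :
    ∃ a b, a ≤ b ∧ g a = 0 ∧ g b = 0 ∧ ∫ x in Iic a, g x ≤ massDefect v E ∧
      ∫ x in Ioi b, g x ≤ massDefect v E ∧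
      (b - a) ^ 2 * (min 1 (dualEnergy (Ioo 0 1 ×ˢ univ))).toReal ≤ E := by
  -- The component of the median leaves at most half of the mass on either side, as `le_massDefect`
  -- demands of the smaller piece.
  obtain ⟨m, hm⟩ := exists_setIntegral_Iic_eq_half hg.1.1 hs hg.2.1
  obtain ⟨a, b, ham, hmb, ha, hb, hpos⟩ := exists_zeros_around hg.1.1 hs hg.2.1 m
  have hmono : ∀ c d, c ≤ d → ∫ x in Iic c, g x ≤ ∫ x in Iic d, g x := fun c d hcd =>
    setIntegral_mono_set hg.2.2.1.integrableOn (Eventually.of_forall hg.2.1)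
      (Iic_subset_Iic.2 hcd).eventuallyLE
  rw [hg.2.2.2] at hm
  have h1 : ∫ x in Ioi b, g x = v - ∫ x in Iic b, g x := by
    rw [← hg.2.2.2, ← compl_Iic, ← integral_add_compl (measurableSet_Iic (a := b)) hg.2.2.1]
    ring
  have h2 : 0 ≤ ∫ x in Ioi b, g x := integral_nonneg fun x => hg.2.1 x
  refine ⟨a, b, ham.trans hmb, ha, hb, ?_, ?_, ?_⟩
  · exact le_massDefect hv (integral_nonneg fun x => hg.2.1 x) ((hmono a m ham).trans hm.le)
      (hg.minLimitEnergy_mul_add_le hs ha hE0 hE)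
  · refine le_massDefect hv h2 ?_ ?_
    · linarith [hmono m b hmb]
    · have h3 := hg.minLimitEnergy_mul_add_le hs hb hE0 hE
      rw [h1, sub_sub_cancel, add_comm]
      exact h3
  · rcases (ham.trans hmb).eq_or_lt with rfl | hab
    · simpa using hE0
    -- The minimum with $1$ guarantees a finite number, so that `toReal` loses nothing.
    · rw [← ENNReal.ofReal_le_ofReal_iff hE0, ENNReal.ofReal_mul (sq_nonneg _),
        ENNReal.ofReal_toReal (ne_top_of_le_ne_top ENNReal.one_ne_top (min_le_left _ _))]
      refine le_trans ?_ ((ofReal_mul_dualEnergy_unit_le (I := {x | 0 < g x}) (a := a)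
        (sub_pos.2 hab) fun x hx => hpos x ⟨hx.1, by linarith [hx.2]⟩).trans ?_)
      · gcongr
        exact min_le_right _ _
      · rw [limitEnergy_eq hg.1.1] at hE
        exact le_self_add.trans hE

/-! ### Compactness and lower semicontinuity -/

/-- Arzelà–Ascoli for functions with a common Hölder bound which are uniformly small off a fixed
interval. -/
theorem exists_subseq_tendsto_of_sq_sub_le {G : ℕ → ℝ → ℝ} {B C L : ℝ} {η : ℕ → ℝ}
    (h0 : ∀ n x, 0 ≤ G n x) (hB : ∀ n x, G n x ≤ B) (hG : ∀ n, Continuous (G n))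
    (hs : ∀ n x y, (G n x - G n y) ^ 2 ≤ C * |x - y|)
    (hη : Tendsto η atTop (𝓝 0)) (ht : ∀ n, ∀ x ∉ Icc 0 L, G n x ^ 3 ≤ η n) :
    ∃ (φ : ℕ → ℕ) (H : ℝ → ℝ), StrictMono φ ∧ (∀ x ∉ Icc 0 L, H x = 0) ∧
      ∀ ε > 0, ∀ᶠ k in atTop, ∀ x, |G (φ k) x - H x| ≤ ε := by
  let F : ℕ → BoundedContinuousFunction (Icc (0 : ℝ) L) ℝ := fun n =>
    BoundedContinuousFunction.mkOfCompact ⟨fun x => G n x, (hG n).comp continuous_subtype_val⟩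
  have hK : IsCompact (closure (range F)) := by
    refine BoundedContinuousFunction.arzela_ascoli (Icc 0 B) isCompact_Icc (range F) ?_ ?_
    · rintro _ x ⟨n, rfl⟩
      exact ⟨h0 n x, hB n x⟩
    · refine Metric.equicontinuous_of_continuity_modulus (fun t => √(C * t)) ?_ _ ?_
      · have h1 : Continuous fun t : ℝ => √(C * t) := by fun_prop
        simpa using h1.tendsto 0
      · rintro x y ⟨_, n, rfl⟩
        exact Real.abs_le_sqrt (hs n x y)
  obtain ⟨f, -, φ, hφ, hf⟩ := hK.tendsto_subseq fun n => subset_closure (mem_range_self n)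
  classical
  refine ⟨φ, fun x => if hx : x ∈ Icc 0 L then f ⟨x, hx⟩ else 0, hφ, fun x hx => dif_neg hx,
    fun ε hε => ?_⟩
  have h2 : ∀ᶠ k in atTop, dist (F (φ k)) f < ε := (Metric.tendsto_nhds.1 hf) ε hε
  have h3 : ∀ᶠ k in atTop, η (φ k) < ε ^ 3 :=
    (hη.comp hφ.tendsto_atTop).eventually (gt_mem_nhds (by positivity))
  filter_upwards [h2, h3] with k hk2 hk3 x
  by_cases hx : x ∈ Icc 0 L
  · rw [dif_pos hx]
    exact (BoundedContinuousFunction.dist_coe_le_dist (f := F (φ k)) (g := f) ⟨x, hx⟩).trans hk2.le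
  · rw [dif_neg hx, sub_zero, abs_of_nonneg (h0 _ x)]
    exact (lt_of_pow_lt_pow_left₀ 3 hε.le ((ht _ x hx).trans_lt hk3)).le

/-- Lower semicontinuity of the limit energy. -/
theorem limitEnergy_le_of_tendsto {G : ℕ → ℝ → ℝ} {H : ℝ → ℝ} {E : ℕ → ℝ} {B e : ℝ}
    (hG : ∀ n, Continuous (G n)) (hH : Continuous H) (hB : ∀ n x, |G n x| ≤ B)
    (hE0 : ∀ n, 0 ≤ E n) (hE : ∀ n, limitEnergy (G n) ≤ ENNReal.ofReal (E n))
    (hEe : Tendsto E atTop (𝓝 e))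
    (hu : ∀ ε > 0, ∀ᶠ k in atTop, ∀ x, |G k x - H x| ≤ ε) : limitEnergy H ≤ ENNReal.ofReal e := by
  have hpt : ∀ x, Tendsto (fun k => G k x) atTop (𝓝 (H x)) := fun x =>
    Metric.tendsto_atTop'.2 fun ε hε => by
      obtain ⟨N, hN⟩ := eventually_atTop.1 (hu (ε / 2) (half_pos hε))
      exact ⟨N, fun n hn => (hN n hn.le x).trans_lt (half_lt_self hε)⟩
  rw [limitEnergy_eq hH, dualEnergy, ENNReal.biSup_add' ⟨0, IsTest.zero⟩]
  refine iSup₂_le fun ψ hψ => ?_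
  -- For one fixed $\psi$ the strip term is bounded below by the number $a$, and the surface term of
  -- $G_k$ by what the budget leaves, $E_k-a$. Only the slope bound has to pass to the limit; the
  -- supremum over $\psi$ is taken outside.
  set a := max (dualValue ψ) 0 with ha
  have ha0 : 0 ≤ a := le_max_right _ _
  have hev : ∀ᶠ k in atTop, a ≤ E k ∧ SlopeBound (G k) (E k - a) := by
    have hK : IsCompact (Prod.fst '' tsupport ψ) := hψ.2.isCompact.image continuous_fst
    -- $H$ is bounded below by some $c>0$ on the projection of the support of $\psi$, so uniform
    -- convergence makes $\psi$ admissible for the strip of $G_k$.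
    obtain ⟨c, hc0, hc⟩ := hK.exists_forall_le' (f := H) hH.continuousOn (a := 0) (by
      rintro _ ⟨p, hp, rfl⟩
      exact (hψ.3 hp).1)
    filter_upwards [hu (c / 2) (half_pos hc0)] with k hk
    have hψk : IsTest ({x | 0 < G k x} ×ˢ univ) ψ := by
      refine ⟨hψ.1, hψ.2, fun p hp => ⟨?_, mem_univ _⟩⟩
      have h1 := hc _ ⟨p, hp, rfl⟩
      have h2 := (abs_le.1 (hk p.1)).1
      change 0 < G k p.1
      linarith
    have h3 : ENNReal.ofReal a + surfaceEnergy (G k) ≤ ENNReal.ofReal (E k) := by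
      refine le_trans ?_ (hE k)
      rw [limitEnergy_eq (hG k)]
      gcongr
      rw [ha, ENNReal.ofReal_max, ENNReal.ofReal_zero, max_eq_left zero_le]
      exact hψk.le_dualEnergy
    have h4 : a ≤ E k := (ENNReal.ofReal_le_ofReal_iff (hE0 k)).1 (le_self_add.trans h3)
    refine ⟨h4, (surfaceEnergy_le_iff (hG k).locallyIntegrable (sub_nonneg.2 h4)).1 ?_⟩
    rw [ENNReal.ofReal_sub _ ha0]
    exact ENNReal.le_sub_of_add_le_left ENNReal.ofReal_ne_top h3
  have hae : a ≤ e := ge_of_tendsto hEe (hev.mono fun k hk => hk.1)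
  have hS : SlopeBound H (e - a) := by
    intro φ hφ
    have h1 : Tendsto (fun k => ∫ x, G k x * deriv φ x) atTop (𝓝 (∫ x, H x * deriv φ x)) := by
      refine tendsto_integral_of_dominated_convergence (fun x => B * |deriv φ x|)
        (fun n => ((hG n).mul hφ.isTest_deriv.continuous).aestronglyMeasurable)
        ((hφ.isTest_deriv.integrable volume).abs.const_mul B)
        (fun n => Eventually.of_forall fun x => ?_)
        (Eventually.of_forall fun x => (hpt x).mul_const _)
      rw [Real.norm_eq_abs, abs_mul]
      exact mul_le_mul_of_nonneg_right (hB n x) (abs_nonneg _)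
    exact le_of_tendsto_of_tendsto (h1.pow 2) ((hEe.sub_const a).mul_const _)
      (hev.mono fun k hk => hk.2 φ hφ)
  have h5 := (surfaceEnergy_le_iff hH.locallyIntegrable (sub_nonneg.2 hae)).2 hS
  calc ENNReal.ofReal (dualValue ψ) + surfaceEnergy H
      ≤ ENNReal.ofReal a + ENNReal.ofReal (e - a) := by
        gcongr
        exact le_max_left _ _
    _ = ENNReal.ofReal e := by
        rw [← ENNReal.ofReal_add ha0 (sub_nonneg.2 hae), add_sub_cancel]

theorem IsProfile.pow_three_le {v E : ℝ} {g : ℝ → ℝ} (hg : IsProfile v g) (hE0 : 0 < E)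
    (hE : surfaceEnergy g ≤ ENNReal.ofReal E) {m : ℝ} (hm : v ≤ m) (x : ℝ) :
    g x ^ 3 ≤ 8 * E * m :=
  pow_three_le_of_sq_sub_le hE0 hg.2.2.1 hg.2.1 (fun x y =>
    ((surfaceEnergy_le_iff hg.1.1.locallyIntegrable hE0.le).1 hE).sq_sub_le hE0.le hg.1.1 x y)
    (hg.2.2.2.le.trans hm) x

/-- The constant in the lower bound of the dual energy of an interval. -/
def unitStripBound : ℝ := (min 1 (dualEnergy (Ioo 0 1 ×ˢ univ))).toReal

theorem unitStripBound_pos : 0 < unitStripBound :=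
  ENNReal.toReal_pos (lt_min one_pos dualEnergy_unit_pos).ne'
    (ne_top_of_le_ne_top ENNReal.one_ne_top (min_le_left _ _))

/-- A translate of a profile is concentrated on an interval starting at the origin. -/
theorem IsProfile.exists_translate {v E l : ℝ} {g : ℝ → ℝ} (hg : IsProfile v g)
    (hs : HasCompactSupport g) (hv : 0 < v) (hE0 : 0 < E)
    (hE : limitEnergy g ≤ ENNReal.ofReal E) (hl0 : 0 ≤ l) (hl : E ≤ l ^ 2 * unitStripBound) :
    ∃ a, (∀ x ∉ Icc 0 l, g (x + a) ^ 3 ≤ 8 * E * massDefect v E) ∧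
      v - ∫ x in Icc 0 l, g (x + a) ≤ 2 * massDefect v E := by
  obtain ⟨a, b, hab, ha, hb, hma, hmb, hlen⟩ := hg.exists_main_component hs hv hE0.le hE
  have hbal : b ≤ a + l := by
    have h1 := le_of_mul_le_mul_right (hlen.trans hl) unitStripBound_pos
    have h2 := abs_le_of_sq_le_sq' h1 hl0
    linarith [h2.2]
  have hS : surfaceEnergy g ≤ ENNReal.ofReal E := by
    rw [limitEnergy_eq hg.1.1] at hE
    exact le_add_self.trans hE
  -- The two outer pieces are profiles of mass at most the defect, so the cubic bound makes them
  -- uniformly small.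
  have hpa : IsProfile (∫ x in Iic a, g x) ((Iic a).indicator g) :=
    ⟨hg.1.indicator_Iic ha, fun x => indicator_nonneg (fun y _ => hg.2.1 y) x,
      hg.2.2.1.indicator measurableSet_Iic, integral_indicator measurableSet_Iic⟩
  have hpb : IsProfile (∫ x in Ioi b, g x) ((Ioi b).indicator g) :=
    ⟨hg.1.indicator_Ioi hb, fun x => indicator_nonneg (fun y _ => hg.2.1 y) x,
      hg.2.2.1.indicator measurableSet_Ioi, integral_indicator measurableSet_Ioi⟩
  refine ⟨a, fun x hx => ?_, ?_⟩
  · rw [mem_Icc, not_and_or, not_le, not_le] at hx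
    rcases hx with hx | hx
    · have h1 := hpa.pow_three_le hE0
        (le_self_add.trans ((surfaceEnergy_indicator_add_le hg.1.1 ha).trans hS)) hma (x + a)
      rwa [indicator_of_mem (mem_Iic.2 (by linarith))] at h1
    · have h1 := hpb.pow_three_le hE0
        (le_add_self.trans ((surfaceEnergy_indicator_add_le hg.1.1 hb).trans hS)) hmb (x + a)
      rwa [indicator_of_mem (mem_Ioi.2 (by linarith))] at h1
  · have hi : Integrable (fun x => g (x + a)) volume := hg.2.2.1.comp_add_right a
    have e1 : v = ∫ x, g (x + a) := by rw [integral_add_right_eq_self, hg.2.2.2]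
    have e2 : v - ∫ x in Icc 0 l, g (x + a) =
        ∫ x, (Icc 0 l)ᶜ.indicator (fun x => g (x + a)) x := by
      rw [e1, ← integral_add_compl (measurableSet_Icc (a := (0 : ℝ)) (b := l)) hi,
        add_sub_cancel_left, ← integral_indicator measurableSet_Icc.compl]
    rw [e2]
    have h2 : ∫ x, ((Iic a).indicator g (x + a) + (Ioi b).indicator g (x + a))
        = (∫ x in Iic a, g x) + ∫ x in Ioi b, g x := by
      rw [integral_add (hpa.2.2.1.comp_add_right a) (hpb.2.2.1.comp_add_right a),
        integral_add_right_eq_self, integral_add_right_eq_self, hpa.2.2.2, hpb.2.2.2]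
    refine (integral_mono (hi.indicator measurableSet_Icc.compl)
      ((hpa.2.2.1.comp_add_right a).add (hpb.2.2.1.comp_add_right a)) fun x => ?_).trans
      (h2.le.trans (by linarith))
    change (Icc 0 l)ᶜ.indicator (fun x => g (x + a)) x ≤
      (Iic a).indicator g (x + a) + (Ioi b).indicator g (x + a)
    have n1 := hpa.2.1 (x + a)
    have n2 := hpb.2.1 (x + a)
    by_cases hx : x ∈ (Icc 0 l)ᶜ
    · rw [indicator_of_mem hx]
      rw [mem_compl_iff, mem_Icc, not_and_or, not_le, not_le] at hx
      rcases hx with hx | hx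
      · rw [indicator_of_mem (mem_Iic.2 (by linarith))]
        linarith
      · rw [indicator_of_mem (s := Ioi b) (mem_Ioi.2 (by linarith))]
        linarith
    · rw [indicator_of_notMem hx]
      linarith

/-- Minimizing sequences of the limit functional are compact up to translations. -/
theorem exists_subseq_tendsto_of_minimizing {g : ℕ → ℝ → ℝ} {v E : ℕ → ℝ}
    (hg : ∀ n, IsProfile (v n) (g n)) (hs : ∀ n, HasCompactSupport (g n)) (hv : ∀ n, 0 < v n)
    (hv1 : Tendsto v atTop (𝓝 1)) (hE0 : ∀ n, 0 < E n)
    (hE : ∀ n, limitEnergy (g n) ≤ ENNReal.ofReal (E n))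
    (hE1 : Tendsto E atTop (𝓝 minLimitEnergy.toReal)) :
    ∃ (φ : ℕ → ℕ) (τ : ℕ → ℝ) (H : ℝ → ℝ), StrictMono φ ∧ IsProfile 1 H ∧
      limitEnergy H ≤ minLimitEnergy ∧
      ∀ ε > 0, ∀ᶠ k in atTop, ∀ x, |g (φ k) (x - τ k) - H x| ≤ ε := by
  obtain ⟨vB, hvB⟩ := hv1.bddAbove_range
  obtain ⟨EB, hEB⟩ := hE1.bddAbove_range
  replace hvB : ∀ n, v n ≤ vB := fun n => hvB (mem_range_self n)
  replace hEB : ∀ n, E n ≤ EB := fun n => hEB (mem_range_self n)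
  have hEB0 : 0 < EB := (hE0 0).trans_le (hEB 0)
  have hvB0 : 0 < vB := (hv 0).trans_le (hvB 0)
  -- The longest main component that the energy bound allows, the same for all $n$.
  set L := √(EB / unitStripBound) with hL
  have hLE : L ^ 2 * unitStripBound = EB := by
    rw [hL, Real.sq_sqrt (div_nonneg hEB0.le unitStripBound_pos.le),
      div_mul_cancel₀ _ unitStripBound_pos.ne']
  choose a ha1 ha2 using fun n => (hg n).exists_translate (hs n) (hv n) (hE0 n) (hE n)
    (Real.sqrt_nonneg _) ((hEB n).trans hLE.ge)
  set G : ℕ → ℝ → ℝ := fun n x => g n (x + a n) with hGdef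
  have hG := fun n => (hg n).comp_add_right (hs n) (a n)
  have hGE : ∀ n, limitEnergy (G n) ≤ ENNReal.ofReal (E n) := fun n => (hG n).2.2.trans (hE n)
  have hGS : ∀ n, surfaceEnergy (G n) ≤ ENNReal.ofReal EB := fun n => by
    have h1 := hGE n
    rw [limitEnergy_eq (hG n).1.1.1] at h1
    exact le_add_self.trans (h1.trans (ENNReal.ofReal_le_ofReal (hEB n)))
  -- The cubic bound gives $G^3\le8E_Bv_B$; where $G>1$ also $G\le G^3$, so $B$ bounds $G$ without
  -- cube roots.
  set B := 1 + 8 * EB * vB with hB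
  have hB0 : 0 ≤ 8 * EB * vB := by positivity
  have hGB : ∀ n x, G n x ≤ B := by
    intro n x
    have h1 := (hG n).1.pow_three_le hEB0 (hGS n) (hvB n) x
    by_contra hlt
    have h2 : 1 + 8 * EB * vB < G n x := not_le.1 hlt
    have h3 : G n x ≤ G n x ^ 3 := le_self_pow₀ (by linarith) three_ne_zero
    have h4 : G n x ^ 3 ≤ 8 * EB * vB := h1
    linarith
  have hη : Tendsto (fun n => 8 * E n * massDefect (v n) (E n)) atTop (𝓝 0) := by
    simpa using (hE1.const_mul 8).mul (tendsto_massDefect hv1 hE1)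
  obtain ⟨φ, H, hφ, hH0, hu⟩ := exists_subseq_tendsto_of_sq_sub_le (G := G) (C := EB) (L := L)
    (fun n x => (hg n).2.1 _) hGB (fun n => (hG n).1.1.1) (fun n x y =>
      ((surfaceEnergy_le_iff (hG n).1.1.1.locallyIntegrable hEB0.le).1 (hGS n)).sq_sub_le hEB0.le
        (hG n).1.1.1 x y) hη ha1
  have hHc : Continuous H := by
    have h1 : TendstoUniformly (fun k => G (φ k)) H atTop := by
      refine Metric.tendstoUniformly_iff.2 fun ε hε => ?_
      filter_upwards [hu (ε / 2) (half_pos hε)] with k hk x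
      rw [dist_comm]
      exact (hk x).trans_lt (half_lt_self hε)
    exact h1.continuous (Eventually.of_forall fun k => (hG (φ k)).1.1.1).frequently
  have hpt : ∀ x, Tendsto (fun k => G (φ k) x) atTop (𝓝 (H x)) := fun x =>
    Metric.tendsto_atTop'.2 fun ε hε => by
      obtain ⟨N, hN⟩ := eventually_atTop.1 (hu (ε / 2) (half_pos hε))
      exact ⟨N, fun n hn => (hN n hn.le x).trans_lt (half_lt_self hε)⟩
  have hHs : HasCompactSupport H := HasCompactSupport.intro isCompact_Icc hH0
  have hHn : ∀ x, 0 ≤ H x := fun x =>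
    ge_of_tendsto (hpt x) (Eventually.of_forall fun k => (hg (φ k)).2.1 _)
  have hHE : limitEnergy H ≤ ENNReal.ofReal minLimitEnergy.toReal :=
    limitEnergy_le_of_tendsto (G := fun k => G (φ k)) (E := fun k => E (φ k)) (B := B)
      (fun k => (hG (φ k)).1.1.1) hHc
      (fun k x => (abs_of_nonneg ((hg (φ k)).2.1 _)).trans_le (hGB _ _)) (fun k => (hE0 _).le)
      (fun k => hGE _) (hE1.comp hφ.tendsto_atTop) hu
  -- No mass escapes: the mass off $[0,L]$ is at most twice the defect, which tends to $0$.
  have hHI : ∫ x, H x = 1 := by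
    have h1 : Tendsto (fun k => ∫ x in Icc 0 L, G (φ k) x) atTop (𝓝 (∫ x in Icc 0 L, H x)) := by
      refine tendsto_integral_of_dominated_convergence (fun _ => B)
        (fun k => (hG (φ k)).1.1.1.aestronglyMeasurable) (integrable_const _)
        (fun k => Eventually.of_forall fun x => ?_) (Eventually.of_forall hpt)
      exact (abs_of_nonneg ((hg (φ k)).2.1 _)).trans_le (hGB _ _)
    have h2 : Tendsto (fun n => ∫ x in Icc 0 L, G n x) atTop (𝓝 1) := by
      have h3 := hv1.sub ((tendsto_massDefect hv1 hE1).const_mul 2)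
      rw [mul_zero, sub_zero] at h3
      refine tendsto_of_tendsto_of_tendsto_of_le_of_le h3 hv1 (fun n => ?_) fun n => ?_
      · have := ha2 n
        simp only [hGdef]
        linarith
      · exact (setIntegral_le_integral (hG n).1.2.2.1 (Eventually.of_forall (hG n).1.2.1)).trans
          (hG n).1.2.2.2.le
    rw [← setIntegral_eq_integral_of_forall_compl_eq_zero (s := Icc 0 L) hH0]
    exact tendsto_nhds_unique h1 (h2.comp hφ.tendsto_atTop)
  refine ⟨φ, fun k => -a (φ k), H, hφ, ?_, ?_, fun ε hε => ?_⟩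
  · refine isProfile_of_hasCompactSupport hHc hHs hHn minLimitEnergy_toReal_pos.le
      ((surfaceEnergy_le_iff hHc.locallyIntegrable minLimitEnergy_toReal_pos.le).1 ?_) hHI
    rw [limitEnergy_eq hHc] at hHE
    exact le_add_self.trans hHE
  · rwa [ENNReal.ofReal_toReal minLimitEnergy_ne_top] at hHE
  · filter_upwards [hu ε hε] with k hk x
    rw [sub_neg_eq_add]
    exact hk x

/-! ### Minimizers of large volume -/

theorem IsProfile.volume_lt_le {V M : ℝ} {h : ℝ → ℝ} (hh : IsProfile V h) (hM : 0 < M) :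
    volume {x | M < h x} ≤ ENNReal.ofReal (V / M) := by
  have h1 := mul_meas_ge_le_integral_of_nonneg (Eventually.of_forall hh.2.1) hh.2.2.1 M
  have h2 : volume {x | M ≤ h x} ≠ ⊤ := (hh.2.2.1.measure_ge_lt_top hM).ne
  refine (measure_mono fun x (hx : M < h x) => hx.le).trans ?_
  rw [hh.2.2.2, mul_comm, ← le_div_iff₀ hM, measureReal_def] at h1
  exact (ENNReal.le_ofReal_iff_toReal_le h2 (ENNReal.toReal_nonneg.trans h1)).2 h1

/-- Weak duality in the film combined with the upper bound for $F_s(V)$. From here on the function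
$u$ plays no role. -/
theorem IsMinimizer.energy_le {V : ℝ} (hV : 0 < V) {u : ℝ × ℝ → ℝ} {h : ℝ → ℝ}
    (hm : IsMinimizer V u h) : dualEnergy (filmAndSubstrate h) + surfaceEnergy h
      ≤ ENNReal.ofReal (minLimitEnergy.toReal * V ^ (4 / 5 : ℝ)) := by
  have h1 := dualEnergy_le_dirichletEnergy (isOpen_filmAndSubstrate hm.1.1.1.1) hm.1.2.2
  rw [upperPart_filmAndSubstrate] at h1
  have h2 := minEnergy_le hV
  rw [← hm.2] at h2
  rw [mul_comm, ENNReal.ofReal_mul (by positivity), ENNReal.ofReal_toReal minLimitEnergy_ne_top]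
  exact (add_le_add_left h1 _).trans h2

/-- The constant in the bound of the volume of the thin part of a minimizer. -/
def thinBound : ℝ := ((1 + 2 * transitionBound) ^ 2 + 1) * minLimitEnergy.toReal

theorem thinBound_nonneg : 0 ≤ thinBound :=
  mul_nonneg (by positivity) ENNReal.toReal_nonneg

/-- Removing the thin part of a minimizer of large volume and rescaling leaves a profile which
almost minimizes the limit functional. -/
theorem IsMinimizer.exists_profile_near {V d : ℝ} (hV : 0 < V) (hd : 0 < d)
    (hα : d⁻¹ * V ^ (-(1 / 5) : ℝ) ≤ 1) {u : ℝ × ℝ → ℝ} {h : ℝ → ℝ} (hm : IsMinimizer V u h) :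
    ∃ v g, IsProfile v g ∧ HasCompactSupport g ∧ 1 - thinBound * d ≤ v ∧ v ≤ 1 ∧
      limitEnergy g ≤ ENNReal.ofReal
        ((1 + transitionBound * (d⁻¹ ^ 6 * V ^ (-(1 / 5) : ℝ))) ^ 2 * minLimitEnergy.toReal) ∧
      ∀ x, |rescaled V h x - g x| ≤ d ^ 3 := by
  set κ := minLimitEnergy.toReal with hκ
  have hκ0 : 0 < κ := minLimitEnergy_toReal_pos
  set r := V ^ (1 / 5 : ℝ) with hr
  have hr0 : 0 < r := Real.rpow_pos_of_pos hV _
  have e0 : V ^ (-(1 / 5) : ℝ) = r⁻¹ := Real.rpow_neg hV.le _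
  have e5 : V = r ^ 5 := by
    rw [hr, ← Real.rpow_natCast, ← Real.rpow_mul hV.le]
    norm_num
  have e4 : V ^ (4 / 5 : ℝ) = r ^ 4 := by
    rw [hr, ← Real.rpow_natCast, ← Real.rpow_mul hV.le]
    norm_num
  have e3 : V ^ (-(3 / 5) : ℝ) = (r ^ 3)⁻¹ := by
    rw [Real.rpow_neg hV.le, hr, ← Real.rpow_natCast, ← Real.rpow_mul hV.le]
    norm_num
  rw [e0] at hα ⊢
  have hE := hm.energy_le hV
  rw [e4] at hE
  have hh := hm.1.1
  have hA : 0 ≤ κ * r ^ 4 := by positivity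
  -- With $r=V^{1/5}$ this is $d^3V^{3/5}$, small on the scale of the film. Together with
  -- $\alpha=d^{-1}r^{-1}$ it gives $\alpha^3M=1$, so both terms of the thin-film estimate are of
  -- order $\kappa r^4$, and division by $\alpha$ gives $O(dV)$.
  set M := d ^ 3 * r ^ 3 with hM
  have hM0 : 0 < M := by positivity
  have hSr : (surfaceEnergy h).toReal ≤ κ * r ^ 4 :=
    ENNReal.toReal_le_of_le_ofReal hA (le_add_self.trans hE)
  have hthin : ∫ x, min (h x) M ≤ thinBound * d * V := by
    have h1 := hh.mul_integral_min_le (α := d⁻¹ * r⁻¹) (by positivity) hα hM0 hA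
      (le_self_add.trans hE)
    have h2 : (d⁻¹ * r⁻¹) ^ 3 * M = 1 := by
      rw [hM]
      field_simp
    rw [h2, one_mul] at h1
    have h3 : d⁻¹ * r⁻¹ * ∫ x, min (h x) M ≤ thinBound * r ^ 4 := by
      rw [thinBound]
      linarith
    calc ∫ x, min (h x) M = d * r * (d⁻¹ * r⁻¹ * ∫ x, min (h x) M) := by field_simp
      _ ≤ d * r * (thinBound * r ^ 4) := by gcongr
      _ = thinBound * d * V := by
        rw [e5]
        ring
  have hthin0 : 0 ≤ ∫ x, min (h x) M := integral_nonneg fun x => le_min (hh.2.1 x) hM0.le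
  obtain ⟨k1, k2, k3⟩ := hh.sub_posPart hM0
  obtain ⟨l1, l2, l3⟩ := k1.rescaled hV k2
  -- Chebyshev's inequality gives $L=V/M$, hence $L/M=V/M^2=d^{-6}r^{-1}$, which tends to $0$ for
  -- fixed $d$ as $V\to\infty$.
  have hT := dualEnergy_superlevel_le (div_pos hV hM0) hM0 (hh.volume_lt_le hM0)
  have eT : transitionBound * (V / M) / M = transitionBound * (d⁻¹ ^ 6 * r⁻¹) := by
    rw [hM, e5]
    field_simp
  rw [eT] at hT
  set T := (1 + transitionBound * (d⁻¹ ^ 6 * r⁻¹)) ^ 2 with hTdef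
  have hT1 : 1 ≤ T := one_le_pow₀ (le_add_of_nonneg_right
    (mul_nonneg transitionBound_pos.le (by positivity)))
  refine ⟨_, _, l1, l2, ?_, ?_, ?_, fun x => ?_⟩
  · rw [le_div_iff₀ hV]
    linarith
  · rw [div_le_one hV]
    linarith
  · calc _ ≤ _ := l3
      _ ≤ ENNReal.ofReal (V ^ (-(4 / 5) : ℝ)) * (ENNReal.ofReal T * ENNReal.ofReal (κ * r ^ 4)) := by
          gcongr
          refine k3.trans (le_trans (add_le_add hT ?_) ((mul_add _ _ _).symm.le.trans
            (mul_le_mul_right hE _)))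
          exact le_mul_of_one_le_left zero_le (ENNReal.one_le_ofReal.2 hT1)
      _ = ENNReal.ofReal (T * κ) := by
          rw [← ENNReal.ofReal_mul (by positivity), ← ENNReal.ofReal_mul (by positivity),
            Real.rpow_neg hV.le, e4]
          congr 1
          field_simp
  · have h1 : rescaled V h x - rescaled V (fun x => max (h x - M) 0) x =
        (r ^ 3)⁻¹ * min (h (V ^ (2 / 5 : ℝ) * x)) M := by
      rw [rescaled, rescaled, e3, ← mul_sub]
      congr 1
      rcases le_total (h (V ^ (2 / 5 : ℝ) * x)) M with h2 | h2
      · rw [max_eq_right (by linarith), min_eq_left h2, sub_zero]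
      · rw [max_eq_left (by linarith), min_eq_right h2, sub_sub_cancel]
    rw [h1, abs_of_nonneg (mul_nonneg (by positivity) (le_min (hh.2.1 _) hM0.le))]
    calc (r ^ 3)⁻¹ * min (h (V ^ (2 / 5 : ℝ) * x)) M ≤ (r ^ 3)⁻¹ * M := by
          gcongr
          exact min_le_right _ _
      _ = d ^ 3 := by
          rw [hM]
          field_simp

theorem eventually_exists_profile_near {V : ℕ → ℝ} (hV : Tendsto V atTop atTop)
    {u : ℕ → ℝ × ℝ → ℝ} {h : ℕ → ℝ → ℝ} (hmin : ∀ n, IsMinimizer (V n) (u n) (h n)) {d ε : ℝ}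
    (hd : 0 < d) (hε : 0 < ε) :
    ∀ᶠ n in atTop, ∃ v g, IsProfile v g ∧ HasCompactSupport g ∧ 1 - thinBound * d ≤ v ∧ v ≤ 1 ∧
      limitEnergy g ≤ ENNReal.ofReal ((1 + ε) * minLimitEnergy.toReal) ∧
      ∀ x, |rescaled (V n) (h n) x - g x| ≤ d ^ 3 := by
  have h1 : Tendsto (fun n => V n ^ (-(1 / 5) : ℝ)) atTop (𝓝 0) :=
    (tendsto_rpow_neg_atTop (by norm_num)).comp hV
  have h2 : Tendsto (fun n => d⁻¹ * V n ^ (-(1 / 5) : ℝ)) atTop (𝓝 0) := by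
    simpa using h1.const_mul d⁻¹
  have h3 : Tendsto (fun n => (1 + transitionBound * (d⁻¹ ^ 6 * V n ^ (-(1 / 5) : ℝ))) ^ 2) atTop
      (𝓝 1) := by
    have h6 := (((h1.const_mul (d⁻¹ ^ 6)).const_mul transitionBound).const_add 1).pow 2
    rwa [mul_zero, mul_zero, add_zero, one_pow] at h6
  have h4 := h2.eventually_lt_const one_pos
  have h5 := h3.eventually_lt_const (lt_add_of_pos_right 1 hε)
  filter_upwards [hV.eventually_gt_atTop 0, h4, h5] with n n1 n2 n3
  obtain ⟨v, g, k1, k2, k3, k4, k5, k6⟩ := (hmin n).exists_profile_near n1 hd n2.le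
  refine ⟨v, g, k1, k2, k3, k4, k5.trans (ENNReal.ofReal_le_ofReal ?_), k6⟩
  exact mul_le_mul_of_nonneg_right n3.le ENNReal.toReal_nonneg

end Film

end

/-! ### The main theorem -/

theorem mainTheorem5 (V : ℕ → ℝ) (hV : Tendsto V atTop atTop)
    (u : ℕ → ℝ × ℝ → ℝ) (h : ℕ → ℝ → ℝ) (hmin : ∀ n, Film.IsMinimizer (V n) (u n) (h n)) :
    ∃ (φ : ℕ → ℕ) (τ : ℕ → ℝ) (h' : ℝ → ℝ), StrictMono φ ∧ Film.IsLimitMinimizer h' ∧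
      Tendsto
        (fun k => eLpNorm
          (fun x => Film.rescaled (V (φ k)) (h (φ k)) (x - τ k) - h' x) ∞ volume)
        atTop (𝓝 0) := by
  have hQ := Film.thinBound_nonneg
  have hκ := Film.minLimitEnergy_toReal_pos
  -- The factor $(\mathrm{thinBound}+1)^{-1}$ keeps the removed fraction of the volume below $1$ for
  -- every $k$, so the truncated profiles have positive volume.
  set d : ℕ → ℝ := fun k => (Film.thinBound + 1)⁻¹ * (1 / ((k : ℝ) + 1)) with hd
  have hd0 : ∀ k, 0 < d k := fun k => by positivity
  have hone : Tendsto (fun k : ℕ => 1 / ((k : ℝ) + 1)) atTop (𝓝 0) :=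
    tendsto_one_div_add_atTop_nhds_zero_nat
  have hdt : Tendsto d atTop (𝓝 0) := by simpa [hd] using hone.const_mul (Film.thinBound + 1)⁻¹
  have hdQ : ∀ k, Film.thinBound * d k < 1 := fun k => by
    have h1 : 1 / ((k : ℝ) + 1) ≤ 1 := by
      rw [div_le_one (by positivity)]
      linarith [(k.cast_nonneg : (0 : ℝ) ≤ k)]
    calc Film.thinBound * d k ≤ Film.thinBound * ((Film.thinBound + 1)⁻¹ * 1) := by
          simp only [hd]
          gcongr
      _ < 1 := by
          rw [mul_one, ← div_eq_mul_inv, div_lt_one (by positivity)]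
          linarith
  -- Diagonal choice: for each $k$ a volume so large that the truncation with parameter $d_k$ costs
  -- at most a factor $1+1/(k+1)$.
  obtain ⟨φ, hφ, hP⟩ := extraction_forall_of_eventually fun k =>
    Film.eventually_exists_profile_near hV hmin (hd0 k) (ε := 1 / ((k : ℝ) + 1)) (by positivity)
  choose v g g1 g2 g3 g4 g5 g6 using hP
  obtain ⟨ψ, τ, H, hψ, hH, hHκ, hu⟩ := Film.exists_subseq_tendsto_of_minimizing g1 g2
    (fun k => by linarith [hdQ k, g3 k])
    (tendsto_of_tendsto_of_tendsto_of_le_of_le (by simpa using (hdt.const_mul _).const_sub 1)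
      tendsto_const_nhds g3 g4)
    (fun k => by positivity) g5
    (by simpa using (hone.const_add 1).mul_const Film.minLimitEnergy.toReal)
  refine ⟨φ ∘ ψ, τ, H, hφ.comp hψ,
    ⟨hH, fun f hf => hHκ.trans (Film.minLimitEnergy_le_limitEnergy hf)⟩, ?_⟩
  refine ENNReal.tendsto_nhds_zero.2 fun ε hε => ?_
  -- The given $\varepsilon$ may be infinite, so a positive real number below it is taken.
  obtain ⟨δ, hδ0, hδε⟩ : ∃ δ : ℝ, 0 < δ ∧ ENNReal.ofReal δ ≤ ε := by
    refine ⟨(min ε 1).toReal, ENNReal.toReal_pos (lt_min hε one_pos).ne'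
      (ne_top_of_le_ne_top ENNReal.one_ne_top (min_le_right _ _)), ?_⟩
    rw [ENNReal.ofReal_toReal (ne_top_of_le_ne_top ENNReal.one_ne_top (min_le_right _ _))]
    exact min_le_left _ _
  have hd3 : Tendsto (fun k => d (ψ k) ^ 3) atTop (𝓝 0) := by
    simpa using (hdt.comp hψ.tendsto_atTop).pow 3
  filter_upwards [hu (δ / 2) (half_pos hδ0), hd3.eventually (gt_mem_nhds (half_pos hδ0))]
    with k hk1 hk2
  rw [eLpNorm_exponent_top]
  refine (eLpNormEssSup_le_of_ae_bound (C := δ) (Eventually.of_forall fun x => ?_)).trans hδε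
  have h1 := g6 (ψ k) (x - τ k)
  have h2 := abs_sub_le (Film.rescaled (V (φ (ψ k))) (h (φ (ψ k))) (x - τ k))
    (g (ψ k) (x - τ k)) (H x)
  have h3 := hk1 x
  rw [Real.norm_eq_abs]
  exact h2.trans (by linarith)
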